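/- **Setting.** Let $d\in\{2,3\}$, $\Omega\subset\mathbb R^d$ a bounded domain, $\partial\Omega=\Gamma_u^D\cup\Gamma_u^N=\Gamma_p^D\cup\Gamma_p^N$ with $\Gamma_u^D,\Gamma_p^D$ closed and of non-zero surface measure. Let the constant tensors $C\in\mathbb R^{d\times d\times d\times d}$ (positive definite on symmetric matrices, $C_{ijkl}=C_{klij}$) and $K\in\mathbb R^{d\times d}$ be symmetric and positive definite, and let $r\ge 2$. Let $\mathcal T_h$ be a decomposition of $\Omega$ into open quadrilaterals ($d=2$) or hexahedra ($d=3$), each the image of $(0,1)^d$ under a $\mathbb Q_1$ map $F_{\mathsf K}$ that is injective and regular on $[0,1]^d$, quasi-uniform with constant $\sigma$: for some $h>0$, $\|DF_{\mathsf K}\|\le\sigma h$ and $h^d\le\sigma|\det DF_{\mathsf K}|$ on $[0,1]^d$ for all elements $\mathsf K$. Let $V_h$ be the space of functions in $H^1(\Omega)^d\cap C(\overline\Omega)^d$ that are mapped $\mathbb Q_r^d$ polynomials on each element, and let $Q_h$ be either $Q_h^{\rm cont}$ (functions in $C(\overline\Omega)$, mapped $\mathbb Q_{r-1}$ on each element)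 or $Q_h^{\rm disc}$ (functions in $L^2(\Omega)$, mapped $\mathbb P_{r-1}$ on each element). Write $\langle\cdot,\cdot\rangle$ for the $L^2(\Omega)$ inner product, $\langle\cdot,\cdot\rangle_S$ for that of $L^2(S)$, $\varepsilon(u)=\frac12(\nabla u+\nabla u^\top)$, $n$ for the outer unit normal, and $h_F=|\mathsf K|$ (the $d$-dimensional measure) for a boundary face $F$ of the element $\mathsf K$, $h_F=\frac12(|\mathsf K^+|+|\mathsf K^-|)$ for an interior face between $\mathsf K^+$ and $\mathsf K^-$. On an interior face $\{w\}=\frac12(w^++w^-)$, $[w]=w^+-w^-$ and $n$ points from $\mathsf K^+$ to $\mathsf K^-$; on boundary faces $\{w\}=[w]=w$. Let $\mathcal F_h$ be the set of all interior and boundary faces. Terms with $h_F$ or with one-sided traces on a boundary part are summed over its faces. **Forms.** With $\rho,\alpha,c_0>0$ and parameters $\gamma_a,\gamma_b,\gamma$, $$a_\gamma(w,\chi)=-\langle w,C\varepsilon(\chi)n\rangle_{\Gamma_u^D}+\tfrac{\gamma_a}{h_F}\langle w,\chi\rangle_{\Gamma_u^D},\quad b_\gamma(q,\psi)=-\langle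 q,K\nabla\psi\cdot n\rangle_{\Gamma_p^D}+\tfrac{\gamma_b}{h_F}\langle q,\psi\rangle_{\Gamma_p^D},$$ $$A_\gamma(w,\chi)=\langle C\varepsilon(w),\varepsilon(\chi)\rangle-\langle C\varepsilon(w)n,\chi\rangle_{\Gamma_u^D}+a_\gamma(w,\chi),\qquad C(\chi,q)=-\alpha\langle\nabla\cdot\chi,q\rangle+\alpha\langle\chi\cdot n,q\rangle_{\Gamma_u^D};$$ for $Q_h=Q_h^{\rm cont}$, $B_\gamma(q,\psi)=\langle K\nabla q,\nabla\psi\rangle-\langle K\nabla q\cdot n,\psi\rangle_{\Gamma_p^D}+b_\gamma(q,\psi)$; for $Q_h=Q_h^{\rm disc}$, $$B_\gamma(q,\psi)=\sum_{\mathsf K}\langle K\nabla q,\nabla\psi\rangle_{\mathsf K}-\sum_{F\in\mathcal F_h}\big(\langle\{K\nabla q\}\cdot n,[\psi]\rangle_F+\langle[q],\{K\nabla\psi\}\cdot n\rangle_F\big)+\sum_{F\in\mathcal F_h}\tfrac{\gamma}{h_F}\langle[q],[\psi]\rangle_F .$$ For data $f,t_N,u_D,g,p_D,p_N$ depending on $t\in[0,T]$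 ($f$, $g$, $t_N$, and for $Q_h^{\rm cont}$ also $p_N$, linear functionals acting on the test functions or on their traces; $p_N\in L^2(\Gamma_p^N)$ for $Q_h^{\rm disc}$; $p_D\in L^2(\Gamma_p^D)$; $u_D$ differentiable in time with values in $L^2(\Gamma_u^D)$, $v_D=\partial_tu_D$) put $F_\gamma(\chi)=\langle f,\chi\rangle-\langle t_N,\chi\rangle_{\Gamma_u^N}+a_\gamma(u_D,\chi)$ and $$G_\gamma(\psi)=\langle g,\psi\rangle-\alpha\langle v_D\cdot n,\psi\rangle_{\Gamma_u^D}-\langle p_N,\psi\rangle_{\Gamma_p^N}+b_\gamma(p_D,\psi)\quad\text{for }Q_h^{\rm cont},$$ $$G_\gamma(\psi)=\langle g,\psi\rangle-\alpha\langle v_D\cdot n,\psi\rangle_{\Gamma_u^D}-\langle p_D,K\nabla\psi\cdot n\rangle_{\Gamma_p^D}+\tfrac{\gamma}{h_F}\langle p_D,\psi\rangle_{\Gamma_p^D}-\langle p_N,\psi\rangle_{\Gamma_p^N}\quad\text{for }Q_h^{\rm disc}.$$ **Discrete problem on $I_n$.** Let $0=t_0<\dots<t_N=T$, $I_n=(t_{n-1},t_n]$,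 $k\ge0$, let $\mathbb P_k(I_n;B)$ be the $B$-valued polynomials of degree at most $k$ on $I_n$, $w^+(t_{n-1})$ the right-sided limit, and $Q_n$ the right-sided $(k+1)$-point Gauss--Radau formula on $I_n$ (exact for polynomials of degree $\le 2k$, with $t_n$ as its last node). Given $u_h^{n-1},v_h^{n-1}\in V_h$, $p_h^{n-1}\in Q_h$, find $(u,v,p)\in\mathbb P_k(I_n;V_h)\times\mathbb P_k(I_n;V_h)\times\mathbb P_k(I_n;Q_h)$ such that for all $(\phi,\chi,\psi)$ in the same space, abbreviating $w^+=w^+(t_{n-1})$, $$Q_n\big(\langle\partial_tu,\phi\rangle-\langle v,\phi\rangle\big)+\langle u^+,\phi^+\rangle=\langle u_h^{n-1},\phi^+\rangle,$$ $$Q_n\big(\langle\rho\partial_tv,\chi\rangle+A_\gamma(u,\chi)+C(\chi,p)\big)+\langle\rho v^+,\chi^+\rangle=Q_n(F_\gamma(\chi))+\langle\rho v_h^{n-1},\chi^+\rangle,$$ $$Q_n\big(\langle c_0\partial_tp,\psi\rangle-C(\partial_tu,\psi)+B_\gamma(p,\psi)\big)+\langle c_0p^++\alpha\nabla\cdot u^+,\psi^+\rangle-\alpha\langle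 u^+\cdot n,\psi^+\rangle_{\Gamma_u^D}$$ $$=Q_n(G_\gamma(\psi))+\langle c_0p_h^{n-1}+\alpha\nabla\cdot u_h^{n-1},\psi^+\rangle-\alpha\langle u_D(t_{n-1})\cdot n,\psi^+\rangle_{\Gamma_u^D}.$$ **Claim.** There is $\gamma_0$, depending only on $\Omega$ and its boundary portions, $d$, $C$, $K$, $r$ and $\sigma$ (not on the particular mesh and its size $h$, nor on $\rho,\alpha,c_0,k$, the time mesh or the data), such that for all $\gamma_a,\gamma_b,\gamma\ge\gamma_0$ and either choice of $Q_h$, the discrete problem on each $I_n$ has one and only one solution $(u,v,p)$. -/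

import Mathlib

open MeasureTheory Set Filter Topology
open scoped ContDiff

noncomputable section

namespace Biot

/-- Euclidean space `ℝ^d`. -/
abbrev E (d : ℕ) : Type := EuclideanSpace ℝ (Fin d)

/-- The `j`-th coordinate vector. -/
def basisVec (d : ℕ) (j : Fin d) : E d := EuclideanSpace.single j 1

/-- Surface measure: the Euclidean (normalized) `(d-1)`-dimensional Hausdorff measure. -/
def surf (d : ℕ) : Measure (E d) := Measure.euclideanHausdorffMeasure (d - 1)

/-! ### Setting: domain, boundary portions, elasticity tensor and permeability -/

/-- A bounded domain `Ω ⊂ ℝ^d` with the Dirichlet and Neumann portions of its boundary for `u` and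
`p`, the constant elasticity tensor `C` and the constant permeability tensor `Kp`, both symmetric
and positive definite. -/
structure Setting (d : ℕ) where
  Ω : Set (E d)
  isOpen : IsOpen Ω
  bounded : Bornology.IsBounded Ω
  connected : IsConnected Ω
  ΓuD : Set (E d)
  ΓuN : Set (E d)
  ΓpD : Set (E d)
  ΓpN : Set (E d)
  bdry_u : frontier Ω = ΓuD ∪ ΓuN
  bdry_p : frontier Ω = ΓpD ∪ ΓpN
  closed_uD : IsClosed ΓuD
  closed_pD : IsClosed ΓpD
  nonzero_uD : surf d ΓuD ≠ 0
  nonzero_pD : surf d ΓpD ≠ 0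
  C : Fin d → Fin d → Fin d → Fin d → ℝ
  C_symm : ∀ i j k l, C i j k l = C k l i j
  C_pos : ∃ k₀ > 0, ∀ ξ : Matrix (Fin d) (Fin d) ℝ, ξ.IsSymm →
    k₀ * ∑ i, ∑ j, ξ i j ^ 2 ≤ ∑ i, ∑ j, ∑ k, ∑ l, ξ i j * C i j k l * ξ k l
  Kp : Matrix (Fin d) (Fin d) ℝ
  Kp_symm : Kp.IsSymm
  Kp_pos : ∃ k₁ > 0, ∀ ξ : Fin d → ℝ,
    k₁ * ∑ i, ξ i ^ 2 ≤ ∑ i, ∑ j, ξ i * Kp i j * ξ j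

/-! ### Meshes of quadrilaterals or hexahedra -/

/-- The closed reference cube `[0,1]^d`. -/
def refCube (d : ℕ) : Set (E d) := {x | ∀ j, x j ∈ Icc (0 : ℝ) 1}

/-- The open reference cube `(0,1)^d`. -/
def refCubeO (d : ℕ) : Set (E d) := {x | ∀ j, x j ∈ Ioo (0 : ℝ) 1}

/-- The multilinear (`ℚ₁`) map taking the vertex `s` of the reference cube to `a s`. -/
def multilin {d : ℕ} (a : (Fin d → Fin 2) → E d) (x : E d) : E d :=
  ∑ s : Fin d → Fin 2, (∏ j, if s j = 1 then x j else 1 - x j) • a s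

/-- A decomposition of `Ω` into finitely many pairwise disjoint open quadrilaterals (`d = 2`) or
hexahedra (`d = 3`), each being the image of the open reference cube under a `ℚ₁` map that is
injective and regular on the closed reference cube. -/
structure Mesh (d : ℕ) (Ω : Set (E d)) where
  num : ℕ
  vert : Fin num → (Fin d → Fin 2) → E d
  injOn : ∀ i, InjOn (multilin (vert i)) (refCube d)
  regular : ∀ i, ∀ x ∈ refCube d, (fderiv ℝ (multilin (vert i)) x).det ≠ 0
  subset : ∀ i, multilin (vert i) '' refCubeO d ⊆ Ω
  disjoint : ∀ i j, i ≠ j →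
    Disjoint (multilin (vert i) '' refCubeO d) (multilin (vert j) '' refCubeO d)
  cover : closure Ω = ⋃ i, closure (multilin (vert i) '' refCubeO d)

namespace Mesh

variable {d : ℕ} {Ω : Set (E d)} (M : Mesh d Ω)

/-- The reference map of the `i`-th element. -/
def map (i : Fin M.num) : E d → E d := multilin (M.vert i)

/-- The `i`-th (open) element. -/
def cell (i : Fin M.num) : Set (E d) := M.map i '' refCubeO d

/-- The union of the (open) elements. -/
def cells : Set (E d) := ⋃ i, M.cell i

/-- The `d`-dimensional measure `|K|_d` of the `i`-th element. -/
def size (i : Fin M.num) : ℝ := (volume (M.cell i)).toReal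

/-- Quasi-uniformity (including shape regularity) with constant `σ`: for some mesh size `h > 0`
all the reference maps satisfy `‖DF‖ ≤ σ h` and `h^d ≤ σ |det DF|`. -/
def QuasiUniform (σ : ℝ) : Prop :=
  ∃ h > 0, ∀ i, ∀ x ∈ refCube d,
    ‖fderiv ℝ (M.map i) x‖ ≤ σ * h ∧ h ^ d ≤ σ * |(fderiv ℝ (M.map i) x).det|

/-- Trace from within the `i`-th element: the limit of `w` from inside that element. -/
def tr {F : Type*} [TopologicalSpace F] (i : Fin M.num) (w : E d → F) : E d → F :=
  extendFrom (M.cell i) w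

/-- The reference coordinates of a point of the `i`-th closed element. -/
def refPt (i : Fin M.num) (x : E d) : E d := Function.invFunOn (M.map i) (refCube d) x

/-- The outer normal direction of the reference cube: `± e_j` in the relative interior of the
faces; on lower-dimensional faces (a null set of the boundary) the sum of the adjacent ones. -/
def refNormal (x : E d) : E d :=
  ∑ j, ((if x j = 1 then (1 : ℝ) else 0) - (if x j = 0 then (1 : ℝ) else 0)) • basisVec d j

/-- The outer unit normal vector of the `i`-th element `K = F((0,1)^d)` at `x = F(ξ) ∈ ∂K`:
the normalization of `DF(ξ)^{-T} ν`, with `ν` the outer normal of the reference cube at `ξ`. -/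
def normal (i : Fin M.num) (x : E d) : E d :=
  let w := ContinuousLinearMap.adjoint (fderiv ℝ (M.map i) (M.refPt i x)).inverse
    (refNormal (M.refPt i x))
  ‖w‖⁻¹ • w

/-- The surface integral over a part `Γ` of `∂Ω`, element by element; the integrand may depend on
the element through one-sided traces, normal vectors and element sizes. -/
def bInt (Γ : Set (E d)) (w : Fin M.num → E d → ℝ) : ℝ :=
  ∑ i, ∫ x in frontier (M.cell i) ∩ Γ, w i x ∂(surf d)

end Mesh

/-! ### Differential operators -/

variable {d : ℕ}

/-- Gradient of a scalar function. -/
def grad (q : E d → ℝ) (x : E d) : Fin d → ℝ := fun j => fderiv ℝ q x (basisVec d j)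

/-- Jacobian matrix `(∂_j v_i)_{ij}` of a vector field. -/
def jac (v : E d → E d) (x : E d) : Matrix (Fin d) (Fin d) ℝ :=
  fun i j => fderiv ℝ v x (basisVec d j) i

/-- Symmetrized gradient `ε(v)`. -/
def strain (v : E d → E d) (x : E d) : Matrix (Fin d) (Fin d) ℝ :=
  (1 / 2 : ℝ) • (jac v x + (jac v x).transpose)

/-- Divergence. -/
def dvg (v : E d → E d) (x : E d) : ℝ := (jac v x).trace

/-- `(C ξ)_{ij} = ∑_{kl} C_{ijkl} ξ_{kl}`. -/
def applyC (C : Fin d → Fin d → Fin d → Fin d → ℝ) (ξ : Matrix (Fin d) (Fin d) ℝ) :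
    Matrix (Fin d) (Fin d) ℝ :=
  fun i j => ∑ k, ∑ l, C i j k l * ξ k l

/-- `(S n) · w` for a matrix `S` and vectors `n`, `w`. -/
def matDot (S : Matrix (Fin d) (Fin d) ℝ) (n w : E d) : ℝ := ∑ i, ∑ j, S i j * n j * w i

/-- `(K g) · n` for a matrix `K` and vectors `g`, `n`. -/
def flux (K : Matrix (Fin d) (Fin d) ℝ) (g : Fin d → ℝ) (n : E d) : ℝ :=
  ∑ i, ∑ j, K i j * g j * n i

/-- `v · w`. -/
def dotE (v w : E d) : ℝ := ∑ i, v i * w i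

/-! ### Finite element spaces -/

/-- `w ∈ H¹(Ω)`: `w` and its weak first-order derivatives are in `L²(Ω)`. -/
def MemH1 (Ω : Set (E d)) (w : E d → ℝ) : Prop :=
  MemLp w 2 (volume.restrict Ω) ∧
    ∀ j, ∃ g : E d → ℝ, MemLp g 2 (volume.restrict Ω) ∧
      ∀ φ : E d → ℝ, ContDiff ℝ ∞ φ → HasCompactSupport φ → tsupport φ ⊆ Ω →
        ∫ x in Ω, w x * fderiv ℝ φ x (basisVec d j) = -∫ x in Ω, g x * φ x

/-- The two families of pressure spaces: globally continuous mapped `ℚ_{r-1}` elements (Taylor--Hood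
family), and discontinuous mapped `ℙ_{r-1}` elements. -/
inductive PressureKind
  | cont
  | disc

/-- `V_h`: functions in `H¹(Ω)^d ∩ C(closure Ω)^d` that are, on each element, mapped `ℚ_r^d`
polynomials. As functions on `ℝ^d` they are extended by `0` outside `closure Ω`. -/
def Vh {Ω : Set (E d)} (M : Mesh d Ω) (r : ℕ) : Set (E d → E d) :=
  {v | (∀ x ∉ closure Ω, v x = 0) ∧ ContinuousOn v (closure Ω) ∧
    (∀ j, MemH1 Ω fun x => v x j) ∧
    ∀ i, ∀ j, ∃ P ∈ MvPolynomial.restrictDegree (Fin d) ℝ r, ∀ ξ ∈ refCubeO d,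
      v (M.map i ξ) j = MvPolynomial.eval (fun l => ξ l) P}

/-- `Q_h`: either the functions in `L²(Ω) ∩ C(closure Ω)` (extended by `0` outside `closure Ω`) that
are mapped `ℚ_{r-1}` polynomials on each element, or the functions in `L²(Ω)` that are mapped
`ℙ_{r-1}` polynomials on each element (an `L²`-class being represented by the function that
vanishes outside the union of the open elements). -/
def Qh {Ω : Set (E d)} (M : Mesh d Ω) (r : ℕ) : PressureKind → Set (E d → ℝ)
  | .cont => {q | (∀ x ∉ closure Ω, q x = 0) ∧ MemLp q 2 (volume.restrict Ω) ∧
      ContinuousOn q (closure Ω) ∧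
      ∀ i, ∃ P ∈ MvPolynomial.restrictDegree (Fin d) ℝ (r - 1), ∀ ξ ∈ refCubeO d,
        q (M.map i ξ) = MvPolynomial.eval (fun l => ξ l) P}
  | .disc => {q | (∀ x ∉ M.cells, q x = 0) ∧ MemLp q 2 (volume.restrict Ω) ∧
      ∀ i, ∃ P ∈ MvPolynomial.restrictTotalDegree (Fin d) ℝ (r - 1), ∀ ξ ∈ refCubeO d,
        q (M.map i ξ) = MvPolynomial.eval (fun l => ξ l) P}

/-! ### Bilinear forms -/

/-- `⟨w, χ⟩` in `L²(Ω)^d`. -/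
def ipV (Ω : Set (E d)) (w χ : E d → E d) : ℝ := ∫ x in Ω, dotE (w x) (χ x)

/-- `⟨q, ψ⟩` in `L²(Ω)`. -/
def ipQ (Ω : Set (E d)) (q ψ : E d → ℝ) : ℝ := ∫ x in Ω, q x * ψ x

/-- The scalar coefficients `ρ`, `α`, `c₀` and the parameters `γ_a`, `γ_b` (Nitsche) and `γ`
(interior penalty). -/
structure Params where
  ρ : ℝ
  α : ℝ
  c₀ : ℝ
  γa : ℝ
  γb : ℝ
  γ : ℝ

section Forms

variable (S : Setting d) (M : Mesh d S.Ω) (c : Params)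

/-- `a_γ(w, χ) = - ⟨w, C ε(χ) n⟩ + γ_a / h_F ⟨w, χ⟩` on `Γ_u^D`. -/
def aN (w χ : E d → E d) : ℝ :=
  - M.bInt S.ΓuD (fun i x => matDot (applyC S.C (M.tr i (strain χ) x)) (M.normal i x) (w x))
  + M.bInt S.ΓuD (fun i x => c.γa / M.size i * dotE (w x) (χ x))

/-- `A_γ(w, χ) = ⟨C ε(w), ε(χ)⟩ - ⟨C ε(w) n, χ⟩_{Γ_u^D} + a_γ(w, χ)`. -/
def formA (w χ : E d → E d) : ℝ :=
  (∫ x in S.Ω, ∑ i, ∑ j, applyC S.C (strain w x) i j * strain χ x i j)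
  - M.bInt S.ΓuD (fun i x => matDot (applyC S.C (M.tr i (strain w) x)) (M.normal i x) (χ x))
  + aN S M c w χ

/-- `⟨χ · n, q⟩` on `Γ_u^D`. -/
def bdryN (χ : E d → E d) (q : E d → ℝ) : ℝ :=
  M.bInt S.ΓuD (fun i x => dotE (χ x) (M.normal i x) * M.tr i q x)

/-- `C(χ, q) = - α ⟨∇·χ, q⟩ + α ⟨χ · n, q⟩_{Γ_u^D}`. -/
def formC (χ : E d → E d) (q : E d → ℝ) : ℝ :=
  - c.α * ipQ S.Ω (dvg χ) q + c.α * bdryN S M χ q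

/-- `b_γ(q, ψ) = - ⟨q, K ∇ψ · n⟩ + γ_b / h_F ⟨q, ψ⟩` on `Γ_p^D`, for continuous `ψ`. -/
def bN (q ψ : E d → ℝ) : ℝ :=
  - M.bInt S.ΓpD (fun i x => q x * flux S.Kp (M.tr i (grad ψ) x) (M.normal i x))
  + M.bInt S.ΓpD (fun i x => c.γb / M.size i * (q x * ψ x))

/-- The volume term `∑_K ⟨K ∇q, ∇ψ⟩_K`. -/
def diffusion (q ψ : E d → ℝ) : ℝ :=
  ∑ k, ∫ x in M.cell k, ∑ i, ∑ j, S.Kp i j * grad q x j * grad ψ x i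

/-- The sum over the interior faces `F = ∂K_i ∩ ∂K_j`, `i < j`, with `n` pointing from `K_i` to
`K_j`. -/
def faceInt (w : Fin M.num → Fin M.num → E d → ℝ) : ℝ :=
  ∑ i, ∑ j ∈ Finset.Ioi i, ∫ x in frontier (M.cell i) ∩ frontier (M.cell j), w i j x ∂(surf d)

/-- The jump of `q` at a face between `K_i` and `K_j`. -/
def jump (i j : Fin M.num) (q : E d → ℝ) (x : E d) : ℝ := M.tr i q x - M.tr j q x

/-- The average of the normal flux `K ∇q · n` at a face between `K_i` and `K_j`, `n = n_{K_i}`. -/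
def avgFlux (i j : Fin M.num) (q : E d → ℝ) (x : E d) : ℝ :=
  flux S.Kp ((1 / 2 : ℝ) • (M.tr i (grad q) x + M.tr j (grad q) x)) (M.normal i x)

/-- `B_γ`: Nitsche's form for continuous pressures, and the symmetric interior penalty form, with
sums over all interior and boundary faces, for discontinuous ones. -/
def formB (kind : PressureKind) (q ψ : E d → ℝ) : ℝ :=
  match kind with
  | .cont =>
      (∫ x in S.Ω, ∑ i, ∑ j, S.Kp i j * grad q x j * grad ψ x i)
      - M.bInt S.ΓpD (fun i x => flux S.Kp (M.tr i (grad q) x) (M.normal i x) * ψ x)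
      + bN S M c q ψ
  | .disc =>
      diffusion S M q ψ
      - (faceInt S M (fun i j x =>
            avgFlux S M i j q x * jump S M i j ψ x + jump S M i j q x * avgFlux S M i j ψ x)
          + M.bInt (frontier S.Ω) (fun i x =>
            flux S.Kp (M.tr i (grad q) x) (M.normal i x) * M.tr i ψ x
              + M.tr i q x * flux S.Kp (M.tr i (grad ψ) x) (M.normal i x)))
      + (faceInt S M (fun i j x => c.γ / ((M.size i + M.size j) / 2)
            * (jump S M i j q x * jump S M i j ψ x))
          + M.bInt (frontier S.Ω) (fun i x => c.γ / M.size i * (M.tr i q x * M.tr i ψ x)))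

end Forms

/-! ### Data and right-hand sides -/

/-- Neumann data `p_N` at a fixed time: a linear functional on functions on `Γ_p^N` (evaluated at
traces) for continuous pressures, and an `L²(Γ_p^N)` function for discontinuous ones. -/
def NeumannP (S : Setting d) : PressureKind → Type
  | .cont => Module.Dual ℝ (S.ΓpN → ℝ)
  | .disc => Lp ℝ 2 ((surf d).restrict S.ΓpN)

/-- The Neumann functional in the case of continuous pressures. -/
def NeumannP.toDual {S : Setting d} (x : NeumannP S .cont) : Module.Dual ℝ (S.ΓpN → ℝ) := x

/-- The Neumann function in the case of discontinuous pressures. -/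
def NeumannP.toLp {S : Setting d} (x : NeumannP S .disc) : Lp ℝ 2 ((surf d).restrict S.ΓpN) := x

/-- The time-dependent data. The distributional data `f`, `g`, `t_N` (and `p_N` for continuous
pressures) enter the scheme only through their values at finite element functions or at their
traces; they are taken as linear functionals. (Every linear functional on a subspace extends to the
whole vector space, so that in particular all bounded functionals on `H¹`, or on the trace space
`H^{1/2}`, restricted to the finite element space are covered.) The Dirichlet data are in `L²` of
the Dirichlet portion of the boundary, which contains `H^{1/2}`. -/
structure Data (S : Setting d) (kind : PressureKind) where
  f : ℝ → Module.Dual ℝ (S.Ω → E d)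
  tN : ℝ → Module.Dual ℝ (S.ΓuN → E d)
  uD : ℝ → Lp (E d) 2 ((surf d).restrict S.ΓuD)
  g : ℝ → Module.Dual ℝ (S.Ω → ℝ)
  pD : ℝ → Lp ℝ 2 ((surf d).restrict S.ΓpD)
  pN : ℝ → NeumannP S kind

section RHS

variable (S : Setting d) (M : Mesh d S.Ω) (c : Params)

/-- `F_γ(χ) = ⟨f, χ⟩ - ⟨t_N, χ⟩_{Γ_u^N} + a_γ(u_D, χ)` at time `t`. -/
def rhsF {kind : PressureKind} (D : Data S kind) (t : ℝ) (χ : E d → E d) : ℝ :=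
  D.f t (fun x => χ x) - D.tN t (fun x => χ x) + aN S M c (D.uD t) χ

/-- `v_D = ∂_t u_D` on `[0, T]`. -/
def Data.vD {S : Setting d} {kind : PressureKind} (D : Data S kind) (T t : ℝ) :
    Lp (E d) 2 ((surf d).restrict S.ΓuD) :=
  derivWithin D.uD (Icc 0 T) t

/-- `G_γ(ψ)` at time `t`, for continuous and for discontinuous pressures. -/
def rhsG (T : ℝ) : (kind : PressureKind) → Data S kind → ℝ → (E d → ℝ) → ℝ
  | .cont, D, t, ψ =>
      D.g t (fun x => ψ x) - c.α * bdryN S M (D.vD T t) ψ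
      - (D.pN t).toDual (fun x => ψ x)
      + bN S M c (D.pD t) ψ
  | .disc, D, t, ψ =>
      D.g t (fun x => ψ x) - c.α * bdryN S M (D.vD T t) ψ
      - M.bInt S.ΓpD (fun i x => D.pD t x * flux S.Kp (M.tr i (grad ψ) x) (M.normal i x))
      + M.bInt S.ΓpD (fun i x => c.γ / M.size i * (D.pD t x * M.tr i ψ x))
      - M.bInt S.ΓpN (fun i x => (D.pN t).toLp x * M.tr i ψ x)

end RHS

/-! ### Time discretization -/

/-- The right-sided `(k+1)`-point Gauss--Radau quadrature formula on `[-1, 1]`: the (unique) formula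
with `k+1` nodes, the last of which is the right end point `1`, that is exact on `ℙ_{2k}`. -/
structure GaussRadau (k : ℕ) where
  node : Fin (k + 1) → ℝ
  weight : Fin (k + 1) → ℝ
  strictMono : StrictMono node
  mem : ∀ μ, node μ ∈ Icc (-1 : ℝ) 1
  last : node (Fin.last k) = 1
  exact : ∀ q : Polynomial ℝ, q.natDegree ≤ 2 * k →
    ∑ μ, weight μ * q.eval (node μ) = ∫ x in (-1 : ℝ)..1, q.eval x

/-- The formula `Q_n` on `I_n = (a, b]`. -/
def GaussRadau.quad {k : ℕ} (R : GaussRadau k) (a b : ℝ) (w : ℝ → ℝ) : ℝ :=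
  (b - a) / 2 * ∑ μ, R.weight μ * w ((a + b) / 2 + (b - a) / 2 * R.node μ)

/-- `ℙ_k(I_n; B)` with `I_n = (a, b]`, for a set `B` of functions on `ℝ^d` (functions of time being
extended by `0` outside `I_n`). -/
def PolyT {F : Type} [AddCommGroup F] [Module ℝ F] (k : ℕ) (a b : ℝ) (B : Set (E d → F)) :
    Set (ℝ → E d → F) :=
  {w | (∃ W : Fin (k + 1) → E d → F, (∀ j, W j ∈ B) ∧
      ∀ t ∈ Ioc a b, w t = ∑ j : Fin (k + 1), (t ^ (j : ℕ)) • W j) ∧ ∀ t ∉ Ioc a b, w t = 0}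

/-- The time derivative `∂_t w` on `I_n = (a, b]`. -/
def dt {F : Type} [NormedAddCommGroup F] [NormedSpace ℝ F] (a b : ℝ) (w : ℝ → E d → F) (t : ℝ) :
    E d → F :=
  fun x => derivWithin (fun s => w s x) (Ioc a b) t

/-- The right-sided limit `w⁺(a)`. -/
def plus {F : Type} [NormedAddCommGroup F] (w : ℝ → E d → F) (a : ℝ) : E d → F :=
  fun x => Function.rightLim (fun s => w s x) a

/-- The fully discrete problem on `I_n = (a, b]` with `∂_t u` in the coupling term: `(u, v, p)` is
a solution for the previous values `u₀`, `v₀`, `p₀` at time `a = t_{n-1}`. -/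
def IsSolution (S : Setting d) (M : Mesh d S.Ω) (c : Params) (r : ℕ) (kind : PressureKind)
    (D : Data S kind) (T : ℝ) {k : ℕ} (R : GaussRadau k) (a b : ℝ)
    (u₀ v₀ : E d → E d) (p₀ : E d → ℝ)
    (u v : ℝ → E d → E d) (p : ℝ → E d → ℝ) : Prop :=
  u ∈ PolyT k a b (Vh M r) ∧ v ∈ PolyT k a b (Vh M r) ∧ p ∈ PolyT k a b (Qh M r kind) ∧
  (∀ φ ∈ PolyT k a b (Vh M r),
    R.quad a b (fun t => ipV S.Ω (dt a b u t) (φ t) - ipV S.Ω (v t) (φ t))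
      + ipV S.Ω (plus u a) (plus φ a)
    = ipV S.Ω u₀ (plus φ a)) ∧
  (∀ χ ∈ PolyT k a b (Vh M r),
    R.quad a b (fun t => c.ρ * ipV S.Ω (dt a b v t) (χ t) + formA S M c (u t) (χ t)
        + formC S M c (χ t) (p t))
      + c.ρ * ipV S.Ω (plus v a) (plus χ a)
    = R.quad a b (fun t => rhsF S M c D t (χ t)) + c.ρ * ipV S.Ω v₀ (plus χ a)) ∧
  (∀ ψ ∈ PolyT k a b (Qh M r kind),
    R.quad a b (fun t => c.c₀ * ipQ S.Ω (dt a b p t) (ψ t) - formC S M c (dt a b u t) (ψ t)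
        + formB S M c kind (p t) (ψ t))
      + ipQ S.Ω (fun x => c.c₀ * plus p a x + c.α * dvg (plus u a) x) (plus ψ a)
      - c.α * bdryN S M (plus u a) (plus ψ a)
    = R.quad a b (fun t => rhsG S M c T kind D t (ψ t))
      + ipQ S.Ω (fun x => c.c₀ * p₀ x + c.α * dvg u₀ x) (plus ψ a)
      - c.α * bdryN S M (D.uD a) (plus ψ a))

end Biot

end

/-! The discrete problem is a square linear system: on coefficient vectors in `V_h`, `V_h`, `Q_h`
the unknowns and the test functions range over the same finite-dimensional space. Hence it suffices
that the homogeneous system has only the zero solution, and this follows from symmetry and mere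
positive semidefiniteness of `A_γ` and `B_γ`. Coercivity, and with it Korn and Poincaré
inequalities, is not needed.

Uniqueness (`system_injective`). The `L²` product on `V_h` is definite, so every functional has a
Riesz representative that may serve as test function. Thus the first equation holds with `A_γ` or
with the coupling form in place of the `L²` product. Testing these versions with `u` and `p`, the
second equation with `v` and the third with `p`, and adding, all mixed terms cancel. The products
with time derivatives are half the derivatives of polynomials of degree at most `2k`, so the
quadrature integrates them exactly, and with the jump terms they leave half the sum of the energies
at both ends of the interval. Hence these energies and the quadrature of `B_γ(p, p)` vanish. By
Cauchy--Schwarz for semidefinite forms `A_γ(u⁺, ·) = 0`, and `B_γ(p, ·) = 0` at the nodes. What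
remains are evolution equations at the `k + 1` nodes. Their residuals have degree at most `k` in
time, so they hold for all times. They conserve the energy `ρ|v|² + A_γ(u, u) + c₀|p|²`, which
starts at zero, so `v = 0` and `p = 0`; the first equation then forces `u = 0`.

Semidefiniteness (`exists_penalty`). The flux terms are absorbed by Young's inequality into the
penalty and into the volume terms, using a discrete trace inequality (`Mesh.exists_trace_le`) with a
constant depending on the mesh only through `σ`. The gradient of a mapped polynomial is rational on
the reference cube, but its product with `det DF` is a polynomial of bounded degree
(`Mesh.IsPW.isRat_grad`), so equivalence of norms on a fixed finite-dimensional space applies.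
Scaling yields `|K| |∂K| sup φ² ≤ c h^(d-1) ∫_K φ²`, and the spare power of `h` is bounded because
elements fit into `Ω`. For the interior penalty form, the number of elements touching a given one is
bounded by a volume count. -/

noncomputable section

namespace Biot

/-! ### Gauss--Radau formulas -/

namespace GaussRadau

variable {k : ℕ} (R : GaussRadau k)

/-- The nodes of the formula transported to `(a, b]`. -/
def pt (a b : ℝ) (μ : Fin (k + 1)) : ℝ := (a + b) / 2 + (b - a) / 2 * R.node μ

/-- The weights of the formula transported to `(a, b]`. -/
def wt (a b : ℝ) (μ : Fin (k + 1)) : ℝ := (b - a) / 2 * R.weight μ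

theorem quad_eq (a b : ℝ) (w : ℝ → ℝ) :
    R.quad a b w = ∑ μ, R.wt a b μ * w (R.pt a b μ) := by
  simp only [quad, wt, pt, Finset.mul_sum, mul_assoc]

theorem pt_injective {a b : ℝ} (hab : a < b) : Function.Injective (R.pt a b) := by
  intro μ ν h
  have hne : (b - a) / 2 ≠ 0 := by linarith
  exact R.strictMono.injective (mul_left_cancel₀ hne (add_left_cancel h))

/-- The product of `(X - x_ν)²` over a set of nodes. -/
def nodeSq (s : Finset (Fin (k + 1))) : Polynomial ℝ :=
  ∏ ν ∈ s, (Polynomial.X - Polynomial.C (R.node ν)) ^ 2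

theorem natDegree_nodeSq (s : Finset (Fin (k + 1))) : (R.nodeSq s).natDegree = 2 * s.card := by
  rw [nodeSq, Polynomial.natDegree_prod_of_monic _ _ fun _ _ => (Polynomial.monic_X_sub_C _).pow 2]
  simp [mul_comm]

theorem eval_nodeSq (s : Finset (Fin (k + 1))) (x : ℝ) :
    (R.nodeSq s).eval x = ∏ ν ∈ s, (x - R.node ν) ^ 2 := by
  simp [nodeSq, Polynomial.eval_prod]

/-- A nonzero polynomial cannot vanish on all of an infinite set, so the continuous nonnegative
integrand is positive somewhere. -/
theorem integral_pos_of_roots (q : Polynomial ℝ) (hq : q ≠ 0)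
    (h : ∀ x ∈ Ioo (-1 : ℝ) 1, 0 ≤ q.eval x) : 0 < ∫ x in (-1 : ℝ)..1, q.eval x := by
  have hex : ∃ c ∈ Ioo (-1 : ℝ) 1, q.eval c ≠ 0 := by
    by_contra! hc
    exact hq (Polynomial.eq_zero_of_infinite_isRoot q
      ((Ioo_infinite (by norm_num : (-1 : ℝ) < 1)).mono hc))
  obtain ⟨c, hc, hc0⟩ := hex
  have hcl : ∀ x ∈ Icc (-1 : ℝ) 1, 0 ≤ q.eval x := by
    intro x hx
    rw [← closure_Ioo (by norm_num : (-1 : ℝ) ≠ 1)] at hx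
    exact closure_minimal (s := Ioo (-1 : ℝ) 1) (t := {x | 0 ≤ q.eval x}) h
      (isClosed_le continuous_const q.continuous) hx
  exact intervalIntegral.integral_pos (by norm_num) q.continuous.continuousOn
    (fun x hx => hcl x (Ioc_subset_Icc_self hx))
    ⟨c, Ioo_subset_Icc_self hc, lt_of_le_of_ne (hcl c (Ioo_subset_Icc_self hc)) hc0.symm⟩

theorem nodeSq_ne_zero (s : Finset (Fin (k + 1))) : R.nodeSq s ≠ 0 :=
  Finset.prod_ne_zero_iff.2 fun _ _ => pow_ne_zero 2 (Polynomial.X_sub_C_ne_zero _)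

/-- The squared node polynomial of the other `k` nodes has degree exactly `2k`, so it is integrated
exactly. Only the node `μ` contributes to the sum, and the integral is positive. -/
theorem weight_pos (μ : Fin (k + 1)) : 0 < R.weight μ := by
  classical
  have hdeg : (R.nodeSq (Finset.univ.erase μ)).natDegree ≤ 2 * k := by
    simp [natDegree_nodeSq]
  have h1 := R.exact _ hdeg
  rw [Finset.sum_eq_single μ] at h1
  · have h2 := integral_pos_of_roots (R.nodeSq (Finset.univ.erase μ)) (R.nodeSq_ne_zero _)
      fun x _ => by rw [eval_nodeSq]; positivity
    rw [← h1] at h2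
    refine pos_of_mul_pos_left h2 ?_
    rw [eval_nodeSq]; positivity
  · intro ν _ hν
    rw [eval_nodeSq, Finset.prod_eq_zero (i := ν) (by simpa using hν) (by simp), mul_zero]
  · simp

/-- If `-1` were a node, then `1 - x²` times the squares of the factors of the remaining `k - 1`
nodes would have degree `2k`, vanish at every node and have positive integral. Excluding `-1`
matters because functions in `PolyT` are set to zero at the left end point: all transported nodes
must lie in the half-open interval. -/
theorem neg_one_lt_node (μ : Fin (k + 1)) : -1 < R.node μ := by
  classical
  refine lt_of_le_of_ne (R.mem μ).1 fun hμ => ?_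
  have hne : μ ≠ Fin.last k := by
    rintro rfl
    rw [R.last] at hμ
    norm_num at hμ
  set s := (Finset.univ.erase μ).erase (Fin.last k) with hs
  have hcard : s.card = k - 1 := by
    rw [hs, Finset.card_erase_of_mem (by simpa using hne.symm),
      Finset.card_erase_of_mem (by simp)]
    simp
  have hk : 1 ≤ k := by
    rcases Nat.eq_zero_or_pos k with rfl | h
    · exact absurd (Subsingleton.elim (α := Fin 1) _ _) hne
    · exact h
  set q : Polynomial ℝ := R.nodeSq s * (1 - Polynomial.X ^ 2) with hqdef
  have hq2 : (1 - Polynomial.X ^ 2 : Polynomial ℝ).natDegree ≤ 2 := by compute_degree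
  have hdeg : q.natDegree ≤ 2 * k := by
    refine Polynomial.natDegree_mul_le.trans ?_
    rw [natDegree_nodeSq, hcard]
    omega
  have heval : ∀ x, q.eval x = (∏ ν ∈ s, (x - R.node ν) ^ 2) * (1 - x ^ 2) := by
    intro x
    simp [hqdef, eval_nodeSq]
  have hq0 : q ≠ 0 := by
    refine mul_ne_zero (R.nodeSq_ne_zero _) fun h => ?_
    have := congrArg (Polynomial.eval 0) h
    simp at this
  have hpos := integral_pos_of_roots q hq0 fun x hx => by
    rw [heval]
    have : 0 ≤ 1 - x ^ 2 := by nlinarith [hx.1, hx.2]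
    positivity
  rw [← R.exact q hdeg, Finset.sum_eq_zero] at hpos
  · exact lt_irrefl _ hpos
  · intro ν _
    rw [heval]
    by_cases h1 : ν = μ
    · rw [h1, ← hμ]; norm_num
    by_cases h2 : ν = Fin.last k
    · rw [h2, R.last]; norm_num
    · rw [Finset.prod_eq_zero (i := ν) (by simp [hs, h1, h2]) (by simp)]; ring

theorem pt_mem {a b : ℝ} (hab : a < b) (μ : Fin (k + 1)) : R.pt a b μ ∈ Ioc a b := by
  have h1 := R.neg_one_lt_node μ
  have h2 := (R.mem μ).2
  have h : 0 < (b - a) / 2 := by linarith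
  constructor <;> · unfold pt; nlinarith

theorem wt_pos {a b : ℝ} (hab : a < b) (μ : Fin (k + 1)) : 0 < R.wt a b μ :=
  mul_pos (by linarith) (R.weight_pos μ)

/-- The formula integrates derivatives of polynomials of degree at most `2k + 1` exactly. -/
theorem sum_derivative (a b : ℝ) (q : Polynomial ℝ) (hq : q.natDegree ≤ 2 * k) :
    ∑ μ, R.wt a b μ * q.derivative.eval (R.pt a b μ) = q.eval b - q.eval a := by
  -- The affine map of `[-1, 1]` onto `[a, b]`. Its slope, produced by the chain rule, is the factor
  -- by which the weights are scaled.
  set l : Polynomial ℝ := Polynomial.C ((a + b) / 2) + Polynomial.C ((b - a) / 2) * Polynomial.X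
    with hl
  have hldeg : l.natDegree ≤ 1 := by rw [hl]; compute_degree
  have hleval : ∀ x, l.eval x = (a + b) / 2 + (b - a) / 2 * x := fun x => by simp [hl]
  have hdeg : (q.comp l).derivative.natDegree ≤ 2 * k := by
    refine (Polynomial.natDegree_derivative_le _).trans ((Nat.sub_le _ _).trans ?_)
    rw [Polynomial.natDegree_comp]
    nlinarith
  have h := R.exact _ hdeg
  have hF : ∫ x in (-1 : ℝ)..1, (q.comp l).derivative.eval x
      = (q.comp l).eval 1 - (q.comp l).eval (-1) :=
    intervalIntegral.integral_eq_sub_of_hasDerivAt (fun x _ => (q.comp l).hasDerivAt x)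
      ((q.comp l).derivative.continuous.intervalIntegrable _ _)
  rw [hF] at h
  have hld : l.derivative = Polynomial.C ((b - a) / 2) := by simp [hl]
  rw [Polynomial.derivative_comp, hld] at h
  simp only [Polynomial.eval_mul, Polynomial.eval_C, Polynomial.eval_comp, hleval] at h
  have e1 : (a + b) / 2 + (b - a) / 2 * 1 = b := by ring
  have e2 : (a + b) / 2 + (b - a) / 2 * -1 = a := by ring
  rw [e1, e2] at h
  rw [← h]
  refine Finset.sum_congr rfl fun μ _ => ?_
  simp only [wt, pt]
  ring

end GaussRadau

/-! ### Polynomials in time with values in a vector space -/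

section TimePoly

variable {k : ℕ} {V V' : Type*} [AddCommGroup V] [Module ℝ V] [AddCommGroup V'] [Module ℝ V']

/-- The value at `t` of the polynomial with coefficients `W`. -/
def pe (t : ℝ) : (Fin (k + 1) → V) →ₗ[ℝ] V :=
  ∑ j : Fin (k + 1), (t ^ (j : ℕ)) • LinearMap.proj j

/-- The derivative at `t` of the polynomial with coefficients `W`. -/
def pd (t : ℝ) : (Fin (k + 1) → V) →ₗ[ℝ] V :=
  ∑ j : Fin (k + 1), ((j : ℕ) * t ^ ((j : ℕ) - 1)) • LinearMap.proj j

theorem pe_apply (t : ℝ) (W : Fin (k + 1) → V) : pe t W = ∑ j : Fin (k + 1), (t ^ (j : ℕ)) • W j := by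
  simp [pe]

theorem pd_apply (t : ℝ) (W : Fin (k + 1) → V) :
    pd t W = ∑ j : Fin (k + 1), ((j : ℕ) * t ^ ((j : ℕ) - 1)) • W j := by
  simp [pd]

/-- Real functions given by a polynomial of degree at most `k`. -/
def IsPolyFun (k : ℕ) (f : ℝ → ℝ) : Prop :=
  ∃ q : Polynomial ℝ, q.natDegree ≤ k ∧ ∀ t, f t = q.eval t

namespace IsPolyFun

theorem add {f g : ℝ → ℝ} (hf : IsPolyFun k f) (hg : IsPolyFun k g) :
    IsPolyFun k fun t => f t + g t := by
  obtain ⟨p, hp, hp'⟩ := hf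
  obtain ⟨q, hq, hq'⟩ := hg
  exact ⟨p + q, Polynomial.natDegree_add_le_of_degree_le hp hq, fun t => by simp [hp', hq']⟩

theorem const_mul {f : ℝ → ℝ} (c : ℝ) (hf : IsPolyFun k f) : IsPolyFun k fun t => c * f t := by
  obtain ⟨p, hp, hp'⟩ := hf
  exact ⟨Polynomial.C c * p, (Polynomial.natDegree_C_mul_le _ _).trans hp, fun t => by simp [hp']⟩

theorem sub {f g : ℝ → ℝ} (hf : IsPolyFun k f) (hg : IsPolyFun k g) :
    IsPolyFun k fun t => f t - g t := by
  simpa [sub_eq_add_neg] using hf.add (hg.const_mul (-1))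

theorem pe (ℓ : V →ₗ[ℝ] ℝ) (W : Fin (k + 1) → V) : IsPolyFun k fun t => ℓ (Biot.pe t W) := by
  refine ⟨∑ j : Fin (k + 1), Polynomial.C (ℓ (W j)) * Polynomial.X ^ (j : ℕ), ?_, fun t => ?_⟩
  · refine Polynomial.natDegree_sum_le_of_forall_le _ _ fun j _ => ?_
    exact (Polynomial.natDegree_C_mul_X_pow_le _ _).trans (Nat.lt_succ_iff.1 j.2)
  · simp only [pe_apply, map_sum, map_smul, smul_eq_mul, Polynomial.eval_finsetSum,
      Polynomial.eval_mul, Polynomial.eval_C, Polynomial.eval_pow, Polynomial.eval_X]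
    exact Finset.sum_congr rfl fun j _ => by ring

/-- For `j = 0` the truncated exponent `0 - 1 = 0` is harmless since the coefficient is zero. The
bound `k` instead of `k - 1` suffices, as derivatives are only added to polynomials of degree at
most `k`. -/
theorem pd (ℓ : V →ₗ[ℝ] ℝ) (W : Fin (k + 1) → V) : IsPolyFun k fun t => ℓ (Biot.pd t W) := by
  refine ⟨∑ j : Fin (k + 1), Polynomial.C ((j : ℕ) * ℓ (W j)) * Polynomial.X ^ ((j : ℕ) - 1), ?_,
    fun t => ?_⟩
  · refine Polynomial.natDegree_sum_le_of_forall_le _ _ fun j _ => ?_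
    exact (Polynomial.natDegree_C_mul_X_pow_le _ _).trans (by omega)
  · simp only [pd_apply, map_sum, map_smul, smul_eq_mul, Polynomial.eval_finsetSum,
      Polynomial.eval_mul, Polynomial.eval_C, Polynomial.eval_pow, Polynomial.eval_X]
    exact Finset.sum_congr rfl fun j _ => by ring

/-- There are `k + 1` distinct zeros against degree at most `k`. This is how equations known only at
the quadrature nodes are promoted to all times. -/
theorem eq_zero {f : ℝ → ℝ} (hf : IsPolyFun k f) {s : Fin (k + 1) → ℝ}
    (hs : Function.Injective s) (h : ∀ μ, f (s μ) = 0) (t : ℝ) : f t = 0 := by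
  obtain ⟨q, hq, hq'⟩ := hf
  have : q = 0 := Polynomial.eq_zero_of_natDegree_lt_card_of_eval_eq_zero q hs
    (fun μ => by rw [← hq', h]) (by simpa using Nat.lt_succ_of_le hq)
  rw [hq', this, Polynomial.eval_zero]

end IsPolyFun

/-- Linear functionals separate the points of any real vector space, so the claim reduces to a
scalar polynomial with infinitely many roots. -/
theorem eq_zero_of_pe_eq_zero {s : Set ℝ} (hs : s.Infinite) (W : Fin (k + 1) → V)
    (h : ∀ t ∈ s, pe t W = 0) : W = 0 := by
  by_contra hW
  obtain ⟨j, hj⟩ : ∃ j, W j ≠ 0 := by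
    by_contra! hc
    exact hW (funext hc)
  obtain ⟨ℓ, hℓ⟩ : ∃ ℓ : V →ₗ[ℝ] ℝ, ℓ (W j) ≠ 0 := by
    by_contra! hc
    exact hj ((Module.forall_dual_apply_eq_zero_iff ℝ (W j)).1 hc)
  let q : Polynomial ℝ := ∑ i : Fin (k + 1), Polynomial.C (ℓ (W i)) * Polynomial.X ^ (i : ℕ)
  have hq : q = 0 := by
    refine Polynomial.eq_zero_of_infinite_isRoot q (hs.mono fun t ht => ?_)
    have := congrArg ℓ (h t ht)
    rw [map_zero, pe_apply, map_sum] at this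
    simp only [q, Polynomial.IsRoot, mem_ofPred_eq, Polynomial.eval_finsetSum, Polynomial.eval_mul,
      Polynomial.eval_C, Polynomial.eval_pow, Polynomial.eval_X]
    simpa only [map_smul, smul_eq_mul, mul_comm] using this
  have : q.coeff j = ℓ (W j) := by
    simp only [q, Polynomial.finsetSum_coeff, Polynomial.coeff_C_mul_X_pow]
    rw [Finset.sum_eq_single j] <;> simp +contextual [Fin.ext_iff, eq_comm]
  rw [hq] at this
  exact hℓ (by simpa using this.symm)

/-- The scalar polynomial `ℓ`, times a vector. -/
theorem exists_pe_eq (ℓ : Polynomial ℝ) (hℓ : ℓ.natDegree ≤ k) (v : V) :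
    ∃ W : Fin (k + 1) → V, ∀ t, pe t W = ℓ.eval t • v := by
  refine ⟨fun j => ℓ.coeff j • v, fun t => ?_⟩
  rw [pe_apply, Polynomial.eval_eq_sum_range' (Nat.lt_succ_of_le hℓ), Finset.sum_smul,
    Finset.sum_range]
  exact Finset.sum_congr rfl fun j _ => by rw [smul_smul, mul_comm]

/-- The polynomial with prescribed value `v` at one node and `0` at the others. -/
theorem exists_pe_node {s : Fin (k + 1) → ℝ} (hs : Function.Injective s) (μ : Fin (k + 1)) (v : V) :
    ∃ W : Fin (k + 1) → V, ∀ ν, pe (s ν) W = if ν = μ then v else 0 := by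
  classical
  obtain ⟨W, hW⟩ := exists_pe_eq (k := k) (Lagrange.basis Finset.univ s μ)
    (by rw [Lagrange.natDegree_basis hs.injOn (Finset.mem_univ μ)]; simp) v
  refine ⟨W, fun ν => ?_⟩
  rw [hW]
  split_ifs with h
  · rw [h, Lagrange.eval_basis_self hs.injOn (Finset.mem_univ μ), one_smul]
  · rw [Lagrange.eval_basis_of_ne (Ne.symm h) (Finset.mem_univ ν), zero_smul]

theorem map_pe (f : V →ₗ[ℝ] V') (t : ℝ) (W : Fin (k + 1) → V) :
    pe t (fun j => f (W j)) = f (pe t W) := by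
  simp [pe_apply]

/-- A single polynomial carries the energy along the trajectory, its derivative and the degree bound
`2k` required for exact quadrature. -/
theorem hasDerivAt_bilin (m : LinearMap.BilinForm ℝ V) (hm : ∀ x y, m x y = m y x)
    (W : Fin (k + 1) → V) :
    ∃ q : Polynomial ℝ, q.natDegree ≤ 2 * k ∧ (∀ t, q.eval t = m (pe t W) (pe t W)) ∧
      ∀ t, q.derivative.eval t = 2 * m (pd t W) (pe t W) := by
  refine ⟨∑ i : Fin (k + 1), ∑ j : Fin (k + 1),
    Polynomial.C (m (W i) (W j)) * (Polynomial.X ^ (i : ℕ) * Polynomial.X ^ (j : ℕ)), ?_, ?_, ?_⟩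
  · refine Polynomial.natDegree_sum_le_of_forall_le _ _ fun i _ =>
      Polynomial.natDegree_sum_le_of_forall_le _ _ fun j _ => ?_
    rw [← pow_add]
    exact (Polynomial.natDegree_C_mul_X_pow_le _ _).trans (by omega)
  · intro t
    simp only [pe_apply, Polynomial.eval_finsetSum, map_sum, LinearMap.sum_apply, map_smul,
      LinearMap.smul_apply, smul_eq_mul, Polynomial.eval_mul, Polynomial.eval_C,
      Polynomial.eval_pow, Polynomial.eval_X]
    rw [Finset.sum_comm]
    refine Finset.sum_congr rfl fun i _ => ?_
    rw [Finset.mul_sum]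
    exact Finset.sum_congr rfl fun j _ => by ring
  · intro t
    have h1 : m (pd t W) (pe t W) = ∑ i : Fin (k + 1), ∑ j : Fin (k + 1),
        m (W i) (W j) * ((i : ℕ) * t ^ ((i : ℕ) - 1) * t ^ (j : ℕ)) := by
      simp only [pe_apply, pd_apply, map_sum, LinearMap.sum_apply, map_smul,
        LinearMap.smul_apply, smul_eq_mul]
      rw [Finset.sum_comm]
      refine Finset.sum_congr rfl fun i _ => ?_
      rw [Finset.mul_sum]
      exact Finset.sum_congr rfl fun j _ => by ring
    -- The other half of the product rule: by symmetry of `m` the derivative may fall on either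
    -- factor.
    have h2 : m (pd t W) (pe t W) = ∑ i : Fin (k + 1), ∑ j : Fin (k + 1),
        m (W i) (W j) * (t ^ (i : ℕ) * ((j : ℕ) * t ^ ((j : ℕ) - 1))) := by
      rw [h1, Finset.sum_comm]
      exact Finset.sum_congr rfl fun i _ => Finset.sum_congr rfl fun j _ => by rw [hm]; ring
    rw [two_mul]
    nth_rewrite 1 [h1]
    rw [h2, ← Finset.sum_add_distrib]
    simp only [← Finset.sum_add_distrib, Polynomial.derivative_sum, Polynomial.eval_finsetSum]
    refine Finset.sum_congr rfl fun i _ => Finset.sum_congr rfl fun j _ => ?_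
    simp [Polynomial.derivative_X_pow]
    ring

end TimePoly

end Biot

end

noncomputable section

namespace Biot

/-! ### The abstract fully discrete system -/

/-- Cauchy--Schwarz holds for semidefinite forms, so a vector of zero energy lies in the kernel.
This substitutes for definiteness of `A_γ` and `B_γ`. -/
theorem psd_apply_eq_zero {V : Type*} [AddCommGroup V] [Module ℝ V] {A : LinearMap.BilinForm ℝ V}
    (hs : ∀ x y, A x y = A y x) (hA : ∀ x, 0 ≤ A x x) {x : V} (hx : A x x = 0) (y : V) :
    A x y = 0 := by
  have h := LinearMap.BilinForm.apply_mul_apply_le_of_forall_zero_le A hA x y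
  rw [hs y x, hx, zero_mul] at h
  nlinarith [mul_self_nonneg (A x y)]

/-- A definite form on a finite-dimensional space is nondegenerate, hence identifies the space with
its dual. The representatives depend linearly on `w`, so they can be applied coefficientwise to a
polynomial in time and used as a test function. -/
theorem exists_riesz {V : Type*} [AddCommGroup V] [Module ℝ V] [FiniteDimensional ℝ V]
    {m : LinearMap.BilinForm ℝ V} (hm : ∀ x, x ≠ 0 → 0 < m x x) {W : Type*} [AddCommGroup W]
    [Module ℝ W] (f : W →ₗ[ℝ] V →ₗ[ℝ] ℝ) : ∃ g : W →ₗ[ℝ] V, ∀ w x, m x (g w) = f w x := by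
  have hinj : Function.Injective m.flip := by
    rw [injective_iff_map_eq_zero]
    intro x hx
    by_contra h
    have h0 : m x x = 0 := congrArg (fun l : V →ₗ[ℝ] ℝ => l x) hx
    exact (hm x h).ne' h0
  have hsurj : Function.Surjective m.flip :=
    (LinearMap.injective_iff_surjective_of_finrank_eq_finrank
      (Subspace.dual_finrank_eq (K := ℝ) (V := V)).symm).1 hinj
  let e : V ≃ₗ[ℝ] (V →ₗ[ℝ] ℝ) := LinearEquiv.ofBijective m.flip ⟨hinj, hsurj⟩
  refine ⟨e.symm.toLinearMap ∘ₗ f, fun w x => ?_⟩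
  have : e (e.symm (f w)) = f w := e.apply_symm_apply _
  exact congrArg (fun l : V →ₗ[ℝ] ℝ => l x) this

section System

variable {k : ℕ} {V Q : Type*} [AddCommGroup V] [Module ℝ V] [AddCommGroup Q] [Module ℝ Q]

/-- Left-hand side of the first equation. -/
def eqU (R : GaussRadau k) (a b : ℝ) (m : LinearMap.BilinForm ℝ V)
    (U W Φ : Fin (k + 1) → V) : ℝ :=
  R.quad a b (fun t => m (pd t U) (pe t Φ) - m (pe t W) (pe t Φ)) + m (pe a U) (pe a Φ)

/-- Left-hand side of the second equation. -/
def eqV (R : GaussRadau k) (a b ρ : ℝ) (m A : LinearMap.BilinForm ℝ V) (B : V →ₗ[ℝ] Q →ₗ[ℝ] ℝ)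
    (U W : Fin (k + 1) → V) (P : Fin (k + 1) → Q) (X : Fin (k + 1) → V) : ℝ :=
  R.quad a b (fun t => ρ * m (pd t W) (pe t X) + A (pe t U) (pe t X) + B (pe t X) (pe t P))
    + ρ * m (pe a W) (pe a X)

/-- Left-hand side of the third equation. -/
def eqP (R : GaussRadau k) (a b c₀ : ℝ) (m D : LinearMap.BilinForm ℝ Q) (B : V →ₗ[ℝ] Q →ₗ[ℝ] ℝ)
    (U : Fin (k + 1) → V) (P Ψ : Fin (k + 1) → Q) : ℝ :=
  R.quad a b (fun t => c₀ * m (pd t P) (pe t Ψ) - B (pd t U) (pe t Ψ) + D (pe t P) (pe t Ψ))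
    + (c₀ * m (pe a P) (pe a Ψ) - B (pe a U) (pe a Ψ))

theorem quad_add (R : GaussRadau k) (a b : ℝ) (f g : ℝ → ℝ) :
    R.quad a b (fun t => f t + g t) = R.quad a b f + R.quad a b g := by
  simp [GaussRadau.quad_eq, mul_add, Finset.sum_add_distrib]

theorem quad_const_mul (R : GaussRadau k) (a b c : ℝ) (f : ℝ → ℝ) :
    R.quad a b (fun t => c * f t) = c * R.quad a b f := by
  simp only [GaussRadau.quad_eq, Finset.mul_sum]
  exact Finset.sum_congr rfl fun _ _ => by ring

theorem quad_sub (R : GaussRadau k) (a b : ℝ) (f g : ℝ → ℝ) :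
    R.quad a b (fun t => f t - g t) = R.quad a b f - R.quad a b g := by
  simp [GaussRadau.quad_eq, mul_sub, Finset.sum_sub_distrib]

theorem quad_congr (R : GaussRadau k) {a b : ℝ} (hab : a < b) {f g : ℝ → ℝ}
    (h : ∀ t ∈ Ioc a b, f t = g t) : R.quad a b f = R.quad a b g := by
  simp only [GaussRadau.quad_eq]
  exact Finset.sum_congr rfl fun μ _ => by rw [h _ (R.pt_mem hab μ)]

theorem quad_nonneg (R : GaussRadau k) {a b : ℝ} (hab : a < b) {f : ℝ → ℝ} (h : ∀ t, 0 ≤ f t) :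
    0 ≤ R.quad a b f := by
  rw [GaussRadau.quad_eq]
  exact Finset.sum_nonneg fun μ _ => mul_nonneg (R.wt_pos hab μ).le (h _)

theorem eq_zero_of_quad_eq_zero (R : GaussRadau k) {a b : ℝ} (hab : a < b) {f : ℝ → ℝ}
    (h : ∀ t, 0 ≤ f t) (h0 : R.quad a b f = 0) (μ : Fin (k + 1)) : f (R.pt a b μ) = 0 := by
  rw [GaussRadau.quad_eq, Finset.sum_eq_zero_iff_of_nonneg
    fun μ _ => mul_nonneg (R.wt_pos hab μ).le (h _)] at h0
  exact (mul_eq_zero.1 (h0 μ (Finset.mem_univ μ))).resolve_left (R.wt_pos hab μ).ne'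

/-- By symmetry `m(w', w)` is half the derivative of `m(w, w)`, and the quadrature integrates this
derivative exactly. -/
theorem quad_energy (R : GaussRadau k) (a b : ℝ) (m : LinearMap.BilinForm ℝ V)
    (hm : ∀ x y, m x y = m y x) (W : Fin (k + 1) → V) :
    R.quad a b (fun t => m (pd t W) (pe t W))
      = (m (pe b W) (pe b W) - m (pe a W) (pe a W)) / 2 := by
  obtain ⟨q, hq, h1, h2⟩ := hasDerivAt_bilin m hm W
  have := R.sum_derivative a b q hq
  rw [h1, h1] at this
  rw [← this, GaussRadau.quad_eq, Finset.sum_div]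
  exact Finset.sum_congr rfl fun μ _ => by rw [h2]; ring

/-- The bilinear quantity `F (w(t)) (Φ(t))` integrated by quadrature against all test polynomials
vanishes only if it vanishes at the nodes. -/
theorem node_eq_zero_of_quad (R : GaussRadau k) {a b : ℝ} (hab : a < b) (F : ℝ → V →ₗ[ℝ] ℝ)
    (h : ∀ Φ : Fin (k + 1) → V, R.quad a b (fun t => F t (pe t Φ)) = 0) (μ : Fin (k + 1)) (x : V) :
    F (R.pt a b μ) x = 0 := by
  obtain ⟨Φ, hΦ⟩ := exists_pe_node (R.pt_injective hab) μ x
  have h1 := h Φ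
  rw [GaussRadau.quad_eq, Finset.sum_eq_single μ] at h1
  · rw [hΦ, if_pos rfl] at h1
    exact (mul_eq_zero.1 h1).resolve_left (R.wt_pos hab μ).ne'
  · intro ν _ hν
    rw [hΦ, if_neg hν, map_zero, mul_zero]
  · simp

/-- The energy argument in the form that needs `A` and `D` only semidefinite. The sum of the tested
equations gives zero initial energies and no dissipation at the nodes. With these terms removed the
system is an evolution equation for all times, whose conserved energy is zero. The energy controls
`W` and `P` but not the kernel of `A`, so `U` is recovered at the end from the first equation in the
definite product `m`. -/
theorem system_injective [FiniteDimensional ℝ V] (R : GaussRadau k) {a b : ℝ} (hab : a < b) {ρ c₀ : ℝ} (hρ : 0 < ρ)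
    (hc : 0 < c₀) {m A : LinearMap.BilinForm ℝ V} {n D : LinearMap.BilinForm ℝ Q}
    (B : V →ₗ[ℝ] Q →ₗ[ℝ] ℝ)
    (hm : ∀ x y, m x y = m y x) (hmp : ∀ x, x ≠ 0 → 0 < m x x)
    (hA : ∀ x y, A x y = A y x) (hAp : ∀ x, 0 ≤ A x x)
    (hn : ∀ x y, n x y = n y x) (hnp : ∀ x, x ≠ 0 → 0 < n x x)
    (hD : ∀ x y, D x y = D y x) (hDp : ∀ x, 0 ≤ D x x)
    {U W : Fin (k + 1) → V} {P : Fin (k + 1) → Q}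
    (h1 : ∀ Φ, eqU R a b m U W Φ = 0) (h2 : ∀ X, eqV R a b ρ m A B U W P X = 0)
    (h3 : ∀ Ψ, eqP R a b c₀ n D B U P Ψ = 0) : U = 0 ∧ W = 0 ∧ P = 0 := by
  have hm0 : ∀ x, 0 ≤ m x x := fun x => by
    by_cases h : x = 0
    · simp [h]
    · exact (hmp x h).le
  have hn0 : ∀ x, 0 ≤ n x x := fun x => by
    by_cases h : x = 0
    · simp [h]
    · exact (hnp x h).le
  have hm1 : ∀ x, m x x = 0 → x = 0 := fun x h => by
    by_contra h'
    exact (hmp x h').ne' h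
  have hn1 : ∀ x, n x x = 0 → x = 0 := fun x h => by
    by_contra h'
    exact (hnp x h').ne' h
  obtain ⟨gA, hgA⟩ := exists_riesz hmp A
  obtain ⟨gB, hgB⟩ := exists_riesz hmp B.flip
  -- the first equation tested with Riesz representatives
  have h1A : ∀ Φ : Fin (k + 1) → V, R.quad a b (fun t => A (pd t U) (pe t Φ))
      - R.quad a b (fun t => A (pe t W) (pe t Φ)) + A (pe a U) (pe a Φ) = 0 := by
    intro Φ
    have := h1 (fun j => gA (Φ j))
    simp only [eqU, map_pe, hgA] at this
    rw [← quad_sub]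
    simpa only [hA (pe _ Φ)] using this
  have h1B : ∀ Ψ : Fin (k + 1) → Q, R.quad a b (fun t => B (pd t U) (pe t Ψ))
      - R.quad a b (fun t => B (pe t W) (pe t Ψ)) + B (pe a U) (pe a Ψ) = 0 := by
    intro Ψ
    have := h1 (fun j => gB (Ψ j))
    simp only [eqU, map_pe, hgB, LinearMap.flip_apply] at this
    rw [← quad_sub]
    exact this
  simp only [eqV, quad_add, quad_const_mul] at h2
  simp only [eqP, quad_add, quad_sub, quad_const_mul] at h3
  -- energy identity
  have e1 := h1A U
  have e2 := h1B P
  have e3 := h2 W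
  have e4 := h3 P
  have c1 : R.quad a b (fun t => A (pe t W) (pe t U)) = R.quad a b (fun t => A (pe t U) (pe t W)) := by
    simp only [hA (pe _ W)]
  rw [c1, quad_energy R a b A hA] at e1
  rw [quad_energy R a b m hm] at e3
  rw [quad_energy R a b n hn] at e4
  have hq := quad_nonneg R hab fun t => hDp (pe t P)
  have pos1 := mul_nonneg hρ.le (hm0 (pe a W))
  have pos2 := mul_nonneg hρ.le (hm0 (pe b W))
  have pos3 := hAp (pe a U)
  have pos4 := hAp (pe b U)
  have pos5 := mul_nonneg hc.le (hn0 (pe a P))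
  have pos6 := mul_nonneg hc.le (hn0 (pe b P))
  -- In `e1 + e2 + e3 + e4` the terms in `A(U, W)`, `B(W, P)`, `B(∂ₜU, P)` and `B(U(a), P(a))`
  -- cancel. Adding the initial value to half the difference of the end values leaves half the sum
  -- of the energies at `a` and `b`, plus the quadrature of `D(P, P)`. Every summand is nonnegative,
  -- so each one vanishes.
  have z1 : ρ * m (pe a W) (pe a W) = 0 := by nlinarith
  have z3 : A (pe a U) (pe a U) = 0 := by nlinarith
  have z5 : c₀ * n (pe a P) (pe a P) = 0 := by nlinarith
  have z7 : R.quad a b (fun t => D (pe t P) (pe t P)) = 0 := by nlinarith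
  have va : pe a W = 0 := hm1 _ ((mul_eq_zero.1 z1).resolve_left hρ.ne')
  have pa : pe a P = 0 := hn1 _ ((mul_eq_zero.1 z5).resolve_left hc.ne')
  have ua : ∀ x, A (pe a U) x = 0 := psd_apply_eq_zero hA hAp z3
  have hDz : ∀ μ x, D (pe (R.pt a b μ) P) x = 0 := fun μ =>
    psd_apply_eq_zero hD hDp (eq_zero_of_quad_eq_zero R hab (fun t => hDp (pe t P)) z7 μ)
  have hDq : ∀ Ψ : Fin (k + 1) → Q, R.quad a b (fun t => D (pe t P) (pe t Ψ)) = 0 := by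
    intro Ψ
    rw [GaussRadau.quad_eq]
    exact Finset.sum_eq_zero fun μ _ => by rw [hDz, mul_zero]
  -- the differential equations
  have d1 : ∀ t x, A (pd t U) x - A (pe t W) x = 0 := by
    intro t x
    -- For fixed `x` the residual is a polynomial of degree at most `k` in time. It vanishes at the
    -- nodes since the initial term `A(U(a), ·)` has disappeared and test polynomials can be
    -- concentrated at one node.
    refine (IsPolyFun.sub (.pd (A.flip x) U) (.pe (A.flip x) W)).eq_zero (R.pt_injective hab)
      (fun μ => ?_) t
    refine node_eq_zero_of_quad R hab (fun t => A (pd t U) - A (pe t W)) (fun Φ => ?_) μ x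
    have := h1A Φ
    rw [ua, add_zero, ← quad_sub] at this
    exact this
  have d2 : ∀ t x, ρ * m (pd t W) x + A (pe t U) x + B x (pe t P) = 0 := by
    intro t x
    refine (((IsPolyFun.pd (m.flip x) W).const_mul ρ).add (.pe (A.flip x) U)).add
      (.pe (B x) P) |>.eq_zero (R.pt_injective hab) (fun μ => ?_) t
    refine node_eq_zero_of_quad R hab
      (fun t => ρ • m (pd t W) + A (pe t U) + B.flip (pe t P)) (fun X => ?_) μ x
    have := h2 X
    rw [va] at this
    simp only [LinearMap.add_apply, LinearMap.smul_apply, smul_eq_mul, LinearMap.flip_apply,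
      quad_add, quad_const_mul]
    simpa using this
  -- Adding the first equation in its `B`-version to the third trades `B(∂ₜU, ·)` for `B(W, ·)`. It
  -- also removes the initial term `B(U(a), ·)`, about which nothing is known at this stage.
  have d3 : ∀ t x, c₀ * n (pd t P) x - B (pe t W) x = 0 := by
    intro t x
    refine ((IsPolyFun.pd (n.flip x) P).const_mul c₀).sub
      (.pe (B.flip x) W) |>.eq_zero (R.pt_injective hab) (fun μ => ?_) t
    refine node_eq_zero_of_quad R hab
      (fun t => c₀ • n (pd t P) - B (pe t W)) (fun Ψ => ?_) μ x
    have e5 := h3 Ψ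
    have e6 := h1B Ψ
    rw [hDq, pa] at e5
    simp only [LinearMap.sub_apply, LinearMap.smul_apply, smul_eq_mul, quad_sub, quad_const_mul]
    simp only [map_zero, LinearMap.zero_apply, mul_zero] at e5
    linarith
  -- conservation of energy
  obtain ⟨q1, -, f1, g1⟩ := hasDerivAt_bilin m hm W
  obtain ⟨q2, -, f2, g2⟩ := hasDerivAt_bilin A hA U
  obtain ⟨q3, -, f3, g3⟩ := hasDerivAt_bilin n hn P
  have hconst : ∀ t, ρ * m (pe t W) (pe t W) + A (pe t U) (pe t U) + c₀ * n (pe t P) (pe t P) = 0 := by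
    intro t
    have hd : ∀ t, HasDerivAt (fun t => ρ * q1.eval t + q2.eval t + c₀ * q3.eval t) 0 t := by
      intro t
      have := (((q1.hasDerivAt t).const_mul ρ).add (q2.hasDerivAt t)).add
        ((q3.hasDerivAt t).const_mul c₀)
      refine this.congr_deriv ?_
      rw [g1, g2, g3]
      have i1 := d1 t (pe t U)
      have i2 := d2 t (pe t W)
      have i3 := d3 t (pe t P)
      rw [hA (pe t W)] at i1
      linarith
    have := is_const_of_deriv_eq_zero (fun t => (hd t).differentiableAt) (fun t => (hd t).deriv) t a
    simp only [f1, f2, f3] at this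
    rw [this, va, pa, ua]
    simp
  have hW : W = 0 := eq_zero_of_pe_eq_zero infinite_univ W fun t _ => by
    have := hconst t
    have w1 := mul_nonneg hρ.le (hm0 (pe t W))
    have w2 := hAp (pe t U)
    have w3 := mul_nonneg hc.le (hn0 (pe t P))
    have : ρ * m (pe t W) (pe t W) = 0 := by linarith
    exact hm1 _ ((mul_eq_zero.1 this).resolve_left hρ.ne')
  have hP : P = 0 := eq_zero_of_pe_eq_zero infinite_univ P fun t _ => by
    have := hconst t
    have w1 := mul_nonneg hρ.le (hm0 (pe t W))
    have w2 := hAp (pe t U)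
    have w3 := mul_nonneg hc.le (hn0 (pe t P))
    have : c₀ * n (pe t P) (pe t P) = 0 := by linarith
    exact hn1 _ ((mul_eq_zero.1 this).resolve_left hc.ne')
  -- With `W = 0` the first equation reads `Q(m(∂ₜU, Φ)) + m(U(a), Φ(a)) = 0`. Testing with `U`
  -- gives `U(a) = 0`; then `∂ₜU` vanishes at the nodes, hence always, so `m(U, U)` is constant and
  -- equal to zero.
  refine ⟨?_, hW, hP⟩
  simp only [eqU, hW, map_zero, LinearMap.zero_apply, sub_zero] at h1
  have u1 := h1 U
  rw [quad_energy R a b m hm] at u1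
  have ua0 : pe a U = 0 := hm1 _ (by linarith [hm0 (pe a U), hm0 (pe b U)])
  have hdU : ∀ t x, m (pd t U) x = 0 := fun t x =>
    (IsPolyFun.pd (m.flip x) U).eq_zero (R.pt_injective hab) (fun μ =>
      node_eq_zero_of_quad R hab (fun t => m (pd t U)) (fun Φ => by
        have := h1 Φ
        rw [ua0] at this
        simpa using this) μ x) t
  obtain ⟨q, -, f, g⟩ := hasDerivAt_bilin m hm U
  refine eq_zero_of_pe_eq_zero infinite_univ U fun t _ => hm1 _ ?_
  have hd : ∀ t, HasDerivAt (fun t => q.eval t) 0 t := fun t => by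
    simpa [g, hdU] using q.hasDerivAt t
  have := is_const_of_deriv_eq_zero (fun t => (hd t).differentiableAt) (fun t => (hd t).deriv) t a
  simp only [f, ua0] at this
  simpa using this

/-- The pairing of the discrete system as a bilinear map of unknowns and test functions. -/
def systemMap (R : GaussRadau k) (a b ρ c₀ : ℝ) (m A : LinearMap.BilinForm ℝ V)
    (n D : LinearMap.BilinForm ℝ Q) (B : V →ₗ[ℝ] Q →ₗ[ℝ] ℝ) :
    ((Fin (k + 1) → V) × (Fin (k + 1) → V) × (Fin (k + 1) → Q)) →ₗ[ℝ]
      ((Fin (k + 1) → V) × (Fin (k + 1) → V) × (Fin (k + 1) → Q)) →ₗ[ℝ] ℝ :=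
  LinearMap.mk₂ ℝ (fun x y => eqU R a b m x.1 x.2.1 y.1
      + eqV R a b ρ m A B x.1 x.2.1 x.2.2 y.2.1 + eqP R a b c₀ n D B x.1 x.2.2 y.2.2)
    (fun x x' y => by
      simp only [eqU, eqV, eqP, quad_add, quad_sub, quad_const_mul, Prod.fst_add, Prod.snd_add,
        map_add, LinearMap.add_apply, mul_add]
      ring)
    (fun c x y => by
      simp only [eqU, eqV, eqP, quad_add, quad_sub, quad_const_mul, Prod.smul_fst, Prod.smul_snd,
        map_smul, LinearMap.smul_apply, smul_eq_mul]
      ring)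
    (fun x y y' => by
      simp only [eqU, eqV, eqP, quad_add, quad_sub, quad_const_mul, Prod.fst_add, Prod.snd_add,
        map_add, LinearMap.add_apply, mul_add]
      ring)
    (fun c x y => by
      simp only [eqU, eqV, eqP, quad_add, quad_sub, quad_const_mul, Prod.smul_fst, Prod.smul_snd,
        map_smul, LinearMap.smul_apply, smul_eq_mul]
      ring)

/-- The three equations together define a linear map from the space of unknowns to the dual of that
same space. Injectivity and equality of dimensions make it bijective. -/
theorem system_existsUnique [FiniteDimensional ℝ V] [FiniteDimensional ℝ Q] (R : GaussRadau k) {a b : ℝ} (hab : a < b) {ρ c₀ : ℝ} (hρ : 0 < ρ)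
    (hc : 0 < c₀) {m A : LinearMap.BilinForm ℝ V} {n D : LinearMap.BilinForm ℝ Q}
    (B : V →ₗ[ℝ] Q →ₗ[ℝ] ℝ)
    (hm : ∀ x y, m x y = m y x) (hmp : ∀ x, x ≠ 0 → 0 < m x x)
    (hA : ∀ x y, A x y = A y x) (hAp : ∀ x, 0 ≤ A x x)
    (hn : ∀ x y, n x y = n y x) (hnp : ∀ x, x ≠ 0 → 0 < n x x)
    (hD : ∀ x y, D x y = D y x) (hDp : ∀ x, 0 ≤ D x x)
    (ℓ₁ ℓ₂ : (Fin (k + 1) → V) →ₗ[ℝ] ℝ) (ℓ₃ : (Fin (k + 1) → Q) →ₗ[ℝ] ℝ) :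
    ∃! x : (Fin (k + 1) → V) × (Fin (k + 1) → V) × (Fin (k + 1) → Q),
      (∀ Φ, eqU R a b m x.1 x.2.1 Φ = ℓ₁ Φ) ∧
      (∀ X, eqV R a b ρ m A B x.1 x.2.1 x.2.2 X = ℓ₂ X) ∧
      (∀ Ψ, eqP R a b c₀ n D B x.1 x.2.2 Ψ = ℓ₃ Ψ) := by
  set L := systemMap R a b ρ c₀ m A n D B with hL
  have hLa : ∀ x y, L x y = eqU R a b m x.1 x.2.1 y.1
      + eqV R a b ρ m A B x.1 x.2.1 x.2.2 y.2.1 + eqP R a b c₀ n D B x.1 x.2.2 y.2.2 :=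
    fun x y => rfl
  have z1 : ∀ U W, eqU R a b m U W 0 = 0 := fun U W => by
    simp [eqU, GaussRadau.quad_eq]
  have z2 : ∀ U W P, eqV R a b ρ m A B U W P 0 = 0 := fun U W P => by
    simp [eqV, GaussRadau.quad_eq]
  have z3 : ∀ U P, eqP R a b c₀ n D B U P 0 = 0 := fun U P => by
    simp [eqP, GaussRadau.quad_eq]
  have hinj : Function.Injective L := by
    rw [injective_iff_map_eq_zero]
    intro x hx
    have hx' : ∀ y, L x y = 0 := fun y => by rw [hx]; rfl
    obtain ⟨a1, a2, a3⟩ := system_injective R hab hρ hc B hm hmp hA hAp hn hnp hD hDp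
      (U := x.1) (W := x.2.1) (P := x.2.2)
      (fun Φ => by simpa [hLa, z1, z2, z3] using hx' (Φ, 0, 0))
      (fun X => by simpa [hLa, z1, z2, z3] using hx' (0, X, 0))
      (fun Ψ => by simpa [hLa, z1, z2, z3] using hx' (0, 0, Ψ))
    exact Prod.ext a1 (Prod.ext a2 a3)
  have hsurj : Function.Surjective L :=
    (LinearMap.injective_iff_surjective_of_finrank_eq_finrank
      (Subspace.dual_finrank_eq (K := ℝ)
        (V := (Fin (k + 1) → V) × (Fin (k + 1) → V) × (Fin (k + 1) → Q))).symm).1 hinj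
  -- Inserting test triples with a single nonzero component recovers the separate equations from
  -- their sum.
  have key : ∀ x, ((∀ Φ, eqU R a b m x.1 x.2.1 Φ = ℓ₁ Φ) ∧
      (∀ X, eqV R a b ρ m A B x.1 x.2.1 x.2.2 X = ℓ₂ X) ∧
      (∀ Ψ, eqP R a b c₀ n D B x.1 x.2.2 Ψ = ℓ₃ Ψ)) ↔
      L x = ℓ₁.coprod (ℓ₂.coprod ℓ₃) := by
    intro x
    constructor
    · rintro ⟨a1, a2, a3⟩
      refine LinearMap.ext fun y => ?_
      rw [hLa, a1, a2, a3]
      simp [add_assoc]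
    · intro h
      have hx : ∀ y, L x y = ℓ₁ y.1 + (ℓ₂ y.2.1 + ℓ₃ y.2.2) := fun y => by
        rw [h]; simp
      exact ⟨fun Φ => by simpa [hLa, z1, z2, z3] using hx (Φ, 0, 0),
        fun X => by simpa [hLa, z1, z2, z3] using hx (0, X, 0),
        fun Ψ => by simpa [hLa, z1, z2, z3] using hx (0, 0, Ψ)⟩
  obtain ⟨x, hx⟩ := hsurj (ℓ₁.coprod (ℓ₂.coprod ℓ₃))
  exact ⟨x, (key x).2 hx, fun y hy => hinj (((key y).1 hy).trans hx.symm)⟩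

end System

end Biot

end

noncomputable section

namespace Biot

/-! ### The reference cube -/

section Cube

variable {d : ℕ}

theorem refCube_eq : refCube d = (EuclideanSpace.equiv (Fin d) ℝ) ⁻¹' (univ.pi fun _ => Icc 0 1) := by
  ext x
  exact (mem_univ_pi (t := fun _ => Icc (0 : ℝ) 1)).symm

theorem refCubeO_eq :
    refCubeO d = (EuclideanSpace.equiv (Fin d) ℝ) ⁻¹' (univ.pi fun _ => Ioo 0 1) := by
  ext x
  exact (mem_univ_pi (t := fun _ => Ioo (0 : ℝ) 1)).symm

theorem isOpen_refCubeO : IsOpen (refCubeO d) := by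
  rw [refCubeO_eq]
  exact (isOpen_set_pi finite_univ fun _ _ => isOpen_Ioo).preimage
    (EuclideanSpace.equiv (Fin d) ℝ).continuous

theorem isCompact_refCube : IsCompact (refCube d) := by
  rw [refCube_eq]
  exact (EuclideanSpace.equiv (Fin d) ℝ).toHomeomorph.isCompact_preimage.2
    (isCompact_univ_pi fun _ => isCompact_Icc)

theorem convex_refCube : Convex ℝ (refCube d) := by
  rw [refCube_eq]
  exact (convex_pi fun _ _ => convex_Icc (0 : ℝ) 1).linear_preimage
    (EuclideanSpace.equiv (Fin d) ℝ).toLinearMap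

theorem closure_refCubeO : closure (refCubeO d) = refCube d := by
  rw [refCubeO_eq, refCube_eq]
  refine ((EuclideanSpace.equiv (Fin d) ℝ).toHomeomorph.preimage_closure _).symm.trans ?_
  rw [closure_pi_set]
  simp [closure_Ioo (zero_ne_one (α := ℝ))]

theorem interior_refCube : interior (refCube d) = refCubeO d := by
  rw [refCubeO_eq, refCube_eq]
  refine ((EuclideanSpace.equiv (Fin d) ℝ).toHomeomorph.preimage_interior _).symm.trans ?_
  rw [interior_pi_set finite_univ]
  simp

theorem refCubeO_subset : refCubeO d ⊆ refCube d := by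
  rw [← interior_refCube]
  exact interior_subset

theorem volume_refCube_diff : volume (refCube d \ refCubeO d) = 0 := by
  have h := (convex_refCube (d := d)).addHaar_frontier volume
  rwa [frontier, isCompact_refCube.isClosed.closure_eq, interior_refCube] at h

theorem refCubeO_nonempty : (refCubeO d).Nonempty := by
  rw [refCubeO_eq]
  exact (EuclideanSpace.equiv (Fin d) ℝ).surjective.nonempty_preimage.2
    (univ_pi_nonempty_iff.2 fun _ => nonempty_Ioo.2 zero_lt_one)

theorem volume_refCubeO_pos : 0 < volume (refCubeO d) :=
  isOpen_refCubeO.measure_pos volume refCubeO_nonempty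

theorem volume_refCubeO_lt_top : volume (refCubeO d) < ⊤ :=
  (measure_mono refCubeO_subset).trans_lt isCompact_refCube.measure_lt_top

end Cube

/-! ### Polynomial functions on `ℝ^d` -/

section Poly

variable {d : ℕ}

/-- The affine functions. -/
def affineFun (d : ℕ) : Submodule ℝ (E d → ℝ) :=
  Submodule.span ℝ (insert 1 (range fun (i : Fin d) (x : E d) => x i))

/-- The polynomial functions of degree at most `n`. -/
def polyFun (d n : ℕ) : Submodule ℝ (E d → ℝ) := affineFun d ^ n

theorem one_le_affineFun : (1 : Submodule ℝ (E d → ℝ)) ≤ affineFun d := by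
  rw [Submodule.one_le]
  exact Submodule.subset_span (mem_insert _ _)

theorem coord_mem (i : Fin d) : (fun x : E d => x i) ∈ polyFun d 1 := by
  rw [polyFun, pow_one]
  exact Submodule.subset_span (mem_insert_of_mem _ ⟨i, rfl⟩)

theorem polyFun_mono {m n : ℕ} (h : m ≤ n) : polyFun d m ≤ polyFun d n :=
  pow_le_pow_right' one_le_affineFun h

theorem const_mem_polyFun (n : ℕ) (c : ℝ) : (fun _ : E d => c) ∈ polyFun d n := by
  refine polyFun_mono (Nat.zero_le n) ?_
  rw [polyFun, pow_zero]
  exact Submodule.mem_one.2 ⟨c, rfl⟩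

theorem mul_mem_polyFun {m n : ℕ} {f g : E d → ℝ} (hf : f ∈ polyFun d m) (hg : g ∈ polyFun d n) :
    (fun x => f x * g x) ∈ polyFun d (m + n) := by
  rw [polyFun, pow_add]
  exact Submodule.mul_mem_mul hf hg

theorem sum_mem_polyFun {n : ℕ} {ι : Type*} (s : Finset ι) {f : ι → E d → ℝ}
    (h : ∀ i ∈ s, f i ∈ polyFun d n) : (fun x => ∑ i ∈ s, f i x) ∈ polyFun d n := by
  have := Submodule.sum_mem _ h
  rwa [show (∑ i ∈ s, f i) = fun x => ∑ i ∈ s, f i x from by ext; simp] at this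

theorem prod_mem_polyFun {n : ℕ} {ι : Type*} (s : Finset ι) {f : ι → E d → ℝ}
    (h : ∀ i ∈ s, f i ∈ polyFun d n) : (fun x => ∏ i ∈ s, f i x) ∈ polyFun d (s.card * n) := by
  classical
  induction s using Finset.induction_on with
  | empty => simpa using const_mem_polyFun 0 (1 : ℝ)
  | insert a s ha ih =>
    have h1 := mul_mem_polyFun (h a (by simp)) (ih fun i hi => h i (by simp [hi]))
    rw [Finset.card_insert_of_notMem ha, add_mul, one_mul, add_comm]
    simpa only [Finset.prod_insert ha] using h1

theorem const_mul_mem_polyFun {n : ℕ} {f : E d → ℝ} (c : ℝ) (hf : f ∈ polyFun d n) :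
    (fun x => c * f x) ∈ polyFun d n := (polyFun d n).smul_mem c hf

theorem pow_mem_polyFun {n : ℕ} (f : E d → ℝ) (hf : f ∈ polyFun d 1) :
    (fun x => f x ^ n) ∈ polyFun d n := by
  simpa using prod_mem_polyFun (Finset.range n) (f := fun _ => f) fun _ _ => hf

theorem det_mem_polyFun {n : ℕ} {A : E d → Matrix (Fin d) (Fin d) ℝ}
    (h : ∀ i j, (fun x => A x i j) ∈ polyFun d n) : (fun x => (A x).det) ∈ polyFun d (d * n) := by
  simp only [Matrix.det_apply']
  refine sum_mem_polyFun _ fun s _ => const_mul_mem_polyFun _ ?_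
  simpa using prod_mem_polyFun Finset.univ (f := fun i x => A x (s i) i) fun i _ => h (s i) i

theorem adjugate_mem_polyFun {n : ℕ} {A : E d → Matrix (Fin d) (Fin d) ℝ}
    (h : ∀ i j, (fun x => A x i j) ∈ polyFun d n) (i j : Fin d) :
    (fun x => (A x).adjugate i j) ∈ polyFun d (d * n) := by
  simp only [Matrix.adjugate_apply]
  refine det_mem_polyFun fun a b => ?_
  -- An adjugate entry is the determinant of the matrix with one row replaced by a constant unit
  -- vector, so the degree bound for determinants applies.
  by_cases hab : a = j
  · subst hab
    simpa using const_mem_polyFun n _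
  · simpa [Matrix.updateRow_ne hab] using h a b

theorem finiteDimensional_polyFun (n : ℕ) : FiniteDimensional ℝ (polyFun d n) := by
  have h : (affineFun d).FG := Submodule.fg_span ((finite_range _).insert _)
  exact Module.Finite.iff_fg.2 (h.pow n)

theorem contDiff_of_mem_polyFun {n : ℕ} {f : E d → ℝ} (hf : f ∈ polyFun d n) : ContDiff ℝ ∞ f := by
  have hlin : ∀ g ∈ affineFun d, ContDiff ℝ ∞ g := by
    intro g hg
    induction hg using Submodule.span_induction with
    | mem x h =>
      rcases h with rfl | ⟨i, rfl⟩
      · exact contDiff_const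
      · exact (EuclideanSpace.proj (𝕜 := ℝ) i).contDiff
    | zero => exact contDiff_const
    | add x y _ _ hx hy => exact hx.add hy
    | smul a x _ hx => exact contDiff_const.smul hx
  induction hf using Submodule.pow_induction_on_left' with
  | algebraMap r => exact contDiff_const
  | add x y i _ _ hx hy => exact hx.add hy
  | mem_mul m hm i x _ hx => exact (hlin m hm).mul hx

/-- Induction on products of affine functions with the product rule. The degree bound is not
lowered; only a bound independent of the mesh is needed later. -/
theorem fderiv_mem_polyFun {n : ℕ} {f : E d → ℝ} (hf : f ∈ polyFun d n) (v : E d) :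
    (fun x => fderiv ℝ f x v) ∈ polyFun d n := by
  have hlin : ∀ g ∈ affineFun d, Differentiable ℝ g ∧ ∃ c : ℝ, ∀ x, fderiv ℝ g x v = c := by
    intro g hg
    have hg' : g ∈ polyFun d 1 := by rwa [polyFun, pow_one]
    refine ⟨(contDiff_of_mem_polyFun hg').differentiable (by simp), ?_⟩
    induction hg using Submodule.span_induction with
    | mem x h =>
      rcases h with rfl | ⟨i, rfl⟩
      · exact ⟨0, fun x => by simp [Pi.one_def]⟩
      · refine ⟨v i, fun x => ?_⟩
        exact congrArg (fun l : E d →L[ℝ] ℝ => l v) (EuclideanSpace.proj (𝕜 := ℝ) i).fderiv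
    | zero => exact ⟨0, fun x => by simp [Pi.zero_def]⟩
    | add x y hx hy ihx ihy =>
      have hx' : x ∈ polyFun d 1 := by rwa [polyFun, pow_one]
      have hy' : y ∈ polyFun d 1 := by rwa [polyFun, pow_one]
      obtain ⟨c, hc⟩ := ihx hx'
      obtain ⟨e, he⟩ := ihy hy'
      refine ⟨c + e, fun z => ?_⟩
      rw [fderiv_add ((contDiff_of_mem_polyFun hx').differentiable (by simp) z)
        ((contDiff_of_mem_polyFun hy').differentiable (by simp) z), ← hc z, ← he z]
      rfl
    | smul a x hx ihx =>
      have hx' : x ∈ polyFun d 1 := by rwa [polyFun, pow_one]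
      obtain ⟨c, hc⟩ := ihx hx'
      refine ⟨a * c, fun z => ?_⟩
      rw [fderiv_const_smul ((contDiff_of_mem_polyFun hx').differentiable (by simp) z), ← hc z]
      rfl
  have hdiff : ∀ {i : ℕ} {x : E d → ℝ}, x ∈ polyFun d i → Differentiable ℝ x := fun h =>
    (contDiff_of_mem_polyFun h).differentiable (by simp)
  induction hf using Submodule.pow_induction_on_left' with
  | algebraMap r =>
    have : (algebraMap ℝ (E d → ℝ)) r = fun _ => r := rfl
    simp only [this, fderiv_fun_const]
    exact const_mem_polyFun 0 0
  | add x y i hx hy ihx ihy =>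
    have := Submodule.add_mem _ ihx ihy
    convert this using 1
    ext z
    rw [fderiv_add (hdiff hx z) (hdiff hy z)]
    rfl
  | mem_mul m hm i x hx ihx =>
    obtain ⟨hmd, c, hc⟩ := hlin m hm
    have h1 : m ∈ polyFun d 1 := by rwa [polyFun, pow_one]
    have h2 := mul_mem_polyFun h1 ihx
    rw [add_comm] at h2
    have h3 := polyFun_mono (Nat.le_succ i) (const_mul_mem_polyFun c hx)
    have := Submodule.add_mem _ h2 h3
    convert this using 1
    ext z
    rw [fderiv_mul (hmd z) (hdiff hx z)]
    simp [hc, mul_comm]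

theorem eval_mem_polyFun {n : ℕ} {P : MvPolynomial (Fin d) ℝ}
    (hP : ∀ m ∈ P.support, m.degree ≤ n) :
    (fun ξ : E d => MvPolynomial.eval (fun l => ξ l) P) ∈ polyFun d n := by
  simp only [MvPolynomial.eval_eq]
  refine sum_mem_polyFun _ fun m hm => const_mul_mem_polyFun _ ?_
  have key : ∀ s : Finset (Fin d), (fun ξ : E d => ∏ i ∈ s, ξ i ^ m i) ∈ polyFun d (∑ i ∈ s, m i) := by
    intro s
    induction s using Finset.induction_on with
    | empty => simpa using const_mem_polyFun 0 (1 : ℝ)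
    | insert a s ha ih =>
      rw [Finset.sum_insert ha]
      simpa only [Finset.prod_insert ha] using
        mul_mem_polyFun (pow_mem_polyFun _ (coord_mem a) (n := m a)) ih
  exact polyFun_mono (hP m hm) (key m.support)

/-- Degree at most `r` in each of `d` variables gives total degree at most `d * r`. This places the
`ℚ_r` and `ℙ_r` spaces in one scale. -/
theorem restrictDegree_mem_polyFun {r : ℕ} {P : MvPolynomial (Fin d) ℝ}
    (hP : P ∈ MvPolynomial.restrictDegree (Fin d) ℝ r) :
    (fun ξ : E d => MvPolynomial.eval (fun l => ξ l) P) ∈ polyFun d (d * r) := by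
  rw [MvPolynomial.mem_restrictDegree] at hP
  refine eval_mem_polyFun fun m hm => ?_
  rw [Finsupp.degree_eq_sum]
  exact (Finset.sum_le_sum fun i _ => hP m hm i).trans (by simp)

theorem restrictTotalDegree_mem_polyFun {r : ℕ} {P : MvPolynomial (Fin d) ℝ}
    (hP : P ∈ MvPolynomial.restrictTotalDegree (Fin d) ℝ r) :
    (fun ξ : E d => MvPolynomial.eval (fun l => ξ l) P) ∈ polyFun d r := by
  rw [MvPolynomial.mem_restrictTotalDegree] at hP
  refine eval_mem_polyFun fun m hm => ?_
  exact (MvPolynomial.le_totalDegree hm).trans hP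

/-- Inverse inequality: on polynomials of bounded degree the maximum over the reference cube is
controlled by the `L²` norm. -/
theorem exists_sq_le_integral (d n : ℕ) : ∃ c : ℝ, 0 < c ∧ ∀ f ∈ polyFun d n, ∀ ξ ∈ refCube d,
    f ξ ^ 2 ≤ c * ∫ x in refCubeO d, f x ^ 2 := by
  have := finiteDimensional_polyFun (d := d) n
  have : CompactSpace (refCube d) := isCompact_iff_compactSpace.1 isCompact_refCube
  -- Lebesgue measure on the closed cube as a compact space, where the sup norm and the `L²` norm of
  -- a continuous function can be compared.
  set ν : Measure (refCube d) := volume.comap Subtype.val with hν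
  have : IsFiniteMeasure ν := ⟨by
    rw [hν, comap_subtype_coe_apply isCompact_refCube.isClosed.measurableSet, image_univ,
      Subtype.range_coe]
    exact isCompact_refCube.measure_lt_top⟩
  -- A nonempty relatively open subset of the closed cube meets the open cube, whose closure is the
  -- closed cube. Consequently the map from continuous functions to `L²` is injective.
  have : ν.IsOpenPosMeasure := ⟨fun U hU hne => by
    obtain ⟨O, hO, rfl⟩ := isOpen_induced_iff.1 hU
    obtain ⟨⟨x, hx⟩, hxO⟩ := hne
    have hx' := hx
    rw [← closure_refCubeO] at hx'
    have hne' := mem_closure_iff.1 hx' O hO hxO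
    have hpos := (hO.inter isOpen_refCubeO).measure_pos volume hne'
    rw [hν, comap_subtype_coe_apply
      isCompact_refCube.isClosed.measurableSet]
    refine (hpos.trans_le (measure_mono ?_)).ne'
    rintro y ⟨hy1, hy2⟩
    exact ⟨⟨y, refCubeO_subset hy2⟩, hy1, rfl⟩⟩
  let res : polyFun d n →ₗ[ℝ] C(refCube d, ℝ) :=
    { toFun := fun f => ⟨fun x => f.1 x, (contDiff_of_mem_polyFun f.2).continuous.comp
        continuous_subtype_val⟩
      map_add' := fun _ _ => rfl
      map_smul' := fun _ _ => rfl }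
  let L : LinearMap.range res →ₗ[ℝ] Lp ℝ 2 ν :=
    (ContinuousMap.toLp 2 ν ℝ).toLinearMap ∘ₗ (LinearMap.range res).subtype
  have hL : LinearMap.ker L = ⊥ := LinearMap.ker_eq_bot.2
    ((ContinuousMap.toLp_injective (𝕜 := ℝ) (p := 2) ν).comp Subtype.val_injective)
  have : FiniteDimensional ℝ (LinearMap.range res) := LinearMap.finiteDimensional_range res
  -- An injective linear map on a finite-dimensional space is bounded below. The constant depends
  -- only on `d` and `n`.
  obtain ⟨K, hK, hKL⟩ := LinearMap.exists_antilipschitzWith (𝕜 := ℝ)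
    (E := ↥(LinearMap.range res)) (F := Lp ℝ 2 ν) L hL
  refine ⟨(K : ℝ) ^ 2, by positivity, fun f hf ξ hξ => ?_⟩
  let g : C(refCube d, ℝ) := res ⟨f, hf⟩
  have h1 : ‖g‖ ≤ K * ‖ContinuousMap.toLp (E := ℝ) 2 ν ℝ g‖ := by
    have := hKL.le_mul_dist ⟨g, LinearMap.mem_range_self _ _⟩ 0
    rw [map_zero, dist_zero_right, dist_zero_right] at this
    exact this
  have h2 : ‖ContinuousMap.toLp (E := ℝ) 2 ν ℝ g‖ ^ 2 = ∫ x in refCubeO d, f x ^ 2 := by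
    rw [← real_inner_self_eq_norm_sq, ContinuousMap.inner_toLp]
    have e1 : ∀ x : refCube d, g x * (starRingEnd ℝ) (g x) = f x ^ 2 := fun x => by
      simp [g, res, sq]
    simp only [e1]
    rw [hν, integral_subtype_comap isCompact_refCube.isClosed.measurableSet (fun x => f x ^ 2)]
    refine setIntegral_congr_set ?_
    refine (ae_eq_set.2 ⟨volume_refCube_diff, ?_⟩)
    rw [sdiff_eq_empty.2 refCubeO_subset, measure_empty]
  have h3 : |f ξ| ≤ ‖g‖ := g.norm_coe_le_norm ⟨ξ, hξ⟩
  rw [← sq_abs, ← h2, ← mul_pow]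
  exact pow_le_pow_left₀ (abs_nonneg _) (h3.trans h1) 2

end Poly

end Biot

end

noncomputable section

namespace Biot

/-! ### Multilinear maps -/

section Multilin

variable {d : ℕ} (a : (Fin d → Fin 2) → E d)

theorem multilin_apply_mem (i : Fin d) : (fun x => multilin a x i) ∈ polyFun d d := by
  have h : (fun x => multilin a x i)
      = fun x => ∑ s : Fin d → Fin 2, (a s i) * ∏ j, if s j = 1 then x j else 1 - x j := by
    ext x
    simp [multilin, mul_comm]
  rw [h]
  refine sum_mem_polyFun _ fun s _ => const_mul_mem_polyFun _ ?_
  have := prod_mem_polyFun (n := 1) (Finset.univ : Finset (Fin d))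
    (f := fun j (x : E d) => if s j = 1 then x j else 1 - x j) fun j _ => by
      split_ifs
      · exact coord_mem j
      · exact Submodule.sub_mem _ (const_mem_polyFun 1 1) (coord_mem j)
  simpa using this

theorem contDiff_multilin : ContDiff ℝ ∞ (multilin a) :=
  contDiff_euclidean.2 fun i => contDiff_of_mem_polyFun (multilin_apply_mem a i)

/-- The Jacobian matrix of a multilinear map. -/
def jacM (ξ : E d) : Matrix (Fin d) (Fin d) ℝ :=
  fun i j => fderiv ℝ (multilin a) ξ (basisVec d j) i

theorem jacM_eq (ξ : E d) (i j : Fin d) :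
    jacM a ξ i j = fderiv ℝ (fun x => multilin a x i) ξ (basisVec d j) := by
  have h := (contDiff_multilin a).differentiable (by simp) ξ
  have := ((EuclideanSpace.proj (𝕜 := ℝ) i).hasFDerivAt.comp ξ h.hasFDerivAt).fderiv
  exact (congrArg (fun l : E d →L[ℝ] ℝ => l (basisVec d j)) this).symm

theorem jacM_mem (i j : Fin d) : (fun ξ => jacM a ξ i j) ∈ polyFun d d := by
  simp only [jacM_eq]
  exact fderiv_mem_polyFun (multilin_apply_mem a i) _

theorem det_jacM (ξ : E d) : (jacM a ξ).det = (fderiv ℝ (multilin a) ξ).det := by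
  rw [ContinuousLinearMap.det, ← LinearMap.det_toMatrix (EuclideanSpace.basisFun (Fin d) ℝ).toBasis]
  congr 1

theorem det_mem : (fun ξ => (fderiv ℝ (multilin a) ξ).det) ∈ polyFun d (d * d) := by
  simp only [← det_jacM]
  exact det_mem_polyFun (jacM_mem a)

theorem continuous_det : Continuous fun ξ => (fderiv ℝ (multilin a) ξ).det :=
  (contDiff_of_mem_polyFun (det_mem a)).continuous

/-- Each Jacobian entry is bounded by the operator norm, and the Leibniz formula has `d!` terms. -/
theorem abs_det_le {ξ : E d} {c : ℝ} (h : ‖fderiv ℝ (multilin a) ξ‖ ≤ c) :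
    |(fderiv ℝ (multilin a) ξ).det| ≤ d.factorial * c ^ d := by
  rw [← det_jacM]
  have := Matrix.det_le (A := jacM a ξ) (abv := AbsoluteValue.abs) (x := c) fun i j => by
    have h1 : ‖fderiv ℝ (multilin a) ξ (basisVec d j) i‖
        ≤ ‖fderiv ℝ (multilin a) ξ (basisVec d j)‖ := PiLp.norm_apply_le _ i
    have h2 := (fderiv ℝ (multilin a) ξ).le_opNorm (basisVec d j)
    have h3 : ‖basisVec d j‖ = 1 := by simp [basisVec]
    rw [h3, mul_one] at h2
    exact h1.trans (h2.trans h)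
  simpa using this

end Multilin

/-! ### The surface of the reference cube -/

theorem surf_image_le {d : ℕ} {f : E d → E d} {K : NNReal} {s : Set (E d)}
    (hf : LipschitzOnWith K f s) : surf d (f '' s) ≤ (K : ENNReal) ^ (d - 1) * surf d s := by
  have h := hf.hausdorffMeasure_image_le (d := ((d - 1 : ℕ) : ℝ)) (Nat.cast_nonneg _)
  rw [surf, Measure.euclideanHausdorffMeasure_def, Measure.smul_apply, Measure.smul_apply]
  rw [ENNReal.rpow_natCast] at h
  rw [mul_smul_comm]
  exact mul_le_mul_right h _

/-- The surface is covered by `2d` faces, each a Lipschitz image of a unit cube of dimension `d -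
1`. In the sup norm the Hausdorff measure of that dimension is Lebesgue measure. For `d = 0` there
is no surface. -/
theorem surf_refCube_diff_lt_top (d : ℕ) : surf d (refCube d \ refCubeO d) < ⊤ := by
  rw [surf, Measure.euclideanHausdorffMeasure_def, Measure.smul_apply]
  refine ENNReal.mul_lt_top ENNReal.coe_lt_top ?_
  rcases d with _ | n
  · have : refCube 0 \ refCubeO 0 = ∅ := by
      rw [sdiff_eq_empty]
      exact fun x _ j => j.elim0
    rw [this, measure_empty]
    exact ENNReal.zero_lt_top
  let ins : Fin (n + 1) → ℝ → (Fin n → ℝ) → E (n + 1) := fun j c y =>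
    (EuclideanSpace.equiv (Fin (n + 1)) ℝ).symm (j.insertNth c y)
  have hsub : refCube (n + 1) \ refCubeO (n + 1) ⊆
      ⋃ j : Fin (n + 1), ⋃ b : Bool, ins j (if b then 1 else 0) '' Icc 0 1 := by
    rintro x ⟨hx, hxO⟩
    have hx' : ∀ j, x j ∈ Icc (0 : ℝ) 1 := hx
    have : ∃ j, x j ∉ Ioo (0 : ℝ) 1 := by
      by_contra! hc
      exact hxO hc
    obtain ⟨j, hj⟩ := this
    have hmem : ∀ c, x j = c → x ∈ ins j c '' Icc 0 1 := by
      rintro c rfl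
      refine ⟨fun l => x (j.succAbove l), ⟨fun l => (hx' _).1, fun l => (hx' _).2⟩, ?_⟩
      have : (j.insertNth (x j) fun l => x (j.succAbove l) : Fin (n + 1) → ℝ)
          = EuclideanSpace.equiv (Fin (n + 1)) ℝ x := Fin.insertNth_self_removeNth j _
      simp only [ins, this, ContinuousLinearEquiv.symm_apply_apply]
    simp only [mem_iUnion]
    rcases eq_or_lt_of_le (hx' j).1 with h0 | h0
    · exact ⟨j, false, by simpa using hmem 0 h0.symm⟩
    · rcases eq_or_lt_of_le (hx' j).2 with h1 | h1
      · exact ⟨j, true, by simpa using hmem 1 h1⟩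
      · exact absurd ⟨h0, h1⟩ hj
  refine (measure_mono hsub).trans_lt ?_
  refine (measure_iUnion_le _).trans_lt ?_
  rw [tsum_fintype]
  refine ENNReal.sum_lt_top.2 fun j _ => (measure_iUnion_le _).trans_lt ?_
  rw [tsum_fintype]
  refine ENNReal.sum_lt_top.2 fun b _ => ?_
  -- Inserting a fixed coordinate is nonexpansive in the sup norm; passing to the Euclidean norm
  -- costs only another Lipschitz constant.
  have hins : LipschitzWith 1 (fun y : Fin n → ℝ =>
      (j.insertNth (if b then 1 else 0) y : Fin (n + 1) → ℝ)) := by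
    refine LipschitzWith.of_dist_le_mul fun y z => ?_
    rw [NNReal.coe_one, one_mul, dist_pi_le_iff dist_nonneg, Fin.forall_iff_succAbove j]
    refine ⟨by simp, fun l => ?_⟩
    simpa using dist_le_pi_dist y z l
  have hlip := ((EuclideanSpace.equiv (Fin (n + 1)) ℝ).symm.lipschitz.comp hins)
  have h := (hlip.lipschitzOnWith (s := Icc 0 1)).hausdorffMeasure_image_le (d := (n : ℝ))
    (Nat.cast_nonneg _)
  refine h.trans_lt (ENNReal.mul_lt_top ?_ ?_)
  · exact ENNReal.rpow_lt_top_of_nonneg (Nat.cast_nonneg _) ENNReal.coe_ne_top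
  · have := hausdorffMeasure_pi_real (ι := Fin n)
    rw [Fintype.card_fin] at this
    rw [this]
    exact isCompact_Icc.measure_lt_top

/-! ### Geometry of the elements -/

namespace Mesh

variable {d : ℕ} {Ω : Set (E d)} (M : Mesh d Ω) (i : Fin M.num)

theorem continuous_map : Continuous (M.map i) := (contDiff_multilin _).continuous

theorem hasFDerivAt_map (ξ : E d) : HasFDerivAt (M.map i) (fderiv ℝ (M.map i) ξ) ξ :=
  ((contDiff_multilin _).differentiable (by simp) ξ).hasFDerivAt

theorem det_ne_zero {ξ : E d} (hξ : ξ ∈ refCube d) : (fderiv ℝ (M.map i) ξ).det ≠ 0 :=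
  M.regular i ξ hξ

theorem injOn_map : InjOn (M.map i) (refCube d) := M.injOn i

theorem closure_cell : closure (M.cell i) = M.map i '' refCube d := by
  have := image_closure_of_isCompact (f := M.map i) (s := refCubeO d)
    (by rw [closure_refCubeO]; exact isCompact_refCube) (M.continuous_map i).continuousOn
  rw [closure_refCubeO] at this
  exact this.symm

/-- The Jacobian is invertible, so by the inverse function theorem the reference map is open at each
point of the open cube. -/
theorem isOpen_cell : IsOpen (M.cell i) := by
  rw [isOpen_iff_mem_nhds]
  rintro _ ⟨ξ, hξ, rfl⟩
  have h : HasStrictFDerivAt (M.map i) (fderiv ℝ (M.map i) ξ) ξ :=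
    (contDiff_multilin _).contDiffAt.hasStrictFDerivAt (by simp)
  have hs := h.map_nhds_eq_of_equiv (f' := (fderiv ℝ (M.map i) ξ).toContinuousLinearEquivOfDetNeZero
    (M.det_ne_zero i (refCubeO_subset hξ)))
  rw [← hs]
  exact image_mem_map (isOpen_refCubeO.mem_nhds hξ)

theorem frontier_cell_subset : frontier (M.cell i) ⊆ M.map i '' (refCube d \ refCubeO d) := by
  rw [frontier, (M.isOpen_cell i).interior_eq, closure_cell]
  rintro _ ⟨⟨ξ, hξ, rfl⟩, h⟩
  exact ⟨ξ, ⟨hξ, fun h' => h ⟨ξ, h', rfl⟩⟩, rfl⟩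

theorem isCompact_closure_cell : IsCompact (closure (M.cell i)) := by
  rw [closure_cell]
  exact isCompact_refCube.image (M.continuous_map i)

theorem refPt_map {ξ : E d} (hξ : ξ ∈ refCube d) : M.refPt i (M.map i ξ) = ξ :=
  (M.injOn_map i) (Function.invFunOn_mem ⟨ξ, hξ, rfl⟩) hξ (Function.invFunOn_eq ⟨ξ, hξ, rfl⟩)

theorem refPt_mem {x : E d} (hx : x ∈ closure (M.cell i)) : M.refPt i x ∈ refCube d := by
  rw [closure_cell] at hx
  exact Function.invFunOn_mem hx

theorem map_refPt {x : E d} (hx : x ∈ closure (M.cell i)) : M.map i (M.refPt i x) = x := by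
  rw [closure_cell] at hx
  exact Function.invFunOn_eq hx

theorem refPt_mem_cell {x : E d} (hx : x ∈ M.cell i) : M.refPt i x ∈ refCubeO d := by
  obtain ⟨ξ, hξ, rfl⟩ := hx
  rwa [M.refPt_map i (refCubeO_subset hξ)]

/-- A continuous injection of a compact set maps closed sets to closed sets, so its inverse is
continuous up to the boundary of the element. -/
theorem continuousOn_refPt : ContinuousOn (M.refPt i) (closure (M.cell i)) := by
  rw [continuousOn_iff_isClosed]
  intro t ht
  refine ⟨M.map i '' (refCube d ∩ t), ((isCompact_refCube.inter_right ht).image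
    (M.continuous_map i)).isClosed, ?_⟩
  ext x
  constructor
  · rintro ⟨h1, h2⟩
    exact ⟨⟨M.refPt i x, ⟨M.refPt_mem i h2, h1⟩, M.map_refPt i h2⟩, h2⟩
  · rintro ⟨⟨ξ, ⟨h1, h2⟩, rfl⟩, h3⟩
    exact ⟨by rwa [mem_preimage, M.refPt_map i h1], h3⟩

theorem cell_subset : M.cell i ⊆ Ω := M.subset i

theorem closure_cell_subset : closure (M.cell i) ⊆ closure Ω := closure_mono (M.cell_subset i)

theorem cells_disjoint : Pairwise (Function.onFun Disjoint M.cell) :=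
  fun i j h => M.disjoint i j h

theorem isOpen_cells : IsOpen M.cells := isOpen_iUnion M.isOpen_cell

theorem cells_subset : M.cells ⊆ Ω := iUnion_subset M.cell_subset

/-- The skeleton lies in the images of the cube's surface, a null set, under finitely many smooth
maps. Integrals over `Ω` therefore see only the open cells, which is where the piecewise functions
are differentiable. -/
theorem volume_diff_cells : volume (closure Ω \ M.cells) = 0 := by
  have hsub : closure Ω \ M.cells ⊆ ⋃ i, M.map i '' (refCube d \ refCubeO d) := by
    rintro x ⟨hx, hxc⟩
    rw [M.cover] at hx
    obtain ⟨i, hi⟩ := mem_iUnion.1 hx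
    have hi' : x ∈ closure (M.cell i) := hi
    refine mem_iUnion.2 ⟨i, M.refPt i x, ⟨M.refPt_mem i hi', fun h => hxc ?_⟩, M.map_refPt i hi'⟩
    exact mem_iUnion.2 ⟨i, M.refPt i x, h, M.map_refPt i hi'⟩
  refine measure_mono_null hsub (measure_iUnion_null fun i => ?_)
  exact addHaar_image_eq_zero_of_differentiableOn_of_addHaar_eq_zero volume
    (fun ξ _ => (M.hasFDerivAt_map i ξ).differentiableAt.differentiableWithinAt) volume_refCube_diff

theorem restrict_eq : volume.restrict Ω = volume.restrict M.cells := by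
  refine Measure.restrict_congr_set (ae_eq_set.2 ⟨?_, ?_⟩)
  · exact measure_mono_null (sdiff_subset_sdiff_left subset_closure) M.volume_diff_cells
  · rw [sdiff_eq_empty.2 M.cells_subset, measure_empty]

theorem integral_cell (g : E d → ℝ) :
    ∫ x in M.cell i, g x = ∫ ξ in refCubeO d, |(fderiv ℝ (M.map i) ξ).det| * g (M.map i ξ) :=
  integral_image_eq_integral_abs_det_fderiv_smul volume isOpen_refCubeO.measurableSet
    (fun ξ _ => (M.hasFDerivAt_map i ξ).hasFDerivWithinAt)
    ((M.injOn_map i).mono refCubeO_subset) g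

theorem size_eq : M.size i = ∫ ξ in refCubeO d, |(fderiv ℝ (M.map i) ξ).det| := by
  have := M.integral_cell i fun _ => 1
  simpa [size, Measure.real] using this

theorem lipschitzOnWith_map {K : NNReal} (h : ∀ ξ ∈ refCube d, ‖fderiv ℝ (M.map i) ξ‖ ≤ K) :
    LipschitzOnWith K (M.map i) (refCube d) :=
  convex_refCube.lipschitzOnWith_of_nnnorm_fderiv_le
    (fun ξ _ => (M.hasFDerivAt_map i ξ).differentiableAt) h

theorem surf_frontier_le {K : NNReal} (h : ∀ ξ ∈ refCube d, ‖fderiv ℝ (M.map i) ξ‖ ≤ K) :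
    surf d (frontier (M.cell i)) ≤ (K : ENNReal) ^ (d - 1) * surf d (refCube d \ refCubeO d) :=
  (measure_mono (M.frontier_cell_subset i)).trans
    (surf_image_le ((M.lipschitzOnWith_map i h).mono sdiff_subset))

theorem continuous_fderiv_map : Continuous (fderiv ℝ (M.map i)) :=
  (contDiff_multilin _).continuous_fderiv (by simp)

theorem surf_frontier_lt_top : surf d (frontier (M.cell i)) < ⊤ := by
  obtain ⟨C, hC⟩ := isCompact_refCube.exists_bound_of_continuousOn
    (M.continuous_fderiv_map i).continuousOn
  have := M.surf_frontier_le i (K := C.toNNReal) fun ξ hξ => (hC ξ hξ).trans (Real.le_coe_toNNReal C)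
  refine this.trans_lt (ENNReal.mul_lt_top ?_ (surf_refCube_diff_lt_top d))
  exact ENNReal.pow_lt_top ENNReal.coe_lt_top

/-- The surface measure on the boundary of the `i`-th element. -/
def bd : Measure (E d) := (surf d).restrict (frontier (M.cell i))

instance : IsFiniteMeasure (M.bd i) := ⟨by
  rw [bd, Measure.restrict_apply_univ]
  exact M.surf_frontier_lt_top i⟩

/-! ### Traces -/

/-- Since the reference coordinates are continuous up to the boundary, a function whose pullback
extends continuously to the closed cube has a one-sided limit. This makes the trace `tr` explicit,
rather than an unspecified default of `extendFrom`. -/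
theorem tendsto_cell {F : Type*} [TopologicalSpace F] {w g : E d → F} (hg : ContinuousOn g (refCube d))
    (h : ∀ ξ ∈ refCubeO d, w (M.map i ξ) = g ξ) {x : E d} (hx : x ∈ closure (M.cell i)) :
    Tendsto w (𝓝[M.cell i] x) (𝓝 (g (M.refPt i x))) := by
  have h1 : ContinuousOn (fun y => g (M.refPt i y)) (closure (M.cell i)) :=
    hg.comp (M.continuousOn_refPt i) fun y hy => M.refPt_mem i hy
  have h2 : Tendsto (fun y => g (M.refPt i y)) (𝓝[M.cell i] x) (𝓝 (g (M.refPt i x))) :=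
    (h1 x hx).mono_left (nhdsWithin_mono x subset_closure)
  refine h2.congr' ?_
  filter_upwards [self_mem_nhdsWithin] with y hy
  rw [← h _ (M.refPt_mem_cell i hy), M.map_refPt i (subset_closure hy)]

theorem tr_eq {F : Type*} [TopologicalSpace F] [T2Space F] {w g : E d → F}
    (hg : ContinuousOn g (refCube d))
    (h : ∀ ξ ∈ refCubeO d, w (M.map i ξ) = g ξ) {x : E d} (hx : x ∈ closure (M.cell i)) :
    M.tr i w x = g (M.refPt i x) :=
  extendFrom_eq hx (M.tendsto_cell i hg h hx)

/-- Stated as an inequality because normalizing the zero vector gives zero. The upper bound is all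
the estimates require. -/
theorem norm_normal_le (x : E d) : ‖M.normal i x‖ ≤ 1 := by
  simp only [normal, norm_smul, norm_inv, norm_norm]
  exact inv_mul_le_one

theorem measurable_refNormal : Measurable (refNormal (d := d)) := by
  have hm : ∀ j : Fin d, Measurable fun x : E d => x j := fun j =>
    (EuclideanSpace.proj (𝕜 := ℝ) j).continuous.measurable
  have hs : ∀ (j : Fin d) (c : ℝ), MeasurableSet {x : E d | x j = c} := fun j c =>
    measurableSet_eq_fun (hm j) measurable_const
  unfold refNormal
  refine Finset.measurable_sum _ fun j _ => Measurable.smul_const ?_ _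
  exact (Measurable.ite (hs j 1) measurable_const measurable_const).sub
    (Measurable.ite (hs j 0) measurable_const measurable_const)

theorem aestronglyMeasurable_of_continuousOn {F : Type*} [TopologicalSpace F]
    [TopologicalSpace.PseudoMetrizableSpace F] [SecondCountableTopology F] {f : E d → F}
    (hf : ContinuousOn f (closure (M.cell i))) : AEStronglyMeasurable f (M.bd i) :=
  (hf.mono frontier_subset_closure).aestronglyMeasurable isClosed_frontier.measurableSet

/-- The factor `DF^{-T}` varies continuously, but the reference normal jumps between faces, so it is
only measurable. -/
theorem aestronglyMeasurable_normal : AEStronglyMeasurable (M.normal i) (M.bd i) := by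
  have h1 : AEStronglyMeasurable (fun x => ContinuousLinearMap.adjoint
      (fderiv ℝ (M.map i) (M.refPt i x)).inverse) (M.bd i) := by
    refine M.aestronglyMeasurable_of_continuousOn i ?_
    refine (LinearIsometryEquiv.continuous _).comp_continuousOn ?_
    intro x hx
    have hx' := M.refPt_mem i hx
    have hinv : ContinuousAt ContinuousLinearMap.inverse (fderiv ℝ (M.map i) (M.refPt i x)) :=
      (contDiffAt_map_inverse (n := 0) ((fderiv ℝ (M.map i) (M.refPt i x)).toContinuousLinearEquivOfDetNeZero
        (M.det_ne_zero i hx'))).continuousAt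
    exact ContinuousAt.comp_continuousWithinAt (f := fun y => fderiv ℝ (M.map i) (M.refPt i y)) hinv
      (((M.continuous_fderiv_map i).comp_continuousOn (M.continuousOn_refPt i)) x hx)
  have h2 : AEStronglyMeasurable (fun x => refNormal (M.refPt i x)) (M.bd i) :=
    (measurable_refNormal.comp_aemeasurable
      (M.aestronglyMeasurable_of_continuousOn i (M.continuousOn_refPt i)).aemeasurable).aestronglyMeasurable
  have h3 : AEStronglyMeasurable (fun x => ContinuousLinearMap.adjoint
      (fderiv ℝ (M.map i) (M.refPt i x)).inverse (refNormal (M.refPt i x))) (M.bd i) :=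
    isBoundedBilinearMap_apply.continuous.comp_aestronglyMeasurable (h1.prodMk h2)
  exact (h3.norm.aemeasurable.inv.aestronglyMeasurable).smul h3

end Mesh

end Biot

end

/-! ### Piecewise mapped polynomials: traces, derivatives and scaled trace estimates -/

noncomputable section

namespace Biot

namespace Mesh

variable {d : ℕ} {Ω : Set (E d)} (M : Mesh d Ω)

/-- Functions that are mapped polynomials of degree at most `n` on each element. -/
def IsPW (n : ℕ) (q : E d → ℝ) : Prop :=
  ∀ i, ∃ g ∈ polyFun d n, ∀ ξ ∈ refCubeO d, q (M.map i ξ) = g ξ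

/-- Functions that are mapped polynomials of degree at most `n` on each element after
multiplication with the Jacobian determinant. -/
def IsRat (n : ℕ) (φ : E d → ℝ) : Prop :=
  ∀ i, ∃ g ∈ polyFun d n, ∀ ξ ∈ refCubeO d, φ (M.map i ξ) * (fderiv ℝ (M.map i) ξ).det = g ξ

/-- Functions whose restriction to each open element extends continuously to the closure. -/
def IsReg (φ : E d → ℝ) : Prop :=
  ∀ i, ∃ g : E d → ℝ, ContinuousOn g (refCube d) ∧ ∀ ξ ∈ refCubeO d, φ (M.map i ξ) = g ξ

variable {M}

theorem IsPW.isReg {n : ℕ} {q : E d → ℝ} (h : M.IsPW n q) : M.IsReg q := fun i => by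
  obtain ⟨g, hg, hq⟩ := h i
  exact ⟨g, (contDiff_of_mem_polyFun hg).continuous.continuousOn, hq⟩

theorem IsRat.isReg {n : ℕ} {φ : E d → ℝ} (h : M.IsRat n φ) : M.IsReg φ := fun i => by
  obtain ⟨g, hg, hq⟩ := h i
  refine ⟨fun ξ => g ξ / (fderiv ℝ (M.map i) ξ).det,
    (contDiff_of_mem_polyFun hg).continuous.continuousOn.div (continuous_det _).continuousOn
      fun ξ hξ => M.det_ne_zero i hξ, fun ξ hξ => ?_⟩
  exact (eq_div_iff (M.det_ne_zero i (refCubeO_subset hξ))).2 (hq ξ hξ)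

theorem IsRat.add {n : ℕ} {φ ψ : E d → ℝ} (h : M.IsRat n φ) (h' : M.IsRat n ψ) :
    M.IsRat n fun x => φ x + ψ x := fun i => by
  obtain ⟨g, hg, hq⟩ := h i
  obtain ⟨g', hg', hq'⟩ := h' i
  exact ⟨_, Submodule.add_mem _ hg hg', fun ξ hξ => by rw [add_mul, hq ξ hξ, hq' ξ hξ]; rfl⟩

theorem IsRat.const_mul {n : ℕ} {φ : E d → ℝ} (c : ℝ) (h : M.IsRat n φ) :
    M.IsRat n fun x => c * φ x := fun i => by
  obtain ⟨g, hg, hq⟩ := h i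
  exact ⟨_, const_mul_mem_polyFun c hg, fun ξ hξ => by rw [mul_assoc, hq ξ hξ]⟩

theorem IsRat.congr {n : ℕ} {φ ψ : E d → ℝ} (h : M.IsRat n φ) (h' : ∀ x ∈ M.cells, ψ x = φ x) :
    M.IsRat n ψ := fun i => by
  obtain ⟨g, hg, hq⟩ := h i
  exact ⟨g, hg, fun ξ hξ => by rw [h' _ (mem_iUnion.2 ⟨i, ξ, hξ, rfl⟩), hq ξ hξ]⟩

theorem IsReg.add {φ ψ : E d → ℝ} (h : M.IsReg φ) (h' : M.IsReg ψ) :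
    M.IsReg fun x => φ x + ψ x := fun i => by
  obtain ⟨g, hg, hq⟩ := h i
  obtain ⟨g', hg', hq'⟩ := h' i
  exact ⟨_, hg.add hg', fun ξ hξ => congrArg₂ (· + ·) (hq ξ hξ) (hq' ξ hξ)⟩

theorem IsReg.mul {φ ψ : E d → ℝ} (h : M.IsReg φ) (h' : M.IsReg ψ) :
    M.IsReg fun x => φ x * ψ x := fun i => by
  obtain ⟨g, hg, hq⟩ := h i
  obtain ⟨g', hg', hq'⟩ := h' i
  exact ⟨_, hg.mul hg', fun ξ hξ => congrArg₂ (· * ·) (hq ξ hξ) (hq' ξ hξ)⟩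

theorem isReg_const (c : ℝ) : M.IsReg fun _ => c := fun _ =>
  ⟨fun _ => c, continuousOn_const, fun _ _ => rfl⟩

theorem IsReg.const_mul {φ : E d → ℝ} (c : ℝ) (h : M.IsReg φ) : M.IsReg fun x => c * φ x :=
  (isReg_const c).mul h

theorem isReg_sum {ι : Type*} (s : Finset ι) {φ : ι → E d → ℝ} (h : ∀ i ∈ s, M.IsReg (φ i)) :
    M.IsReg fun x => ∑ i ∈ s, φ i x := by
  classical
  induction s using Finset.induction_on with
  | empty => simpa using isReg_const 0
  | insert a s ha ih =>
    simp only [Finset.sum_insert ha]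
    exact (h a (by simp)).add (ih fun i hi => h i (by simp [hi]))

theorem IsReg.continuousOn_cells {φ : E d → ℝ} (h : M.IsReg φ) : ContinuousOn φ M.cells := by
  intro x hx
  obtain ⟨i, hi⟩ := mem_iUnion.1 hx
  obtain ⟨g, hg, hq⟩ := h i
  have hi' := subset_closure hi
  have := M.tendsto_cell i hg hq hi'
  rw [← hq _ (M.refPt_mem_cell i hi), M.map_refPt i hi', (M.isOpen_cell i).nhdsWithin_eq hi] at this
  exact ContinuousAt.continuousWithinAt this

theorem IsReg.memLp_top {φ : E d → ℝ} (h : M.IsReg φ) : MemLp φ ⊤ (volume.restrict Ω) := by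
  rw [M.restrict_eq]
  have hb : ∀ i, ∃ C, ∀ x ∈ M.cell i, ‖φ x‖ ≤ C := fun i => by
    obtain ⟨g, hg, hq⟩ := h i
    obtain ⟨C, hC⟩ := isCompact_refCube.exists_bound_of_continuousOn hg
    refine ⟨C, ?_⟩
    rintro _ ⟨ξ, hξ, rfl⟩
    rw [hq ξ hξ]
    exact hC ξ (refCubeO_subset hξ)
  choose C hC using hb
  refine memLp_top_of_bound (h.continuousOn_cells.aestronglyMeasurable M.isOpen_cells.measurableSet)
    (∑ i, |C i|) (ae_restrict_of_forall_mem M.isOpen_cells.measurableSet fun x hx => ?_)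
  obtain ⟨i, hi⟩ := mem_iUnion.1 hx
  exact (hC i x hi).trans ((le_abs_self _).trans
    (Finset.single_le_sum (f := fun i => |C i|) (fun _ _ => abs_nonneg _) (Finset.mem_univ i)))

theorem IsReg.tr_add {φ ψ : E d → ℝ} (h : M.IsReg φ) (h' : M.IsReg ψ) {i : Fin M.num} {x : E d}
    (hx : x ∈ closure (M.cell i)) :
    M.tr i (fun y => φ y + ψ y) x = M.tr i φ x + M.tr i ψ x := by
  obtain ⟨g, hg, hq⟩ := h i
  obtain ⟨g', hg', hq'⟩ := h' i
  rw [M.tr_eq i hg hq hx, M.tr_eq i hg' hq' hx,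
    M.tr_eq i (hg.add hg') (fun ξ hξ => by rw [hq ξ hξ, hq' ξ hξ]; rfl) hx]
  rfl

theorem IsReg.tr_const_mul {φ : E d → ℝ} (c : ℝ) (h : M.IsReg φ) {i : Fin M.num} {x : E d}
    (hx : x ∈ closure (M.cell i)) : M.tr i (fun y => c * φ y) x = c * M.tr i φ x := by
  obtain ⟨g, hg, hq⟩ := h i
  rw [M.tr_eq i hg hq hx]
  exact M.tr_eq i (g := fun ξ => c * g ξ) (continuousOn_const.mul hg)
    (fun ξ hξ => congrArg (c * ·) (hq ξ hξ)) hx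

theorem tr_congr {F : Type*} [TopologicalSpace F] [T2Space F] {φ ψ g : E d → F} {i : Fin M.num}
    (hg : ContinuousOn g (refCube d)) (h : ∀ ξ ∈ refCubeO d, φ (M.map i ξ) = g ξ)
    (h' : ∀ x ∈ M.cells, ψ x = φ x) {x : E d}
    (hx : x ∈ closure (M.cell i)) : M.tr i ψ x = M.tr i φ x := by
  rw [M.tr_eq i hg h hx, M.tr_eq i hg (fun ξ hξ => by
    rw [h' _ (mem_iUnion.2 ⟨i, ξ, hξ, rfl⟩), h ξ hξ]) hx]

theorem IsReg.tr_congr {φ ψ : E d → ℝ} (h : M.IsReg φ) (h' : ∀ x ∈ M.cells, ψ x = φ x)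
    {i : Fin M.num} {x : E d} (hx : x ∈ closure (M.cell i)) : M.tr i ψ x = M.tr i φ x := by
  obtain ⟨g, hg, hq⟩ := h i
  exact Mesh.tr_congr hg hq h' hx

theorem IsReg.continuousOn_tr {φ : E d → ℝ} (h : M.IsReg φ) (i : Fin M.num) :
    ContinuousOn (M.tr i φ) (closure (M.cell i)) := by
  obtain ⟨g, hg, hq⟩ := h i
  exact (hg.comp (M.continuousOn_refPt i) fun y hy => M.refPt_mem i hy).congr
    fun x hx => M.tr_eq i hg hq hx

theorem memLp_top_of_continuousOn {f : E d → ℝ} {i : Fin M.num}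
    (hf : ContinuousOn f (closure (M.cell i))) : MemLp f ⊤ (M.bd i) := by
  obtain ⟨C, hC⟩ := (M.isCompact_closure_cell i).exists_bound_of_continuousOn hf
  exact memLp_top_of_bound (M.aestronglyMeasurable_of_continuousOn i hf) C
    (ae_restrict_of_forall_mem isClosed_frontier.measurableSet
      fun x hx => hC x (frontier_subset_closure hx))

theorem IsReg.memLp_tr {φ : E d → ℝ} (h : M.IsReg φ) (i : Fin M.num) : MemLp (M.tr i φ) ⊤ (M.bd i) :=
  memLp_top_of_continuousOn (h.continuousOn_tr i)

theorem memLp_normal (i : Fin M.num) (j : Fin d) : MemLp (fun x => M.normal i x j) ⊤ (M.bd i) := by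
  refine memLp_top_of_bound ((EuclideanSpace.proj (𝕜 := ℝ) j).continuous.comp_aestronglyMeasurable
    (M.aestronglyMeasurable_normal i)) 1 (Eventually.of_forall fun x => ?_)
  exact (PiLp.norm_apply_le _ j).trans (M.norm_normal_le i x)

/-! ### Gradients of mapped polynomials -/

/-- Inside the element `q` is `g` composed with the inverse of the reference map, and this inverse
is differentiable because the Jacobian is invertible. -/
theorem hasFDerivAt_of_eq {q g : E d → ℝ} {i : Fin M.num} (hg : ContDiff ℝ ∞ g)
    (h : ∀ ξ ∈ refCubeO d, q (M.map i ξ) = g ξ) {x : E d} (hx : x ∈ M.cell i) :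
    DifferentiableAt ℝ q x := by
  have hx' := subset_closure hx
  have hn : M.cell i ∈ 𝓝 x := (M.isOpen_cell i).mem_nhds hx
  have h1 : HasFDerivAt (M.refPt i) _ x := HasFDerivAt.of_local_left_inverse
    (f' := (fderiv ℝ (M.map i) (M.refPt i x)).toContinuousLinearEquivOfDetNeZero
      (M.det_ne_zero i (M.refPt_mem i hx')))
    (((M.continuousOn_refPt i).mono subset_closure).continuousAt hn)
    (M.hasFDerivAt_map i _)
    (by filter_upwards [hn] with y hy using M.map_refPt i (subset_closure hy))
  have h2 : DifferentiableAt ℝ (fun y => g (M.refPt i y)) x :=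
    (hg.differentiable (by simp) _).comp x h1.differentiableAt
  refine h2.congr_of_eventuallyEq ?_
  filter_upwards [hn] with y hy
  rw [← h _ (M.refPt_mem_cell i hy), M.map_refPt i (subset_closure hy)]

theorem IsPW.differentiableAt {n : ℕ} {q : E d → ℝ} (h : M.IsPW n q) {x : E d} (hx : x ∈ M.cells) :
    DifferentiableAt ℝ q x := by
  obtain ⟨i, hi⟩ := mem_iUnion.1 hx
  obtain ⟨g, hg, hq⟩ := h i
  exact hasFDerivAt_of_eq (contDiff_of_mem_polyFun hg) hq hi

/-- The chain rule gives `∇g = ∇q · DF`. Multiplying by the adjugate yields `det DF · ∇q = ∇g · adj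
DF`, which is polynomial: `∇g` has degree at most `n`, and the adjugate of a matrix with entries of
degree at most `d` has entries of degree at most `d * d`. -/
theorem IsPW.isRat_grad {n : ℕ} {q : E d → ℝ} (h : M.IsPW n q) (j : Fin d) :
    M.IsRat (n + d * d) fun x => grad q x j := fun i => by
  obtain ⟨g, hg, hq⟩ := h i
  refine ⟨fun ξ => ∑ l, fderiv ℝ g ξ (basisVec d l) * (jacM (M.vert i) ξ).adjugate l j,
    sum_mem_polyFun _ fun l _ => mul_mem_polyFun (fderiv_mem_polyFun hg _)
      (adjugate_mem_polyFun (jacM_mem _) l j), fun ξ hξ => ?_⟩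
  have hx : M.map i ξ ∈ M.cell i := ⟨ξ, hξ, rfl⟩
  have hd : DifferentiableAt ℝ q (M.map i ξ) := hasFDerivAt_of_eq (contDiff_of_mem_polyFun hg) hq hx
  have hgq : g =ᶠ[𝓝 ξ] q ∘ M.map i := by
    filter_upwards [isOpen_refCubeO.mem_nhds hξ] with η hη using (hq η hη).symm
  have hchain : ∀ l, fderiv ℝ g ξ (basisVec d l)
      = ∑ m, grad q (M.map i ξ) m * jacM (M.vert i) ξ m l := fun l => by
    rw [hgq.fderiv_eq, fderiv_comp ξ hd (M.hasFDerivAt_map i ξ).differentiableAt]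
    have hsum : fderiv ℝ (M.map i) ξ (basisVec d l)
        = ∑ m, jacM (M.vert i) ξ m l • basisVec d m := by
      have := (EuclideanSpace.basisFun (Fin d) ℝ).sum_repr (fderiv ℝ (M.map i) ξ (basisVec d l))
      rw [← this]
      simp only [EuclideanSpace.basisFun_apply, EuclideanSpace.basisFun_repr]
      rfl
    rw [ContinuousLinearMap.comp_apply, hsum, map_sum]
    exact Finset.sum_congr rfl fun m _ => by rw [map_smul, smul_eq_mul, mul_comm]; rfl
  have hv : (fun l => fderiv ℝ g ξ (basisVec d l))
      = Matrix.vecMul (grad q (M.map i ξ)) (jacM (M.vert i) ξ) := by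
    ext l
    rw [hchain]
    rfl
  have h2 : Matrix.vecMul (fun l => fderiv ℝ g ξ (basisVec d l)) (jacM (M.vert i) ξ).adjugate
      = (fderiv ℝ (M.map i) ξ).det • grad q (M.map i ξ) := by
    rw [hv, Matrix.vecMul_vecMul, Matrix.mul_adjugate, det_jacM, Matrix.vecMul_smul,
      Matrix.vecMul_one]
    rfl
  have h3 := congrFun h2 j
  rw [mul_comm]
  exact h3.symm

theorem IsPW.isReg_grad {n : ℕ} {q : E d → ℝ} (h : M.IsPW n q) (j : Fin d) :
    M.IsReg fun x => grad q x j := (h.isRat_grad j).isReg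

theorem IsPW.tr_grad {n : ℕ} {q : E d → ℝ} (h : M.IsPW n q) {i : Fin M.num} {x : E d}
    (hx : x ∈ closure (M.cell i)) (j : Fin d) :
    M.tr i (grad q) x j = M.tr i (fun y => grad q y j) x := by
  choose g hg hq using fun j => h.isReg_grad j i
  rw [M.tr_eq i (hg j) (hq j) hx, M.tr_eq i (g := fun ξ j => g j ξ) (continuousOn_pi.2 hg)
    (fun ξ hξ => funext fun j => hq j ξ hξ) hx]

/-- Vector fields with components that are mapped polynomials on each element. -/
def IsPWV (M : Mesh d Ω) (n : ℕ) (v : E d → E d) : Prop := ∀ j, M.IsPW n fun x => v x j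

theorem IsPWV.jac_eq {n : ℕ} {v : E d → E d} (h : M.IsPWV n v) {x : E d} (hx : x ∈ M.cells)
    (a b : Fin d) : jac v x a b = grad (fun y => v y a) x b := by
  have hd : DifferentiableAt ℝ v x := differentiableAt_euclidean.2 fun j => (h j).differentiableAt hx
  have := ((EuclideanSpace.proj (𝕜 := ℝ) a).hasFDerivAt.comp x hd.hasFDerivAt).fderiv
  exact (congrArg (fun l : E d →L[ℝ] ℝ => l (basisVec d b)) this).symm

theorem IsPWV.isRat_jac {n : ℕ} {v : E d → E d} (h : M.IsPWV n v) (a b : Fin d) :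
    M.IsRat (n + d * d) fun x => jac v x a b :=
  ((h a).isRat_grad b).congr fun _ hx => h.jac_eq hx a b

theorem strain_apply (v : E d → E d) (x : E d) (a b : Fin d) :
    strain v x a b = 1 / 2 * (jac v x a b + jac v x b a) := rfl

theorem IsPWV.isRat_strain {n : ℕ} {v : E d → E d} (h : M.IsPWV n v) (a b : Fin d) :
    M.IsRat (n + d * d) fun x => strain v x a b :=
  ((h.isRat_jac a b).add (h.isRat_jac b a)).const_mul (1 / 2)

theorem IsPWV.isReg_strain {n : ℕ} {v : E d → E d} (h : M.IsPWV n v) (a b : Fin d) :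
    M.IsReg fun x => strain v x a b := (h.isRat_strain a b).isReg

theorem IsPWV.isReg_dvg {n : ℕ} {v : E d → E d} (h : M.IsPWV n v) : M.IsReg (dvg v) :=
  isReg_sum Finset.univ (φ := fun a x => jac v x a a) fun a _ => (h.isRat_jac a a).isReg

theorem IsPWV.tr_strain {n : ℕ} {v : E d → E d} (h : M.IsPWV n v) {i : Fin M.num} {x : E d}
    (hx : x ∈ closure (M.cell i)) (a b : Fin d) :
    M.tr i (strain v) x a b = M.tr i (fun y => strain v y a b) x := by
  choose g hg hq using fun a b => h.isReg_strain a b i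
  let G : E d → Matrix (Fin d) (Fin d) ℝ := fun ξ => Matrix.of fun a b => g a b ξ
  have hc : ContinuousOn G (refCube d) :=
    continuousOn_pi.2 fun a => continuousOn_pi.2 (hg a)
  have h1 := M.tr_eq i (w := strain v) (g := G) hc
    (fun ξ hξ => funext fun a => funext fun b => hq a b ξ hξ) hx
  exact (congrFun (congrFun h1 a) b).trans (M.tr_eq i (hg a b) (hq a b) hx).symm

/-! ### Scaling under quasi-uniformity -/

/-- Quasi-uniformity with constant `σ` and mesh size `h`. -/
structure QU (M : Mesh d Ω) (σ h : ℝ) : Prop where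
  pos : 0 < h
  norm_le : ∀ i, ∀ x ∈ refCube d, ‖fderiv ℝ (M.map i) x‖ ≤ σ * h
  le_det : ∀ i, ∀ x ∈ refCube d, h ^ d ≤ σ * |(fderiv ℝ (M.map i) x).det|

theorem QuasiUniform.exists_qu {σ : ℝ} (h : M.QuasiUniform σ) : ∃ h, M.QU σ h := by
  obtain ⟨h, hh, hq⟩ := h
  exact ⟨h, hh, fun i x hx => (hq i x hx).1, fun i x hx => (hq i x hx).2⟩

/-- The volume of the reference cube. -/
def refVol (d : ℕ) : ℝ := volume.real (refCubeO d)

theorem refVol_pos (d : ℕ) : 0 < refVol d :=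
  ENNReal.toReal_pos volume_refCubeO_pos.ne' volume_refCubeO_lt_top.ne

namespace QU

variable {σ h : ℝ}

theorem sigma_pos (H : M.QU σ h) (i : Fin M.num) : 0 < σ := by
  obtain ⟨ξ, hξ⟩ := refCubeO_nonempty (d := d)
  have h1 := H.le_det i ξ (refCubeO_subset hξ)
  exact pos_of_mul_pos_left ((pow_pos H.pos d).trans_le h1) (abs_nonneg _)

theorem det_le (H : M.QU σ h) (i : Fin M.num) {ξ : E d} (hξ : ξ ∈ refCube d) :
    |(fderiv ℝ (M.map i) ξ).det| ≤ d.factorial * (σ * h) ^ d :=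
  abs_det_le _ (H.norm_le i ξ hξ)

theorem integrableOn_refCubeO {g : E d → ℝ} (hg : ContinuousOn g (refCube d)) :
    IntegrableOn g (refCubeO d) :=
  (hg.integrableOn_compact isCompact_refCube).mono_set refCubeO_subset

theorem size_le (H : M.QU σ h) (i : Fin M.num) : M.size i ≤ d.factorial * (σ * h) ^ d * refVol d := by
  rw [size_eq]
  refine (setIntegral_mono_on (integrableOn_refCubeO (continuous_det _).abs.continuousOn)
    (integrableOn_refCubeO continuousOn_const) isOpen_refCubeO.measurableSet
    fun ξ hξ => H.det_le i (refCubeO_subset hξ)).trans (le_of_eq ?_)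
  rw [setIntegral_const, smul_eq_mul, mul_comm]
  rfl

theorem le_size (H : M.QU σ h) (i : Fin M.num) : h ^ d * refVol d ≤ σ * M.size i := by
  rw [size_eq, ← integral_const_mul]
  refine le_trans (le_of_eq ?_) (setIntegral_mono_on (f := fun _ => h ^ d)
    (integrableOn_refCubeO continuousOn_const)
    (integrableOn_refCubeO (continuous_const.mul (continuous_det _).abs).continuousOn)
    isOpen_refCubeO.measurableSet fun ξ hξ => H.le_det i ξ (refCubeO_subset hξ))
  rw [setIntegral_const, smul_eq_mul, mul_comm]
  rfl

theorem size_pos (H : M.QU σ h) (i : Fin M.num) : 0 < M.size i := by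
  have h1 := H.le_size i
  exact pos_of_mul_pos_right
    ((mul_pos (pow_pos H.pos d) (refVol_pos d)).trans_le h1) (H.sigma_pos i).le

theorem size_le_volume (hΩ : volume Ω < ⊤) (i : Fin M.num) : M.size i ≤ volume.real Ω :=
  ENNReal.toReal_mono hΩ.ne (measure_mono (M.cell_subset i))

theorem surf_le (H : M.QU σ h) (i : Fin M.num) : (M.bd i).real univ
    ≤ (σ * h) ^ (d - 1) * (surf d (refCube d \ refCubeO d)).toReal := by
  have hσ : 0 ≤ σ * h := (mul_pos (H.sigma_pos i) H.pos).le
  have h1 := M.surf_frontier_le i (K := ⟨σ * h, hσ⟩) (H.norm_le i)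
  have h2 := ENNReal.toReal_mono (ENNReal.mul_lt_top (ENNReal.pow_lt_top ENNReal.coe_lt_top)
    (surf_refCube_diff_lt_top d)).ne h1
  rw [ENNReal.toReal_mul, ENNReal.toReal_pow] at h2
  rw [Measure.real, bd, Measure.restrict_apply_univ]
  exact h2

theorem dist_map_le (H : M.QU σ h) (i : Fin M.num) {ξ η : E d} (hξ : ξ ∈ refCube d) (hη : η ∈ refCube d) :
    dist (M.map i ξ) (M.map i η) ≤ σ * h * Metric.diam (refCube d) := by
  have hσ : 0 ≤ σ * h := (mul_pos (H.sigma_pos i) H.pos).le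
  have h1 := (M.lipschitzOnWith_map i (K := ⟨σ * h, hσ⟩) (H.norm_le i)).dist_le_mul ξ hξ η hη
  exact h1.trans (mul_le_mul_of_nonneg_left
    (Metric.dist_le_diam_of_mem isCompact_refCube.isBounded hξ hη) hσ)

/-- The number of elements touching a given one is bounded. -/
theorem card_neighbours_le (H : M.QU σ h) (i : Fin M.num) (s : Finset (Fin M.num))
    (hs : ∀ j ∈ s, (frontier (M.cell i) ∩ frontier (M.cell j)).Nonempty) :
    (s.card : ℝ) ≤ (2 * σ * Metric.diam (refCube d)) ^ d * volume.real (Metric.ball (0 : E d) 1) * σ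
      / refVol d := by
  have hσ := H.sigma_pos i
  have hh := H.pos
  obtain ⟨ξ, hξO⟩ := refCubeO_nonempty (d := d)
  have hξ := refCubeO_subset hξO
  -- Two element diameters: one from the fixed point of the given element to a common boundary
  -- point, one from there to any point of the neighbour.
  set r : ℝ := 2 * (σ * h * Metric.diam (refCube d)) with hr
  have hr0 : 0 ≤ r := by have := Metric.diam_nonneg (s := refCube d); positivity
  have hsub : (⋃ j ∈ s, M.cell j) ⊆ Metric.closedBall (M.map i ξ) r := by
    refine iUnion₂_subset fun j hj => ?_
    rintro _ ⟨η, hη, rfl⟩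
    obtain ⟨z, hz1, hz2⟩ := hs j hj
    have hz1 := frontier_subset_closure hz1
    have hz2 := frontier_subset_closure hz2
    have d1 := H.dist_map_le j (refCubeO_subset hη) (M.refPt_mem j hz2)
    have d2 := H.dist_map_le i (M.refPt_mem i hz1) hξ
    rw [M.map_refPt j hz2] at d1
    rw [M.map_refPt i hz1] at d2
    rw [Metric.mem_closedBall, hr]
    linarith [dist_triangle (M.map j η) z (M.map i ξ)]
  have hball : volume.real (Metric.closedBall (M.map i ξ) r)
      = r ^ d * volume.real (Metric.ball (0 : E d) 1) := by
    rw [Measure.real, Measure.addHaar_closedBall _ _ hr0, ENNReal.toReal_mul,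
      ENNReal.toReal_ofReal (pow_nonneg hr0 _)]
    simp [Measure.real]
  have hsum : ∑ j ∈ s, M.size j ≤ r ^ d * volume.real (Metric.ball (0 : E d) 1) := by
    rw [← hball]
    have h1 : ∑ j ∈ s, M.size j = volume.real (⋃ j ∈ s, M.cell j) :=
      (measureReal_biUnion_finset (fun a _ b _ hab => M.cells_disjoint hab)
        (fun j _ => (M.isOpen_cell j).measurableSet)
        fun j _ => ((measure_mono subset_closure).trans_lt
          (M.isCompact_closure_cell j).measure_lt_top).ne).symm
    rw [h1]
    exact measureReal_mono hsub Metric.isBounded_closedBall.measure_lt_top.ne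
  -- The neighbours are disjoint with volume at least a multiple of `h^d`, inside a ball of volume
  -- proportional to `h^d`; the powers of `h` cancel.
  have hlow : (s.card : ℝ) * (h ^ d * refVol d) ≤ σ * ∑ j ∈ s, M.size j := by
    rw [Finset.mul_sum, ← nsmul_eq_mul]
    exact Finset.card_nsmul_le_sum _ _ _ fun j _ => H.le_size j
  have hpow : r ^ d = (2 * σ * Metric.diam (refCube d)) ^ d * h ^ d := by
    rw [hr, ← mul_pow]
    congr 1
    ring
  rw [hpow] at hsum
  rw [le_div_iff₀ (refVol_pos d)]
  refine le_of_mul_le_mul_right ?_ (pow_pos hh d)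
  nlinarith [mul_le_mul_of_nonneg_left hsum hσ.le]

end QU

/-- Discrete trace inequality, scaled with the size of any other element. -/
theorem exists_trace_le (hΩ : volume Ω < ⊤) (σ : ℝ) (n : ℕ) : ∃ c : ℝ, 0 < c ∧
    ∀ M : Mesh d Ω, M.QuasiUniform σ → ∀ φ, M.IsRat n φ → ∀ i j, ∀ x ∈ closure (M.cell i),
      M.size j * (M.bd i).real univ * M.tr i φ x ^ 2 ≤ c * ∫ y in M.cell i, φ y ^ 2 := by
  obtain ⟨cn, hcn, hinv⟩ := exists_sq_le_integral d n
  -- For `σ ≤ 0` quasi-uniformity excludes any element, so the constant is irrelevant.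
  rcases le_or_gt σ 0 with hσ | hσ
  · refine ⟨1, one_pos, fun M hM φ hφ i => ?_⟩
    obtain ⟨h, H⟩ := hM.exists_qu
    exact absurd (H.sigma_pos i) hσ.not_gt
  set s₀ := (surf d (refCube d \ refCubeO d)).toReal with hs₀
  set v₀ := refVol d with hv₀def
  have hv₀ : 0 < v₀ := refVol_pos d
  set Vol := volume.real Ω with hVol
  have hVol0 : 0 ≤ Vol := measureReal_nonneg
  set f : ℝ := (d.factorial : ℝ) with hf
  have hf0 : 0 < f := by rw [hf]; exact_mod_cast d.factorial_pos
  have hs0 : 0 ≤ s₀ := ENNReal.toReal_nonneg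
  -- The factors come, in order, from the volume of the element `j`, the surface of the element `i`,
  -- the pointwise bound of the trace and the bound of the surplus power `h^(d-1)`.
  set c₁ : ℝ := f * σ ^ d * v₀ * (σ ^ (d - 1) * s₀) * (σ ^ 2 * cn * (f * σ ^ d)) *
    (1 + σ * Vol / v₀) with hc₁
  have hc₁0 : 0 ≤ c₁ := by positivity
  refine ⟨c₁ + 1, by linarith, fun M hM φ hφ i j x hx => ?_⟩
  obtain ⟨h, H⟩ := hM.exists_qu
  have hh := H.pos
  obtain ⟨g, hg, hq⟩ := hφ i
  have hgc := (contDiff_of_mem_polyFun hg).continuous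
  set I := ∫ y in M.cell i, φ y ^ 2 with hI
  have hI0 : 0 ≤ I := integral_nonneg fun _ => sq_nonneg _
  set D : E d → ℝ := fun ξ => (fderiv ℝ (M.map i) ξ).det with hD
  have hDc : Continuous D := continuous_det _
  have hD0 : ∀ ξ ∈ refCube d, D ξ ≠ 0 := fun ξ hξ => M.det_ne_zero i hξ
  set ξ := M.refPt i x with hξdef
  have hξ : ξ ∈ refCube d := M.refPt_mem i hx
  have htr : M.tr i φ x = g ξ / D ξ := by
    refine M.tr_eq i (g := fun η => g η / D η) (hgc.continuousOn.div hDc.continuousOn hD0)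
      (fun η hη => ?_) hx
    rw [← hq η hη, mul_div_cancel_right₀ _ (hD0 η (refCubeO_subset hη))]
  -- Here `g = φ det DF`, so `g²` carries two determinants. One is bounded by `d! (σh)^d`, the other
  -- is the Jacobian of the change of variables.
  have hint : ∫ η in refCubeO d, g η ^ 2 ≤ f * (σ * h) ^ d * I := by
    rw [hI, M.integral_cell i, ← integral_const_mul]
    refine setIntegral_mono_on (QU.integrableOn_refCubeO (hgc.pow 2).continuousOn) ?_
      isOpen_refCubeO.measurableSet fun η hη => ?_
    · have hc : ContinuousOn (fun η => f * (σ * h) ^ d * (|D η| * (g η / D η) ^ 2)) (refCube d) :=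
        continuousOn_const.mul (hDc.abs.continuousOn.mul
          ((hgc.continuousOn.div hDc.continuousOn hD0).pow 2))
      refine (QU.integrableOn_refCubeO hc).congr_fun (fun η hη => ?_) isOpen_refCubeO.measurableSet
      simp only
      rw [← hq η hη, mul_div_cancel_right₀ _ (hD0 η (refCubeO_subset hη))]
    · rw [← hq η hη, mul_pow]
      have h1 : |D η| ≤ f * (σ * h) ^ d := H.det_le i (refCubeO_subset hη)
      have h2 : (fderiv ℝ (M.map i) η).det ^ 2 = |D η| * |D η| := by
        rw [hD, abs_mul_abs_self, sq]
      rw [h2]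
      have h3 : 0 ≤ |D η| * φ (M.map i η) ^ 2 := by positivity
      calc φ (M.map i η) ^ 2 * (|D η| * |D η|) = |D η| * (|D η| * φ (M.map i η) ^ 2) := by ring
        _ ≤ f * (σ * h) ^ d * (|D η| * φ (M.map i η) ^ 2) := mul_le_mul_of_nonneg_right h1 h3
  have hpt : h ^ d * M.tr i φ x ^ 2 ≤ σ ^ 2 * cn * (f * σ ^ d) * I := by
    have h1 : h ^ d ≤ σ * |D ξ| := H.le_det i ξ hξ
    have h2 : g ξ ^ 2 ≤ cn * (f * (σ * h) ^ d * I) :=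
      (hinv g hg ξ hξ).trans (mul_le_mul_of_nonneg_left hint hcn.le)
    have h3 : (h ^ d) ^ 2 ≤ σ ^ 2 * D ξ ^ 2 := by
      rw [← sq_abs (D ξ), ← mul_pow]
      exact pow_le_pow_left₀ (pow_nonneg hh.le d) h1 2
    have h4 : M.tr i φ x ^ 2 * D ξ ^ 2 = g ξ ^ 2 := by
      rw [htr, div_pow, div_mul_cancel₀ _ (pow_ne_zero 2 (hD0 ξ hξ))]
    refine le_of_mul_le_mul_left ?_ (pow_pos hh d)
    calc h ^ d * (h ^ d * M.tr i φ x ^ 2) = (h ^ d) ^ 2 * M.tr i φ x ^ 2 := by ring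
      _ ≤ σ ^ 2 * D ξ ^ 2 * M.tr i φ x ^ 2 := mul_le_mul_of_nonneg_right h3 (sq_nonneg _)
      _ = σ ^ 2 * g ξ ^ 2 := by rw [← h4]; ring
      _ ≤ σ ^ 2 * (cn * (f * (σ * h) ^ d * I)) := mul_le_mul_of_nonneg_left h2 (sq_nonneg σ)
      _ = h ^ d * (σ ^ 2 * cn * (f * σ ^ d) * I) := by rw [mul_pow]; ring
  -- Volume times surface scales like `h^(2d-1)`, while the inverse estimate absorbs only `h^d`. The
  -- remaining power stays bounded because an element has at most the volume of `Ω`, which bounds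
  -- `h^d`.
  have hhd : h ^ (d - 1) ≤ 1 + σ * Vol / v₀ := by
    have h1 : h ^ d ≤ σ * Vol / v₀ := by
      rw [le_div_iff₀ hv₀]
      exact (H.le_size i).trans (mul_le_mul_of_nonneg_left (QU.size_le_volume hΩ i) hσ.le)
    rcases le_total h 1 with hle | hle
    · have := pow_le_one₀ hh.le hle (n := d - 1)
      have : 0 ≤ σ * Vol / v₀ := by positivity
      linarith
    · have := pow_le_pow_right₀ hle (Nat.sub_le d 1)
      linarith
  have hT : 0 ≤ M.tr i φ x ^ 2 := sq_nonneg _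
  have hsz := H.size_le j
  have hsf := H.surf_le i
  calc M.size j * (M.bd i).real univ * M.tr i φ x ^ 2
      ≤ (f * (σ * h) ^ d * v₀) * ((σ * h) ^ (d - 1) * s₀) * M.tr i φ x ^ 2 := by
        refine mul_le_mul_of_nonneg_right ?_ hT
        exact mul_le_mul hsz hsf measureReal_nonneg (by positivity)
    _ = f * σ ^ d * v₀ * (σ ^ (d - 1) * s₀) * h ^ (d - 1) * (h ^ d * M.tr i φ x ^ 2) := by
        rw [mul_pow, mul_pow]; ring
    _ ≤ f * σ ^ d * v₀ * (σ ^ (d - 1) * s₀) * (1 + σ * Vol / v₀) *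
          (σ ^ 2 * cn * (f * σ ^ d) * I) := by
        refine mul_le_mul (mul_le_mul_of_nonneg_left hhd (by positivity)) hpt (by positivity)
          (by positivity)
    _ = c₁ * I := by rw [hc₁]; ring
    _ ≤ (c₁ + 1) * I := by nlinarith

end Mesh

end Biot

end

noncomputable section

namespace Biot

variable {d : ℕ}

/-! ### The finite element spaces as vector spaces -/

theorem MemH1.add {Ω : Set (E d)} {w w' : E d → ℝ} (h : MemH1 Ω w) (h' : MemH1 Ω w') :
    MemH1 Ω fun x => w x + w' x := by
  refine ⟨h.1.add h'.1, fun j => ?_⟩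
  obtain ⟨g, hg, hw⟩ := h.2 j
  obtain ⟨g', hg', hw'⟩ := h'.2 j
  refine ⟨_, hg.add hg', fun φ h1 h2 h3 => ?_⟩
  have hφ : MemLp φ 2 (volume.restrict Ω) := (h1.continuous.memLp_of_hasCompactSupport h2).restrict Ω
  have hdφ : MemLp (fun x => fderiv ℝ φ x (basisVec d j)) 2 (volume.restrict Ω) :=
    (((h1.continuous_fderiv (by simp)).clm_apply continuous_const).memLp_of_hasCompactSupport
      (h2.fderiv_apply (𝕜 := ℝ) _)).restrict Ω
  simp only [add_mul, Pi.add_apply]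
  have i1 : ∀ {f : E d → ℝ}, MemLp f 2 (volume.restrict Ω) →
      IntegrableOn (fun x => f x * fderiv ℝ φ x (basisVec d j)) Ω := fun hf => hf.integrable_mul hdφ
  have i2 : ∀ {f : E d → ℝ}, MemLp f 2 (volume.restrict Ω) →
      IntegrableOn (fun x => f x * φ x) Ω := fun hf => hf.integrable_mul hφ
  rw [integral_add (i1 h.1) (i1 h'.1), integral_add (i2 hg) (i2 hg'), hw φ h1 h2 h3,
    hw' φ h1 h2 h3]
  ring

theorem MemH1.const_mul {Ω : Set (E d)} {w : E d → ℝ} (c : ℝ) (h : MemH1 Ω w) :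
    MemH1 Ω fun x => c * w x := by
  refine ⟨h.1.const_mul c, fun j => ?_⟩
  obtain ⟨g, hg, hw⟩ := h.2 j
  refine ⟨_, hg.const_mul c, fun φ h1 h2 h3 => ?_⟩
  simp only [mul_assoc]
  rw [integral_const_mul, integral_const_mul, hw φ h1 h2 h3]
  ring

theorem memH1_zero {Ω : Set (E d)} : MemH1 Ω fun _ => (0 : ℝ) := by
  refine ⟨MemLp.zero', fun j => ⟨fun _ => 0, MemLp.zero', fun φ _ _ _ => by simp⟩⟩

section Spaces

variable {Ω : Set (E d)} (M : Mesh d Ω) (r : ℕ)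

/-- `V_h` as a vector space. -/
def VhS : Submodule ℝ (E d → E d) where
  carrier := Vh M r
  zero_mem' := ⟨fun _ _ => rfl, continuousOn_const, fun _ => memH1_zero, fun _ _ =>
    ⟨0, Submodule.zero_mem _, fun _ _ => by simp⟩⟩
  add_mem' := by
    rintro v w ⟨h1, h2, h3, h4⟩ ⟨k1, k2, k3, k4⟩
    refine ⟨fun x hx => by simp [h1 x hx, k1 x hx], h2.add k2, fun j => (h3 j).add (k3 j),
      fun i j => ?_⟩
    obtain ⟨P, hP, hv⟩ := h4 i j
    obtain ⟨P', hP', hw⟩ := k4 i j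
    exact ⟨P + P', Submodule.add_mem _ hP hP', fun ξ hξ => by simp [hv ξ hξ, hw ξ hξ]⟩
  smul_mem' := by
    rintro c v ⟨h1, h2, h3, h4⟩
    refine ⟨fun x hx => by simp [h1 x hx], h2.const_smul c, fun j => (h3 j).const_mul c,
      fun i j => ?_⟩
    obtain ⟨P, hP, hv⟩ := h4 i j
    exact ⟨c • P, Submodule.smul_mem _ _ hP, fun ξ hξ => by simp [hv ξ hξ, MvPolynomial.smul_eval]⟩

/-- `Q_h` as a vector space. -/
def QhS (kind : PressureKind) : Submodule ℝ (E d → ℝ) where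
  carrier := Qh M r kind
  zero_mem' := by
    cases kind
    · exact ⟨fun _ _ => rfl, MemLp.zero', continuousOn_const, fun _ =>
        ⟨0, Submodule.zero_mem _, fun _ _ => by simp⟩⟩
    · exact ⟨fun _ _ => rfl, MemLp.zero', fun _ => ⟨0, Submodule.zero_mem _, fun _ _ => by simp⟩⟩
  add_mem' := by
    intro v w hv hw
    cases kind
    · obtain ⟨h1, h2, h3, h4⟩ := hv
      obtain ⟨k1, k2, k3, k4⟩ := hw
      refine ⟨fun x hx => by simp [h1 x hx, k1 x hx], h2.add k2, h3.add k3, fun i => ?_⟩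
      obtain ⟨P, hP, hv⟩ := h4 i
      obtain ⟨P', hP', hw⟩ := k4 i
      exact ⟨P + P', Submodule.add_mem _ hP hP', fun ξ hξ => by simp [hv ξ hξ, hw ξ hξ]⟩
    · obtain ⟨h1, h2, h4⟩ := hv
      obtain ⟨k1, k2, k4⟩ := hw
      refine ⟨fun x hx => by simp [h1 x hx, k1 x hx], h2.add k2, fun i => ?_⟩
      obtain ⟨P, hP, hv⟩ := h4 i
      obtain ⟨P', hP', hw⟩ := k4 i
      exact ⟨P + P', Submodule.add_mem _ hP hP', fun ξ hξ => by simp [hv ξ hξ, hw ξ hξ]⟩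
  smul_mem' := by
    intro c v hv
    cases kind
    · obtain ⟨h1, h2, h3, h4⟩ := hv
      refine ⟨fun x hx => by simp [h1 x hx], h2.const_smul c, h3.const_smul c, fun i => ?_⟩
      obtain ⟨P, hP, hv⟩ := h4 i
      exact ⟨c • P, Submodule.smul_mem _ _ hP,
        fun ξ hξ => by simp [hv ξ hξ, MvPolynomial.smul_eval]⟩
    · obtain ⟨h1, h2, h4⟩ := hv
      refine ⟨fun x hx => by simp [h1 x hx], h2.const_smul c, fun i => ?_⟩
      obtain ⟨P, hP, hv⟩ := h4 i
      exact ⟨c • P, Submodule.smul_mem _ _ hP,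
        fun ξ hξ => by simp [hv ξ hξ, MvPolynomial.smul_eval]⟩

/-- A common bound for the degree of all the mapped polynomials. -/
def deg (d r : ℕ) : ℕ := d * r + r

variable {M r}

theorem isPWV_of_mem {v : E d → E d} (hv : v ∈ Vh M r) : M.IsPWV (deg d r) v := fun j i => by
  obtain ⟨P, hP, h⟩ := hv.2.2.2 i j
  exact ⟨_, polyFun_mono (Nat.le_add_right _ _) (restrictDegree_mem_polyFun hP), h⟩

theorem isPW_of_mem {kind : PressureKind} {q : E d → ℝ} (hq : q ∈ Qh M r kind) :
    M.IsPW (deg d r) q := fun i => by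
  cases kind
  · obtain ⟨P, hP, h⟩ := hq.2.2.2 i
    refine ⟨_, polyFun_mono ?_ (restrictDegree_mem_polyFun hP), h⟩
    exact (Nat.mul_le_mul_left d (Nat.sub_le r 1)).trans (Nat.le_add_right _ _)
  · obtain ⟨P, hP, h⟩ := hq.2.2 i
    refine ⟨_, polyFun_mono ?_ (restrictTotalDegree_mem_polyFun hP), h⟩
    exact (Nat.sub_le r 1).trans (Nat.le_add_left _ _)

theorem eqOn_zero_of_cells {F : Type*} [NormedAddCommGroup F] {v : E d → F}
    (hc : ContinuousOn v (closure Ω)) (h : ∀ x ∈ M.cells, v x = 0) : ∀ x ∈ closure Ω, v x = 0 := by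
  have hd : closure Ω ⊆ closure M.cells := by
    rw [M.cover]
    exact iUnion_subset fun i => closure_mono (subset_iUnion M.cell i)
  exact EqOn.of_subset_closure (f := v) (g := fun _ => 0) h hc continuousOn_const
    (M.cells_subset.trans subset_closure) hd

/-- The cells are dense in the closed domain and the values outside it are fixed by convention.
Vanishing on the cells therefore means equality as functions, which makes the `L²` product definite
on the space itself. -/
theorem Vh_eq_zero {v : E d → E d} (hv : v ∈ Vh M r) (h : ∀ x ∈ M.cells, v x = 0) : v = 0 := by
  ext1 x
  by_cases hx : x ∈ closure Ω
  · exact eqOn_zero_of_cells hv.2.1 h x hx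
  · exact hv.1 x hx

theorem Qh_eq_zero {kind : PressureKind} {q : E d → ℝ} (hq : q ∈ Qh M r kind)
    (h : ∀ x ∈ M.cells, q x = 0) : q = 0 := by
  ext1 x
  cases kind
  · by_cases hx : x ∈ closure Ω
    · exact eqOn_zero_of_cells hq.2.2.1 h x hx
    · exact hq.1 x hx
  · by_cases hx : x ∈ M.cells
    · exact h x hx
    · exact hq.1 x hx

/-- Pullback of a function to the reference element. -/
def pullback (M : Mesh d Ω) (i : Fin M.num) : (E d → ℝ) →ₗ[ℝ] (refCubeO d → ℝ) :=
  LinearMap.funLeft ℝ ℝ fun ξ => M.map i ξ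

/-- Restrictions of polynomials to the reference element. -/
def refPoly (d n : ℕ) : Submodule ℝ (refCubeO d → ℝ) :=
  (polyFun d n).map (LinearMap.funLeft ℝ ℝ Subtype.val)

instance (n : ℕ) : FiniteDimensional ℝ (refPoly d n) := by
  have := finiteDimensional_polyFun (d := d) n
  unfold refPoly
  infer_instance

theorem pullback_mem {n : ℕ} {q : E d → ℝ} (hq : M.IsPW n q) (i : Fin M.num) :
    pullback M i q ∈ refPoly d n := by
  obtain ⟨g, hg, h⟩ := hq i
  exact ⟨g, hg, funext fun ξ => (h ξ ξ.2).symm⟩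

theorem eq_zero_of_pullback {q : E d → ℝ} (h : ∀ i, pullback M i q = 0) : ∀ x ∈ M.cells, q x = 0 := by
  intro x hx
  obtain ⟨i, ξ, hξ, rfl⟩ := mem_iUnion.1 hx
  exact congrFun (h i) ⟨ξ, hξ⟩

/-- The pullbacks to the reference element, one for each cell and component, lie in a
finite-dimensional polynomial space and determine the function. -/
instance : FiniteDimensional ℝ (VhS M r) := by
  let f : VhS M r →ₗ[ℝ] (Fin M.num × Fin d → refPoly d (deg d r)) :=
    LinearMap.pi fun ij => LinearMap.codRestrict _
      (pullback M ij.1 ∘ₗ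
        { toFun := fun v : VhS M r => fun x => v.1 x ij.2
          map_add' := fun _ _ => rfl
          map_smul' := fun _ _ => rfl }) fun v => pullback_mem (isPWV_of_mem v.2 ij.2) ij.1
  refine Module.Finite.of_injective f ((injective_iff_map_eq_zero f).2 fun v hv => ?_)
  refine Subtype.ext (Vh_eq_zero v.2 fun x hx => ?_)
  ext j
  exact eq_zero_of_pullback (q := fun x => v.1 x j)
    (fun i => congrArg Subtype.val (congrFun hv (i, j))) x hx

instance (kind : PressureKind) : FiniteDimensional ℝ (QhS M r kind) := by
  let f : QhS M r kind →ₗ[ℝ] (Fin M.num → refPoly d (deg d r)) :=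
    LinearMap.pi fun i => LinearMap.codRestrict _
      (pullback M i ∘ₗ (QhS M r kind).subtype) fun q => pullback_mem (isPW_of_mem q.2) i
  refine Module.Finite.of_injective f ((injective_iff_map_eq_zero f).2 fun q hq => ?_)
  refine Subtype.ext (Qh_eq_zero q.2 fun x hx => ?_)
  exact eq_zero_of_pullback (fun i => congrArg Subtype.val (congrFun hq i)) x hx

end Spaces

/-! ### Interior integrals -/

section Interior

variable {Ω : Set (E d)} {M : Mesh d Ω}

theorem Mesh.IsReg.integrable (hΩ : volume Ω < ⊤) {f : E d → ℝ} (hf : M.IsReg f) :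
    Integrable f (volume.restrict Ω) := by
  have : IsFiniteMeasure (volume.restrict Ω) := ⟨by rwa [Measure.restrict_apply_univ]⟩
  exact hf.memLp_top.integrable le_top

theorem Mesh.IsReg.integrable_cell (hΩ : volume Ω < ⊤) {f : E d → ℝ} (hf : M.IsReg f)
    (i : Fin M.num) : Integrable f (volume.restrict (M.cell i)) :=
  (hf.integrable hΩ).mono_measure (Measure.restrict_mono (M.cell_subset i) le_rfl)

theorem Mesh.IsReg.integral_eq_sum (hΩ : volume Ω < ⊤) {f : E d → ℝ} (hf : M.IsReg f) :
    ∫ x in Ω, f x = ∑ i, ∫ x in M.cell i, f x := by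
  rw [M.restrict_eq]
  exact integral_iUnion_fintype (fun i => (M.isOpen_cell i).measurableSet)
    M.cells_disjoint fun i => hf.integrable_cell hΩ i

/-- The integrand vanishes almost everywhere and is continuous on the open cells, so it vanishes at
every point of them. -/
theorem Mesh.IsReg.eq_zero_of_integral (hΩ : volume Ω < ⊤) {f : E d → ℝ} (hf : M.IsReg f)
    (h0 : ∀ x, 0 ≤ f x) (h : ∫ x in Ω, f x = 0) : ∀ x ∈ M.cells, f x = 0 := by
  have h1 := (integral_eq_zero_iff_of_nonneg h0 (hf.integrable hΩ)).1 h
  rw [M.restrict_eq] at h1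
  exact Measure.eqOn_open_of_ae_eq h1 M.isOpen_cells hf.continuousOn_cells continuousOn_const

variable {n : ℕ}

theorem Mesh.IsPWV.isReg_dotE {v w : E d → E d} (hv : M.IsPWV n v) (hw : M.IsPWV n w) :
    M.IsReg fun x => dotE (v x) (w x) :=
  Mesh.isReg_sum _ fun j _ => (hv j).isReg.mul (hw j).isReg

theorem ipV_comm (u v : E d → E d) : ipV Ω u v = ipV Ω v u := by
  simp only [ipV, dotE, mul_comm]

theorem ipQ_comm (p q : E d → ℝ) : ipQ Ω p q = ipQ Ω q p := by
  simp only [ipQ, mul_comm]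

theorem ipV_add_left (hΩ : volume Ω < ⊤) {u u' v : E d → E d} (hu : M.IsPWV n u)
    (hu' : M.IsPWV n u') (hv : M.IsPWV n v) :
    ipV Ω (fun x => u x + u' x) v = ipV Ω u v + ipV Ω u' v := by
  rw [ipV, ipV, ipV, ← integral_add ((hu.isReg_dotE hv).integrable hΩ)
    ((hu'.isReg_dotE hv).integrable hΩ)]
  simp [dotE, add_mul, Finset.sum_add_distrib]

theorem ipV_smul_left (c : ℝ) (u v : E d → E d) :
    ipV Ω (fun x => c • u x) v = c * ipV Ω u v := by
  rw [ipV, ipV, ← integral_const_mul]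
  simp [dotE, Finset.mul_sum, mul_assoc]

theorem ipQ_add_left (hΩ : volume Ω < ⊤) {u u' v : E d → ℝ} (hu : M.IsReg u)
    (hu' : M.IsReg u') (hv : M.IsReg v) :
    ipQ Ω (fun x => u x + u' x) v = ipQ Ω u v + ipQ Ω u' v := by
  rw [ipQ, ipQ, ipQ, ← integral_add ((hu.mul hv).integrable hΩ) ((hu'.mul hv).integrable hΩ)]
  simp [add_mul]

theorem ipQ_smul_left (c : ℝ) (u v : E d → ℝ) : ipQ Ω (fun x => c * u x) v = c * ipQ Ω u v := by
  rw [ipQ, ipQ, ← integral_const_mul]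
  simp [mul_assoc]

theorem grad_add {p q : E d → ℝ} (hp : M.IsPW n p) (hq : M.IsPW n q) {x : E d} (hx : x ∈ M.cells)
    (j : Fin d) : grad (fun y => p y + q y) x j = grad p x j + grad q x j := by
  simp only [grad]
  rw [fderiv_fun_add (hp.differentiableAt hx) (hq.differentiableAt hx)]
  rfl

theorem grad_smul {p : E d → ℝ} (c : ℝ) (hp : M.IsPW n p) {x : E d} (hx : x ∈ M.cells)
    (j : Fin d) : grad (fun y => c * p y) x j = c * grad p x j := by
  simp only [grad]
  rw [fderiv_const_mul (hp.differentiableAt hx)]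
  rfl

theorem Mesh.IsPW.add {p q : E d → ℝ} (hp : M.IsPW n p) (hq : M.IsPW n q) :
    M.IsPW n fun x => p x + q x := fun i => by
  obtain ⟨g, hg, h⟩ := hp i
  obtain ⟨g', hg', h'⟩ := hq i
  exact ⟨_, Submodule.add_mem _ hg hg', fun ξ hξ => congrArg₂ (· + ·) (h ξ hξ) (h' ξ hξ)⟩

theorem Mesh.IsPW.const_mul {p : E d → ℝ} (c : ℝ) (hp : M.IsPW n p) :
    M.IsPW n fun x => c * p x := fun i => by
  obtain ⟨g, hg, h⟩ := hp i
  exact ⟨_, const_mul_mem_polyFun c hg, fun ξ hξ => congrArg (c * ·) (h ξ hξ)⟩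

theorem Mesh.IsPWV.add {u v : E d → E d} (hu : M.IsPWV n u) (hv : M.IsPWV n v) :
    M.IsPWV n fun x => u x + v x := fun j => (hu j).add (hv j)

theorem Mesh.IsPWV.const_smul {u : E d → E d} (c : ℝ) (hu : M.IsPWV n u) :
    M.IsPWV n fun x => c • u x := fun j => (hu j).const_mul c

theorem jac_add {u v : E d → E d} (hu : M.IsPWV n u) (hv : M.IsPWV n v) {x : E d}
    (hx : x ∈ M.cells) (a b : Fin d) :
    jac (fun y => u y + v y) x a b = jac u x a b + jac v x a b := by
  rw [(hu.add hv).jac_eq hx, hu.jac_eq hx, hv.jac_eq hx]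
  exact grad_add (hu a) (hv a) hx b

theorem jac_smul {u : E d → E d} (c : ℝ) (hu : M.IsPWV n u) {x : E d}
    (hx : x ∈ M.cells) (a b : Fin d) : jac (fun y => c • u y) x a b = c * jac u x a b := by
  rw [(hu.const_smul c).jac_eq hx, hu.jac_eq hx]
  exact grad_smul c (hu a) hx b

theorem strain_add {u v : E d → E d} (hu : M.IsPWV n u) (hv : M.IsPWV n v) {x : E d}
    (hx : x ∈ M.cells) (a b : Fin d) :
    strain (fun y => u y + v y) x a b = strain u x a b + strain v x a b := by
  simp only [Mesh.strain_apply, jac_add hu hv hx]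
  ring

theorem strain_smul {u : E d → E d} (c : ℝ) (hu : M.IsPWV n u) {x : E d}
    (hx : x ∈ M.cells) (a b : Fin d) : strain (fun y => c • u y) x a b = c * strain u x a b := by
  simp only [Mesh.strain_apply, jac_smul c hu hx]
  ring

theorem dvg_add {u v : E d → E d} (hu : M.IsPWV n u) (hv : M.IsPWV n v) {x : E d}
    (hx : x ∈ M.cells) : dvg (fun y => u y + v y) x = dvg u x + dvg v x := by
  simp only [dvg, Matrix.trace, Matrix.diag, jac_add hu hv hx, Finset.sum_add_distrib]

theorem dvg_smul {u : E d → E d} (c : ℝ) (hu : M.IsPWV n u) {x : E d}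
    (hx : x ∈ M.cells) : dvg (fun y => c • u y) x = c * dvg u x := by
  simp only [dvg, Matrix.trace, Matrix.diag, jac_smul c hu hx, Finset.mul_sum]

/-- The derivative rules are available only on the open cells, where the piecewise functions are
differentiable. Default derivative values on the null skeleton do not affect integrals. -/
theorem setIntegral_congr_cells {f g : E d → ℝ} (h : ∀ x ∈ M.cells, f x = g x) :
    ∫ x in Ω, f x = ∫ x in Ω, g x := by
  rw [M.restrict_eq]
  exact setIntegral_congr_fun M.isOpen_cells.measurableSet h

/-! ### Traces of strains and gradients -/

variable {i : Fin M.num} {x : E d}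

theorem tr_strain_add {u v : E d → E d} (hu : M.IsPWV n u) (hv : M.IsPWV n v)
    (hx : x ∈ closure (M.cell i)) (a b : Fin d) :
    M.tr i (strain fun y => u y + v y) x a b
      = M.tr i (strain u) x a b + M.tr i (strain v) x a b := by
  rw [(hu.add hv).tr_strain hx, hu.tr_strain hx, hv.tr_strain hx,
    ← (hu.isReg_strain a b).tr_add (hv.isReg_strain a b) hx]
  exact ((hu.isReg_strain a b).add (hv.isReg_strain a b)).tr_congr
    (fun y hy => strain_add hu hv hy a b) hx

theorem tr_strain_smul {u : E d → E d} (c : ℝ) (hu : M.IsPWV n u)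
    (hx : x ∈ closure (M.cell i)) (a b : Fin d) :
    M.tr i (strain fun y => c • u y) x a b = c * M.tr i (strain u) x a b := by
  rw [(hu.const_smul c).tr_strain hx, hu.tr_strain hx, ← (hu.isReg_strain a b).tr_const_mul c hx]
  exact ((hu.isReg_strain a b).const_mul c).tr_congr (fun y hy => strain_smul c hu hy a b) hx

theorem tr_grad_add {p q : E d → ℝ} (hp : M.IsPW n p) (hq : M.IsPW n q)
    (hx : x ∈ closure (M.cell i)) (a : Fin d) :
    M.tr i (grad fun y => p y + q y) x a = M.tr i (grad p) x a + M.tr i (grad q) x a := by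
  rw [(hp.add hq).tr_grad hx, hp.tr_grad hx, hq.tr_grad hx,
    ← (hp.isReg_grad a).tr_add (hq.isReg_grad a) hx]
  exact ((hp.isReg_grad a).add (hq.isReg_grad a)).tr_congr
    (fun y hy => grad_add hp hq hy a) hx

theorem tr_grad_smul {p : E d → ℝ} (c : ℝ) (hp : M.IsPW n p)
    (hx : x ∈ closure (M.cell i)) (a : Fin d) :
    M.tr i (grad fun y => c * p y) x a = c * M.tr i (grad p) x a := by
  rw [(hp.const_mul c).tr_grad hx, hp.tr_grad hx, ← (hp.isReg_grad a).tr_const_mul c hx]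
  exact ((hp.isReg_grad a).const_mul c).tr_congr (fun y hy => grad_smul c hp hy a) hx

theorem memLp_tr_strain {u : E d → E d} (hu : M.IsPWV n u) (i : Fin M.num) (a b : Fin d) :
    MemLp (fun x => M.tr i (strain u) x a b) ⊤ (M.bd i) :=
  Mesh.memLp_top_of_continuousOn (((hu.isReg_strain a b).continuousOn_tr i).congr
    fun _ hx => hu.tr_strain hx a b)

theorem memLp_tr_grad {p : E d → ℝ} (hp : M.IsPW n p) (i : Fin M.num) (a : Fin d) :
    MemLp (fun x => M.tr i (grad p) x a) ⊤ (M.bd i) :=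
  Mesh.memLp_top_of_continuousOn (((hp.isReg_grad a).continuousOn_tr i).congr
    fun _ hx => hp.tr_grad hx a)

end Interior

end Biot

end

noncomputable section

namespace Biot

variable {d : ℕ}

/-! ### Boundary integrals -/

namespace Mesh

variable {Ω : Set (E d)} (M : Mesh d Ω)

/-- The surface measure on the part of `Γ` in the boundary of the `i`-th element. -/
def bdOn (i : Fin M.num) (Γ : Set (E d)) : Measure (E d) :=
  (surf d).restrict (frontier (M.cell i) ∩ Γ)

theorem bdOn_le (i : Fin M.num) (Γ : Set (E d)) : M.bdOn i Γ ≤ M.bd i :=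
  Measure.restrict_mono inter_subset_left le_rfl

theorem bdOn_frontier_le (i j : Fin M.num) : M.bdOn i (frontier (M.cell j)) ≤ M.bd j :=
  Measure.restrict_mono inter_subset_right le_rfl

instance (i : Fin M.num) (Γ : Set (E d)) : IsFiniteMeasure (M.bdOn i Γ) :=
  isFiniteMeasure_of_le _ (M.bdOn_le i Γ)

theorem ae_bd {i : Fin M.num} {p : E d → Prop} (h : ∀ x ∈ closure (M.cell i), p x) :
    ∀ᵐ x ∂M.bd i, p x :=
  ae_restrict_of_forall_mem isClosed_frontier.measurableSet
    fun x hx => h x (frontier_subset_closure hx)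

theorem ae_bdOn {i : Fin M.num} (Γ : Set (E d)) {p : E d → Prop}
    (h : ∀ x ∈ closure (M.cell i), p x) : ∀ᵐ x ∂M.bdOn i Γ, p x :=
  (M.bdOn_le i Γ).absolutelyContinuous (M.ae_bd h)

theorem bInt_eq (Γ : Set (E d)) (w : Fin M.num → E d → ℝ) :
    M.bInt Γ w = ∑ i, ∫ x, w i x ∂M.bdOn i Γ := rfl

variable {M}

theorem bInt_congr {Γ : Set (E d)} {w w' : Fin M.num → E d → ℝ}
    (h : ∀ i, ∀ x ∈ closure (M.cell i), w i x = w' i x) : M.bInt Γ w = M.bInt Γ w' :=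
  Finset.sum_congr rfl fun i _ => integral_congr_ae (M.ae_bdOn Γ (h i))

theorem bInt_add {Γ : Set (E d)} {w w' : Fin M.num → E d → ℝ}
    (h : ∀ i, Integrable (w i) (M.bdOn i Γ)) (h' : ∀ i, Integrable (w' i) (M.bdOn i Γ)) :
    M.bInt Γ (fun i x => w i x + w' i x) = M.bInt Γ w + M.bInt Γ w' := by
  simp only [bInt_eq]
  rw [← Finset.sum_add_distrib]
  exact Finset.sum_congr rfl fun i _ => integral_add (h i) (h' i)

theorem bInt_const_mul (Γ : Set (E d)) (c : ℝ) (w : Fin M.num → E d → ℝ) :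
    M.bInt Γ (fun i x => c * w i x) = c * M.bInt Γ w := by
  simp only [bInt_eq, Finset.mul_sum, integral_const_mul]

end Mesh

theorem memLp_top_mul {p : ENNReal} {μ : Measure (E d)} {f g : E d → ℝ} (hf : MemLp f ⊤ μ)
    (hg : MemLp g p μ) : MemLp (fun x => f x * g x) p μ := hg.mul hf

section Boundary

variable {S : Setting d} {M : Mesh d S.Ω} {n : ℕ} {Γ : Set (E d)}

theorem memLp_applyC_tr {χ : E d → E d} (hχ : M.IsPWV n χ) (i : Fin M.num) (a b : Fin d) :
    MemLp (fun x => applyC S.C (M.tr i (strain χ) x) a b) ⊤ (M.bd i) :=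
  memLp_finsetSum _ fun k _ => memLp_finsetSum _ fun l _ => (memLp_tr_strain hχ i k l).const_mul _

theorem memLp_flux {g : E d → Fin d → ℝ} {i : Fin M.num} {μ : Measure (E d)} (hμ : μ ≤ M.bd i)
    (hg : ∀ a, MemLp (fun x => g x a) ⊤ μ) :
    MemLp (fun x => flux S.Kp (g x) (M.normal i x)) ⊤ μ :=
  memLp_finsetSum _ fun a _ => memLp_finsetSum _ fun b _ =>
    memLp_top_mul ((hg b).const_mul _) ((M.memLp_normal i a).mono_measure hμ)

/-- Square integrable vector fields on `Γ`. -/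
def L2V (M : Mesh d S.Ω) (Γ : Set (E d)) (w : E d → E d) : Prop :=
  ∀ i j, MemLp (fun x => w x j) 2 (M.bdOn i Γ)

/-- Square integrable families of functions on `Γ`. -/
def L2Q (M : Mesh d S.Ω) (Γ : Set (E d)) (q : Fin M.num → E d → ℝ) : Prop :=
  ∀ i, MemLp (q i) 2 (M.bdOn i Γ)

theorem memLp_two_of_bd {i : Fin M.num} {f : E d → ℝ} (h : MemLp f ⊤ (M.bd i)) :
    MemLp f 2 (M.bdOn i Γ) := (h.mono_measure (M.bdOn_le i Γ)).mono_exponent le_top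

theorem L2V_of_continuousOn {w : E d → E d} (hw : ContinuousOn w (closure S.Ω)) : L2V M Γ w :=
  fun i j => memLp_two_of_bd (Mesh.memLp_top_of_continuousOn
    ((EuclideanSpace.proj (𝕜 := ℝ) j).continuous.comp_continuousOn
      (hw.mono (M.closure_cell_subset i))))

theorem L2Q_of_continuousOn {q : E d → ℝ} (hq : ContinuousOn q (closure S.Ω)) :
    L2Q M Γ fun _ => q :=
  fun i => memLp_two_of_bd (Mesh.memLp_top_of_continuousOn (hq.mono (M.closure_cell_subset i)))

theorem L2Q_tr {q : E d → ℝ} (hq : M.IsReg q) : L2Q M Γ fun i => M.tr i q :=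
  fun i => memLp_two_of_bd (hq.memLp_tr i)

theorem L2V_Lp (w : Lp (E d) 2 ((surf d).restrict Γ)) : L2V M Γ w := fun i j => by
  have h : MemLp (fun x => (EuclideanSpace.proj (𝕜 := ℝ) j) (w x)) 2 ((surf d).restrict Γ) :=
    (EuclideanSpace.proj (𝕜 := ℝ) j).comp_memLp' (Lp.memLp w)
  exact h.mono_measure (Measure.restrict_mono inter_subset_right le_rfl)

theorem L2Q_Lp (w : Lp ℝ 2 ((surf d).restrict Γ)) : L2Q M Γ fun _ => w := fun _ =>
  (Lp.memLp w).mono_measure (Measure.restrict_mono inter_subset_right le_rfl)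

/-- `⟨w, C ε(χ) n⟩` on `Γ`. -/
def stressB (S : Setting d) (M : Mesh d S.Ω) (Γ : Set (E d)) (χ w : E d → E d) : ℝ :=
  M.bInt Γ fun i x => matDot (applyC S.C (M.tr i (strain χ) x)) (M.normal i x) (w x)

/-- `γ / h_F ⟨w, χ⟩` on `Γ`. -/
def penV (M : Mesh d S.Ω) (g : ℝ) (Γ : Set (E d)) (w χ : E d → E d) : ℝ :=
  M.bInt Γ fun i x => g / M.size i * dotE (w x) (χ x)

/-- `⟨q, K ∇ψ · n⟩` on `Γ`. -/
def fluxB (S : Setting d) (M : Mesh d S.Ω) (Γ : Set (E d)) (ψ : E d → ℝ)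
    (q : Fin M.num → E d → ℝ) : ℝ :=
  M.bInt Γ fun i x => q i x * flux S.Kp (M.tr i (grad ψ) x) (M.normal i x)

/-- `γ / h_F ⟨q, ψ⟩` on `Γ`. -/
def penQ (M : Mesh d S.Ω) (g : ℝ) (Γ : Set (E d)) (q ψ : Fin M.num → E d → ℝ) : ℝ :=
  M.bInt Γ fun i x => g / M.size i * (q i x * ψ i x)

/-- Stress traces and normals are bounded while `w` is only square integrable. This generality
admits the Dirichlet data as `w`. -/
theorem integrable_stress {χ w : E d → E d} (hχ : M.IsPWV n χ) (hw : L2V M Γ w) (i : Fin M.num) :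
    Integrable (fun x => matDot (applyC S.C (M.tr i (strain χ) x)) (M.normal i x) (w x))
      (M.bdOn i Γ) := by
  refine integrable_finsetSum _ fun a _ => integrable_finsetSum _ fun b _ => ?_
  exact (memLp_top_mul (memLp_top_mul ((memLp_applyC_tr hχ i a b).mono_measure (M.bdOn_le i Γ))
    ((M.memLp_normal i b).mono_measure (M.bdOn_le i Γ))) (hw i a)).integrable (by norm_num)

theorem integrable_dotE {w χ : E d → E d} (hw : L2V M Γ w) (hχ : L2V M Γ χ) (i : Fin M.num) :
    Integrable (fun x => dotE (w x) (χ x)) (M.bdOn i Γ) :=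
  integrable_finsetSum _ fun a _ => (hw i a).integrable_mul (hχ i a)

theorem integrable_fluxB {ψ : E d → ℝ} {q : Fin M.num → E d → ℝ} (hψ : M.IsPW n ψ)
    (hq : L2Q M Γ q) (i : Fin M.num) :
    Integrable (fun x => q i x * flux S.Kp (M.tr i (grad ψ) x) (M.normal i x)) (M.bdOn i Γ) := by
  have h := memLp_top_mul (memLp_flux (S := S) (M.bdOn_le i Γ)
    fun a => (memLp_tr_grad hψ i a).mono_measure (M.bdOn_le i Γ)) (hq i)
  simpa only [mul_comm] using h.integrable (by norm_num)

theorem integrable_penQ {q ψ : Fin M.num → E d → ℝ} (hq : L2Q M Γ q) (hψ : L2Q M Γ ψ)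
    (i : Fin M.num) : Integrable (fun x => q i x * ψ i x) (M.bdOn i Γ) :=
  (hq i).integrable_mul (hψ i)

theorem matDot_add_left (A B : Matrix (Fin d) (Fin d) ℝ) (n w : E d) :
    matDot (A + B) n w = matDot A n w + matDot B n w := by
  simp only [matDot, Matrix.add_apply, add_mul, Finset.sum_add_distrib]

theorem matDot_smul_left (c : ℝ) (A : Matrix (Fin d) (Fin d) ℝ) (n w : E d) :
    matDot (c • A) n w = c * matDot A n w := by
  simp only [matDot, Matrix.smul_apply, smul_eq_mul, Finset.mul_sum, mul_assoc]

theorem matDot_add_right (A : Matrix (Fin d) (Fin d) ℝ) (n w w' : E d) :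
    matDot A n (w + w') = matDot A n w + matDot A n w' := by
  simp only [matDot, PiLp.add_apply, mul_add, Finset.sum_add_distrib]

theorem matDot_smul_right (c : ℝ) (A : Matrix (Fin d) (Fin d) ℝ) (n w : E d) :
    matDot A n (c • w) = c * matDot A n w := by
  simp only [matDot, PiLp.smul_apply, smul_eq_mul, Finset.mul_sum]
  exact Finset.sum_congr rfl fun a _ => Finset.sum_congr rfl fun b _ => by ring

theorem applyC_add (C : Fin d → Fin d → Fin d → Fin d → ℝ) (A B : Matrix (Fin d) (Fin d) ℝ) :
    applyC C (A + B) = applyC C A + applyC C B := by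
  ext a b
  simp only [applyC, Matrix.add_apply, mul_add, Finset.sum_add_distrib]

theorem applyC_smul (C : Fin d → Fin d → Fin d → Fin d → ℝ) (c : ℝ)
    (A : Matrix (Fin d) (Fin d) ℝ) : applyC C (c • A) = c • applyC C A := by
  ext a b
  simp only [applyC, Matrix.smul_apply, smul_eq_mul, Finset.mul_sum]
  exact Finset.sum_congr rfl fun a _ => Finset.sum_congr rfl fun b _ => by ring

theorem flux_add (K : Matrix (Fin d) (Fin d) ℝ) (g g' : Fin d → ℝ) (n : E d) :
    flux K (g + g') n = flux K g n + flux K g' n := by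
  simp only [flux, Pi.add_apply, mul_add, add_mul, Finset.sum_add_distrib]

theorem flux_smul (K : Matrix (Fin d) (Fin d) ℝ) (c : ℝ) (g : Fin d → ℝ) (n : E d) :
    flux K (c • g) n = c * flux K g n := by
  simp only [flux, Pi.smul_apply, smul_eq_mul, Finset.mul_sum]
  exact Finset.sum_congr rfl fun a _ => Finset.sum_congr rfl fun b _ => by ring

theorem dotE_comm (v w : E d) : dotE v w = dotE w v := by simp only [dotE, mul_comm]

theorem dotE_add_left (v v' w : E d) : dotE (v + v') w = dotE v w + dotE v' w := by
  simp only [dotE, PiLp.add_apply, add_mul, Finset.sum_add_distrib]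

theorem dotE_smul_left (c : ℝ) (v w : E d) : dotE (c • v) w = c * dotE v w := by
  simp only [dotE, PiLp.smul_apply, smul_eq_mul, Finset.mul_sum, mul_assoc]

theorem tr_strain_add' {u v : E d → E d} (hu : M.IsPWV n u) (hv : M.IsPWV n v) {i : Fin M.num}
    {x : E d} (hx : x ∈ closure (M.cell i)) :
    M.tr i (strain fun y => u y + v y) x = M.tr i (strain u) x + M.tr i (strain v) x :=
  Matrix.ext fun a b => tr_strain_add hu hv hx a b

theorem tr_strain_smul' {u : E d → E d} (c : ℝ) (hu : M.IsPWV n u) {i : Fin M.num}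
    {x : E d} (hx : x ∈ closure (M.cell i)) :
    M.tr i (strain fun y => c • u y) x = c • M.tr i (strain u) x :=
  Matrix.ext fun a b => tr_strain_smul c hu hx a b

theorem tr_grad_add' {p q : E d → ℝ} (hp : M.IsPW n p) (hq : M.IsPW n q) {i : Fin M.num}
    {x : E d} (hx : x ∈ closure (M.cell i)) :
    M.tr i (grad fun y => p y + q y) x = M.tr i (grad p) x + M.tr i (grad q) x :=
  funext fun a => tr_grad_add hp hq hx a

theorem tr_grad_smul' {p : E d → ℝ} (c : ℝ) (hp : M.IsPW n p) {i : Fin M.num}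
    {x : E d} (hx : x ∈ closure (M.cell i)) :
    M.tr i (grad fun y => c * p y) x = c • M.tr i (grad p) x :=
  funext fun a => tr_grad_smul c hp hx a

theorem stressB_add_left {χ χ' w : E d → E d} (hχ : M.IsPWV n χ) (hχ' : M.IsPWV n χ')
    (hw : L2V M Γ w) : stressB S M Γ (fun x => χ x + χ' x) w
      = stressB S M Γ χ w + stressB S M Γ χ' w := by
  simp only [stressB]
  rw [← Mesh.bInt_add (integrable_stress hχ hw) (integrable_stress hχ' hw)]
  refine Mesh.bInt_congr fun i x hx => ?_
  rw [tr_strain_add' hχ hχ' hx, applyC_add, matDot_add_left]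

theorem stressB_smul_left {χ : E d → E d} (c : ℝ) (hχ : M.IsPWV n χ) (w : E d → E d) :
    stressB S M Γ (fun x => c • χ x) w = c * stressB S M Γ χ w := by
  simp only [stressB]
  rw [← Mesh.bInt_const_mul]
  refine Mesh.bInt_congr fun i x hx => ?_
  rw [tr_strain_smul' c hχ hx, applyC_smul, matDot_smul_left]

theorem stressB_add_right {χ w w' : E d → E d} (hχ : M.IsPWV n χ) (hw : L2V M Γ w)
    (hw' : L2V M Γ w') : stressB S M Γ χ (fun x => w x + w' x)
      = stressB S M Γ χ w + stressB S M Γ χ w' := by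
  simp only [stressB]
  rw [← Mesh.bInt_add (integrable_stress hχ hw) (integrable_stress hχ hw')]
  exact Mesh.bInt_congr fun i x hx => matDot_add_right _ _ _ _

theorem stressB_smul_right (c : ℝ) (χ w : E d → E d) :
    stressB S M Γ χ (fun x => c • w x) = c * stressB S M Γ χ w := by
  simp only [stressB]
  rw [← Mesh.bInt_const_mul]
  exact Mesh.bInt_congr fun i x hx => matDot_smul_right _ _ _ _

theorem penV_comm (g : ℝ) (w χ : E d → E d) : penV M g Γ w χ = penV M g Γ χ w := by
  simp only [penV, dotE_comm]

theorem penV_add_left (g : ℝ) {w w' χ : E d → E d} (hw : L2V M Γ w) (hw' : L2V M Γ w')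
    (hχ : L2V M Γ χ) : penV M g Γ (fun x => w x + w' x) χ = penV M g Γ w χ + penV M g Γ w' χ := by
  simp only [penV, dotE_add_left, mul_add]
  exact Mesh.bInt_add (fun i => (integrable_dotE hw hχ i).const_mul _)
    fun i => (integrable_dotE hw' hχ i).const_mul _

theorem penV_smul_left (g c : ℝ) (w χ : E d → E d) :
    penV M g Γ (fun x => c • w x) χ = c * penV M g Γ w χ := by
  simp only [penV, dotE_smul_left]
  rw [← Mesh.bInt_const_mul]
  exact Mesh.bInt_congr fun i x _ => by ring

theorem fluxB_add_left {ψ ψ' : E d → ℝ} {q : Fin M.num → E d → ℝ} (hψ : M.IsPW n ψ)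
    (hψ' : M.IsPW n ψ') (hq : L2Q M Γ q) : fluxB S M Γ (fun x => ψ x + ψ' x) q
      = fluxB S M Γ ψ q + fluxB S M Γ ψ' q := by
  simp only [fluxB]
  rw [← Mesh.bInt_add (integrable_fluxB hψ hq) (integrable_fluxB hψ' hq)]
  refine Mesh.bInt_congr fun i x hx => ?_
  rw [tr_grad_add' hψ hψ' hx, flux_add, mul_add]

theorem fluxB_smul_left {ψ : E d → ℝ} (c : ℝ) (hψ : M.IsPW n ψ) (q : Fin M.num → E d → ℝ) :
    fluxB S M Γ (fun x => c * ψ x) q = c * fluxB S M Γ ψ q := by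
  simp only [fluxB]
  rw [← Mesh.bInt_const_mul]
  refine Mesh.bInt_congr fun i x hx => ?_
  rw [tr_grad_smul' c hψ hx, flux_smul]
  ring

theorem fluxB_add_right {ψ : E d → ℝ} {q q' : Fin M.num → E d → ℝ} (hψ : M.IsPW n ψ)
    (hq : L2Q M Γ q) (hq' : L2Q M Γ q') : fluxB S M Γ ψ (fun i x => q i x + q' i x)
      = fluxB S M Γ ψ q + fluxB S M Γ ψ q' := by
  simp only [fluxB]
  rw [← Mesh.bInt_add (integrable_fluxB hψ hq) (integrable_fluxB hψ hq')]
  exact Mesh.bInt_congr fun i x hx => add_mul _ _ _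

theorem fluxB_smul_right (c : ℝ) (ψ : E d → ℝ) (q : Fin M.num → E d → ℝ) :
    fluxB S M Γ ψ (fun i x => c * q i x) = c * fluxB S M Γ ψ q := by
  simp only [fluxB]
  rw [← Mesh.bInt_const_mul]
  exact Mesh.bInt_congr fun i x hx => mul_assoc _ _ _

theorem penQ_comm (g : ℝ) (q ψ : Fin M.num → E d → ℝ) : penQ M g Γ q ψ = penQ M g Γ ψ q := by
  simp only [penQ, mul_comm]

theorem penQ_add_left (g : ℝ) {q q' ψ : Fin M.num → E d → ℝ} (hq : L2Q M Γ q) (hq' : L2Q M Γ q')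
    (hψ : L2Q M Γ ψ) :
    penQ M g Γ (fun i x => q i x + q' i x) ψ = penQ M g Γ q ψ + penQ M g Γ q' ψ := by
  simp only [penQ, add_mul, mul_add]
  exact Mesh.bInt_add (fun i => (integrable_penQ hq hψ i).const_mul _)
    fun i => (integrable_penQ hq' hψ i).const_mul _

theorem penQ_smul_left (g c : ℝ) (q ψ : Fin M.num → E d → ℝ) :
    penQ M g Γ (fun i x => c * q i x) ψ = c * penQ M g Γ q ψ := by
  simp only [penQ]
  rw [← Mesh.bInt_const_mul]
  exact Mesh.bInt_congr fun i x _ => by ring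

theorem integrable_bdryN {χ : E d → E d} {q : E d → ℝ} (hχ : L2V M Γ χ) (hq : M.IsReg q)
    (i : Fin M.num) :
    Integrable (fun x => dotE (χ x) (M.normal i x) * M.tr i q x) (M.bdOn i Γ) := by
  have h : MemLp (fun x => dotE (M.normal i x) (χ x)) 2 (M.bdOn i Γ) :=
    memLp_finsetSum _ fun a _ =>
      memLp_top_mul ((M.memLp_normal i a).mono_measure (M.bdOn_le i Γ)) (hχ i a)
  have := memLp_top_mul ((hq.memLp_tr i).mono_measure (M.bdOn_le i Γ)) h
  simpa only [mul_comm, dotE_comm] using this.integrable (by norm_num)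

theorem bdryN_add_left {χ χ' : E d → E d} {q : E d → ℝ} (hχ : L2V M S.ΓuD χ)
    (hχ' : L2V M S.ΓuD χ') (hq : M.IsReg q) :
    bdryN S M (fun x => χ x + χ' x) q = bdryN S M χ q + bdryN S M χ' q := by
  simp only [bdryN]
  rw [← Mesh.bInt_add (integrable_bdryN hχ hq) (integrable_bdryN hχ' hq)]
  exact Mesh.bInt_congr fun i x _ => by rw [dotE_add_left, add_mul]

theorem bdryN_smul_left (c : ℝ) (χ : E d → E d) (q : E d → ℝ) :
    bdryN S M (fun x => c • χ x) q = c * bdryN S M χ q := by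
  simp only [bdryN]
  rw [← Mesh.bInt_const_mul]
  exact Mesh.bInt_congr fun i x _ => by rw [dotE_smul_left, mul_assoc]

theorem bdryN_add_right {χ : E d → E d} {q q' : E d → ℝ} (hχ : L2V M S.ΓuD χ)
    (hq : M.IsReg q) (hq' : M.IsReg q') :
    bdryN S M χ (fun x => q x + q' x) = bdryN S M χ q + bdryN S M χ q' := by
  simp only [bdryN]
  rw [← Mesh.bInt_add (integrable_bdryN hχ hq) (integrable_bdryN hχ hq')]
  exact Mesh.bInt_congr fun i x hx => by rw [hq.tr_add hq' hx, mul_add]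

theorem bdryN_smul_right (c : ℝ) (χ : E d → E d) {q : E d → ℝ} (hq : M.IsReg q) :
    bdryN S M χ (fun x => c * q x) = c * bdryN S M χ q := by
  simp only [bdryN]
  rw [← Mesh.bInt_const_mul]
  exact Mesh.bInt_congr fun i x hx => by rw [hq.tr_const_mul c hx]; ring

end Boundary

/-! ### Interior faces -/

section Faces

variable {S : Setting d} {M : Mesh d S.Ω} {n : ℕ}

theorem faceInt_eq (w : Fin M.num → Fin M.num → E d → ℝ) :
    faceInt S M w = ∑ i, ∑ j ∈ Finset.Ioi i, ∫ x, w i j x ∂M.bdOn i (frontier (M.cell j)) := rfl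

theorem ae_face {i j : Fin M.num} {p : E d → Prop}
    (h : ∀ x ∈ closure (M.cell i), x ∈ closure (M.cell j) → p x) :
    ∀ᵐ x ∂M.bdOn i (frontier (M.cell j)), p x := by
  filter_upwards [M.ae_bdOn (i := i) (frontier (M.cell j)) fun x hx => hx,
    (M.bdOn_frontier_le i j).absolutelyContinuous (M.ae_bd (i := j) fun x hx => hx)] with x h1 h2
  exact h x h1 h2

theorem faceInt_congr {w w' : Fin M.num → Fin M.num → E d → ℝ}
    (h : ∀ i j, ∀ x ∈ closure (M.cell i), x ∈ closure (M.cell j) → w i j x = w' i j x) :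
    faceInt S M w = faceInt S M w' :=
  Finset.sum_congr rfl fun i _ => Finset.sum_congr rfl fun j _ => integral_congr_ae (ae_face (h i j))

theorem faceInt_add {w w' : Fin M.num → Fin M.num → E d → ℝ}
    (h : ∀ i j, Integrable (w i j) (M.bdOn i (frontier (M.cell j))))
    (h' : ∀ i j, Integrable (w' i j) (M.bdOn i (frontier (M.cell j)))) :
    faceInt S M (fun i j x => w i j x + w' i j x) = faceInt S M w + faceInt S M w' := by
  simp only [faceInt_eq, ← Finset.sum_add_distrib]
  exact Finset.sum_congr rfl fun i _ => Finset.sum_congr rfl fun j _ => integral_add (h i j) (h' i j)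

theorem faceInt_const_mul (c : ℝ) (w : Fin M.num → Fin M.num → E d → ℝ) :
    faceInt S M (fun i j x => c * w i j x) = c * faceInt S M w := by
  simp only [faceInt_eq, Finset.mul_sum, integral_const_mul]

theorem memLp_jump {q : E d → ℝ} (hq : M.IsReg q) (i j : Fin M.num) :
    MemLp (jump S M i j q) ⊤ (M.bdOn i (frontier (M.cell j))) :=
  ((hq.memLp_tr i).mono_measure (M.bdOn_le i _)).sub
    ((hq.memLp_tr j).mono_measure (M.bdOn_frontier_le i j))

theorem memLp_avgFlux {q : E d → ℝ} (hq : M.IsPW n q) (i j : Fin M.num) :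
    MemLp (avgFlux S M i j q) ⊤ (M.bdOn i (frontier (M.cell j))) := by
  refine memLp_flux (S := S) (M.bdOn_le i _) fun a => ?_
  exact (((memLp_tr_grad hq i a).mono_measure (M.bdOn_le i _)).add
    ((memLp_tr_grad hq j a).mono_measure (M.bdOn_frontier_le i j))).const_mul (1 / 2)

theorem jump_add {p q : E d → ℝ} (hp : M.IsReg p) (hq : M.IsReg q) {i j : Fin M.num} {x : E d}
    (hi : x ∈ closure (M.cell i)) (hj : x ∈ closure (M.cell j)) :
    jump S M i j (fun y => p y + q y) x = jump S M i j p x + jump S M i j q x := by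
  simp only [jump, hp.tr_add hq hi, hp.tr_add hq hj]
  ring

theorem jump_smul (c : ℝ) {p : E d → ℝ} (hp : M.IsReg p) {i j : Fin M.num} {x : E d}
    (hi : x ∈ closure (M.cell i)) (hj : x ∈ closure (M.cell j)) :
    jump S M i j (fun y => c * p y) x = c * jump S M i j p x := by
  simp only [jump, hp.tr_const_mul c hi, hp.tr_const_mul c hj]
  ring

theorem avgFlux_add {p q : E d → ℝ} (hp : M.IsPW n p) (hq : M.IsPW n q) {i j : Fin M.num} {x : E d}
    (hi : x ∈ closure (M.cell i)) (hj : x ∈ closure (M.cell j)) :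
    avgFlux S M i j (fun y => p y + q y) x = avgFlux S M i j p x + avgFlux S M i j q x := by
  simp only [avgFlux, tr_grad_add' hp hq hi, tr_grad_add' hp hq hj, flux_smul, flux_add]
  ring

theorem avgFlux_smul (c : ℝ) {p : E d → ℝ} (hp : M.IsPW n p) {i j : Fin M.num} {x : E d}
    (hi : x ∈ closure (M.cell i)) (hj : x ∈ closure (M.cell j)) :
    avgFlux S M i j (fun y => c * p y) x = c * avgFlux S M i j p x := by
  simp only [avgFlux, tr_grad_smul' c hp hi, tr_grad_smul' c hp hj, flux_smul, flux_add]
  ring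

end Faces

end Biot

end

noncomputable section

namespace Biot

variable {d : ℕ}

/-! ### The forms as bilinear maps on the finite element spaces -/

section Forms

variable {S : Setting d} {M : Mesh d S.Ω} {n r : ℕ}

theorem Setting.volume_lt_top (S : Setting d) : volume S.Ω < ⊤ := S.bounded.measure_lt_top

/-- `⟨C ε(w), ε(χ)⟩`. -/
def elast (S : Setting d) (w χ : E d → E d) : ℝ :=
  ∫ x in S.Ω, ∑ i, ∑ j, applyC S.C (strain w x) i j * strain χ x i j

/-- `⟨K ∇q, ∇ψ⟩`. -/
def diffn (S : Setting d) (q ψ : E d → ℝ) : ℝ :=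
  ∫ x in S.Ω, ∑ i, ∑ j, S.Kp i j * grad q x j * grad ψ x i

theorem isReg_elast {w χ : E d → E d} (hw : M.IsPWV n w) (hχ : M.IsPWV n χ) :
    M.IsReg fun x => ∑ i, ∑ j, applyC S.C (strain w x) i j * strain χ x i j :=
  Mesh.isReg_sum _ fun a _ => Mesh.isReg_sum _ fun b _ =>
    (Mesh.isReg_sum _ fun k _ => Mesh.isReg_sum _ fun l _ =>
      (hw.isReg_strain k l).const_mul _).mul (hχ.isReg_strain a b)

theorem isReg_diffn {q ψ : E d → ℝ} (hq : M.IsPW n q) (hψ : M.IsPW n ψ) :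
    M.IsReg fun x => ∑ i, ∑ j, S.Kp i j * grad q x j * grad ψ x i :=
  Mesh.isReg_sum _ fun a _ => Mesh.isReg_sum _ fun b _ =>
    ((hq.isReg_grad b).const_mul _).mul (hψ.isReg_grad a)

/-- The symmetry `C_{ijkl} = C_{klij}`, after exchanging the two index pairs in the sum. -/
theorem elast_comm (w χ : E d → E d) : elast S w χ = elast S χ w := by
  refine integral_congr_ae (Eventually.of_forall fun x => ?_)
  simp only [applyC, Finset.sum_mul]
  have e : ∀ f : Fin d → Fin d → Fin d → Fin d → ℝ,
      ∑ i, ∑ j, ∑ k, ∑ l, f i j k l = ∑ i, ∑ j, ∑ k, ∑ l, f k l i j := by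
    intro f
    have e1 := Finset.sum_comm (s := (Finset.univ : Finset (Fin d × Fin d)))
      (t := (Finset.univ : Finset (Fin d × Fin d))) (f := fun p q => f p.1 p.2 q.1 q.2)
    simpa only [Fintype.sum_prod_type] using e1
  rw [e]
  refine Finset.sum_congr rfl fun i _ => Finset.sum_congr rfl fun j _ =>
    Finset.sum_congr rfl fun k _ => Finset.sum_congr rfl fun l _ => ?_
  rw [S.C_symm k l i j]
  ring

theorem elast_add_left {w w' χ : E d → E d} (hw : M.IsPWV n w) (hw' : M.IsPWV n w')
    (hχ : M.IsPWV n χ) :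
    elast S (fun x => w x + w' x) χ = elast S w χ + elast S w' χ := by
  simp only [elast]
  rw [← integral_add ((isReg_elast hw hχ).integrable S.volume_lt_top)
    ((isReg_elast hw' hχ).integrable S.volume_lt_top)]
  refine setIntegral_congr_cells (M := M) fun x hx => ?_
  have : strain (fun y => w y + w' y) x = strain w x + strain w' x :=
    Matrix.ext fun a b => strain_add hw hw' hx a b
  simp only [this, applyC_add, Matrix.add_apply, add_mul, Finset.sum_add_distrib]

theorem elast_smul_left (c : ℝ) {w : E d → E d} (hw : M.IsPWV n w) (χ : E d → E d) :
    elast S (fun x => c • w x) χ = c * elast S w χ := by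
  simp only [elast]
  rw [← integral_const_mul]
  refine setIntegral_congr_cells (M := M) fun x hx => ?_
  have : strain (fun y => c • w y) x = c • strain w x :=
    Matrix.ext fun a b => strain_smul c hw hx a b
  simp only [this, applyC_smul, Matrix.smul_apply, smul_eq_mul, Finset.mul_sum, mul_assoc]

theorem diffn_comm (q ψ : E d → ℝ) : diffn S q ψ = diffn S ψ q := by
  refine integral_congr_ae (Eventually.of_forall fun x => ?_)
  simp only
  rw [Finset.sum_comm]
  refine Finset.sum_congr rfl fun i _ => Finset.sum_congr rfl fun j _ => ?_
  rw [← S.Kp_symm.apply i j]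
  ring

theorem diffn_add_left {q q' ψ : E d → ℝ} (hq : M.IsPW n q) (hq' : M.IsPW n q')
    (hψ : M.IsPW n ψ) : diffn S (fun x => q x + q' x) ψ = diffn S q ψ + diffn S q' ψ := by
  simp only [diffn]
  rw [← integral_add ((isReg_diffn hq hψ).integrable S.volume_lt_top)
    ((isReg_diffn hq' hψ).integrable S.volume_lt_top)]
  refine setIntegral_congr_cells (M := M) fun x hx => ?_
  simp only [grad_add hq hq' hx, mul_add, add_mul, Finset.sum_add_distrib]

theorem diffn_smul_left (c : ℝ) {q : E d → ℝ} (hq : M.IsPW n q) (ψ : E d → ℝ) :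
    diffn S (fun x => c * q x) ψ = c * diffn S q ψ := by
  simp only [diffn]
  rw [← integral_const_mul]
  refine setIntegral_congr_cells (M := M) fun x hx => ?_
  simp only [grad_smul c hq hx, Finset.mul_sum]
  exact Finset.sum_congr rfl fun a _ => Finset.sum_congr rfl fun b _ => by ring

theorem diffusion_eq {q ψ : E d → ℝ} (hq : M.IsPW n q) (hψ : M.IsPW n ψ) :
    diffusion S M q ψ = diffn S q ψ :=
  ((isReg_diffn hq hψ).integral_eq_sum S.volume_lt_top).symm

variable (c : Params)

theorem aN_eq (w χ : E d → E d) :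
    aN S M c w χ = -stressB S M S.ΓuD χ w + penV M c.γa S.ΓuD w χ := rfl

theorem formA_eq (w χ : E d → E d) : formA S M c w χ
    = elast S w χ - stressB S M S.ΓuD w χ + (-stressB S M S.ΓuD χ w + penV M c.γa S.ΓuD w χ) := rfl

theorem bN_eq (q ψ : E d → ℝ) : bN S M c q ψ
    = -fluxB S M S.ΓpD ψ (fun _ => q) + penQ M c.γb S.ΓpD (fun _ => q) fun _ => ψ := rfl

theorem formA_comm (w χ : E d → E d) : formA S M c w χ = formA S M c χ w := by
  rw [formA_eq, formA_eq, elast_comm, penV_comm]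
  ring

theorem formB_cont_eq (q ψ : E d → ℝ) : formB S M c .cont q ψ
    = diffn S q ψ - fluxB S M S.ΓpD q (fun _ => ψ)
      + (-fluxB S M S.ΓpD ψ (fun _ => q) + penQ M c.γb S.ΓpD (fun _ => q) fun _ => ψ) := by
  rw [← bN_eq]
  simp only [formB, diffn, fluxB, mul_comm (ψ _)]

/-- The flux term `⟨{K ∇q} · n, [ψ]⟩` on the interior faces. -/
def faceFlux (S : Setting d) (M : Mesh d S.Ω) (q ψ : E d → ℝ) : ℝ :=
  faceInt S M fun i j x => avgFlux S M i j q x * jump S M i j ψ x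

/-- The penalty term `γ / h_F ⟨[q], [ψ]⟩` on the interior faces. -/
def facePen (S : Setting d) (M : Mesh d S.Ω) (g : ℝ) (q ψ : E d → ℝ) : ℝ :=
  faceInt S M fun i j x =>
    g / ((M.size i + M.size j) / 2) * (jump S M i j q x * jump S M i j ψ x)

theorem integrable_faceFlux {q ψ : E d → ℝ} (hq : M.IsPW n q) (hψ : M.IsReg ψ) (i j : Fin M.num) :
    Integrable (fun x => avgFlux S M i j q x * jump S M i j ψ x)
      (M.bdOn i (frontier (M.cell j))) :=
  (memLp_top_mul (memLp_avgFlux hq i j) (memLp_jump hψ i j)).integrable le_top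

theorem integrable_facePen {q ψ : E d → ℝ} (hq : M.IsReg q) (hψ : M.IsReg ψ) (i j : Fin M.num) :
    Integrable (fun x => jump S M i j q x * jump S M i j ψ x)
      (M.bdOn i (frontier (M.cell j))) :=
  (memLp_top_mul (memLp_jump hq i j) (memLp_jump hψ i j)).integrable le_top

/-- Splitting the face integrals of sums needs integrability of both summands, which is why the
arguments must be piecewise polynomials. -/
theorem formB_disc_eq {q ψ : E d → ℝ} (hq : M.IsPW n q) (hψ : M.IsPW n ψ) :
    formB S M c .disc q ψ
    = diffn S q ψ - (faceFlux S M q ψ + faceFlux S M ψ q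
        + (fluxB S M (frontier S.Ω) q (fun i => M.tr i ψ)
          + fluxB S M (frontier S.Ω) ψ fun i => M.tr i q))
      + (facePen S M c.γ q ψ
        + penQ M c.γ (frontier S.Ω) (fun i => M.tr i q) fun i => M.tr i ψ) := by
  have h1 := faceInt_add (integrable_faceFlux (S := S) hq hψ.isReg)
    (integrable_faceFlux hψ hq.isReg)
  have h2 := Mesh.bInt_add (integrable_fluxB (S := S) (Γ := frontier S.Ω) hq (L2Q_tr hψ.isReg))
    (integrable_fluxB hψ (L2Q_tr hq.isReg))
  simp only [formB, diffusion_eq hq hψ, mul_comm (flux _ _ _) (M.tr _ ψ _),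
    mul_comm (jump _ _ _ _ q _) (avgFlux _ _ _ _ _ _)]
  rw [h1, h2]
  rfl

theorem formB_comm {kind : PressureKind} {q ψ : E d → ℝ} (hq : M.IsPW n q) (hψ : M.IsPW n ψ) :
    formB S M c kind q ψ = formB S M c kind ψ q := by
  cases kind
  · rw [formB_cont_eq, formB_cont_eq, diffn_comm, penQ_comm]
    ring
  · rw [formB_disc_eq c hq hψ, formB_disc_eq c hψ hq, diffn_comm, penQ_comm]
    have : facePen S M c.γ q ψ = facePen S M c.γ ψ q := by
      simp only [facePen, mul_comm (jump _ _ _ _ q _)]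
    rw [this]
    ring

theorem formA_add_left {w w' χ : E d → E d} (hw : w ∈ Vh M r) (hw' : w' ∈ Vh M r)
    (hχ : χ ∈ Vh M r) :
    formA S M c (fun x => w x + w' x) χ = formA S M c w χ + formA S M c w' χ := by
  have p1 := isPWV_of_mem hw
  have p2 := isPWV_of_mem hw'
  have p3 := isPWV_of_mem hχ
  have l1 : L2V M S.ΓuD w := L2V_of_continuousOn hw.2.1
  have l2 : L2V M S.ΓuD w' := L2V_of_continuousOn hw'.2.1
  have l3 : L2V M S.ΓuD χ := L2V_of_continuousOn hχ.2.1
  simp only [formA_eq, elast_add_left p1 p2 p3, stressB_add_left p1 p2 l3,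
    stressB_add_right p3 l1 l2, penV_add_left _ l1 l2 l3]
  ring

theorem formA_smul_left (a : ℝ) {w : E d → E d} (hw : w ∈ Vh M r) (χ : E d → E d) :
    formA S M c (fun x => a • w x) χ = a * formA S M c w χ := by
  have p1 := isPWV_of_mem hw
  simp only [formA_eq, elast_smul_left a p1, stressB_smul_left a p1, stressB_smul_right,
    penV_smul_left]
  ring

theorem fluxB_congr {Γ : Set (E d)} {ψ : E d → ℝ} {q q' : Fin M.num → E d → ℝ}
    (h : ∀ i, ∀ x ∈ closure (M.cell i), q i x = q' i x) :
    fluxB S M Γ ψ q = fluxB S M Γ ψ q' :=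
  Mesh.bInt_congr fun i x hx => by rw [h i x hx]

theorem penQ_congr {Γ : Set (E d)} {g : ℝ} {ψ : Fin M.num → E d → ℝ} {q q' : Fin M.num → E d → ℝ}
    (h : ∀ i, ∀ x ∈ closure (M.cell i), q i x = q' i x) :
    penQ M g Γ q ψ = penQ M g Γ q' ψ :=
  Mesh.bInt_congr fun i x hx => by rw [h i x hx]

theorem faceFlux_add_left {q q' ψ : E d → ℝ} (hq : M.IsPW n q) (hq' : M.IsPW n q')
    (hψ : M.IsReg ψ) :
    faceFlux S M (fun x => q x + q' x) ψ = faceFlux S M q ψ + faceFlux S M q' ψ := by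
  simp only [faceFlux]
  rw [← faceInt_add (integrable_faceFlux hq hψ) (integrable_faceFlux hq' hψ)]
  exact faceInt_congr fun i j x hi hj => by rw [avgFlux_add hq hq' hi hj, add_mul]

theorem faceFlux_smul_left (a : ℝ) {q : E d → ℝ} (hq : M.IsPW n q) (ψ : E d → ℝ) :
    faceFlux S M (fun x => a * q x) ψ = a * faceFlux S M q ψ := by
  simp only [faceFlux]
  rw [← faceInt_const_mul]
  exact faceInt_congr fun i j x hi hj => by rw [avgFlux_smul a hq hi hj, mul_assoc]

theorem faceFlux_add_right {q q' ψ : E d → ℝ} (hψ : M.IsPW n ψ) (hq : M.IsReg q) (hq' : M.IsReg q') :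
    faceFlux S M ψ (fun x => q x + q' x) = faceFlux S M ψ q + faceFlux S M ψ q' := by
  simp only [faceFlux]
  rw [← faceInt_add (integrable_faceFlux hψ hq) (integrable_faceFlux hψ hq')]
  exact faceInt_congr fun i j x hi hj => by rw [jump_add hq hq' hi hj, mul_add]

theorem faceFlux_smul_right (a : ℝ) {q : E d → ℝ} (hq : M.IsReg q) (ψ : E d → ℝ) :
    faceFlux S M ψ (fun x => a * q x) = a * faceFlux S M ψ q := by
  simp only [faceFlux]
  rw [← faceInt_const_mul]
  exact faceInt_congr fun i j x hi hj => by rw [jump_smul a hq hi hj]; ring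

theorem facePen_add_left (g : ℝ) {q q' ψ : E d → ℝ} (hq : M.IsReg q) (hq' : M.IsReg q')
    (hψ : M.IsReg ψ) :
    facePen S M g (fun x => q x + q' x) ψ = facePen S M g q ψ + facePen S M g q' ψ := by
  simp only [facePen]
  rw [← faceInt_add (fun i j => (integrable_facePen hq hψ i j).const_mul _)
    fun i j => (integrable_facePen hq' hψ i j).const_mul _]
  exact faceInt_congr fun i j x hi hj => by rw [jump_add hq hq' hi hj]; ring

theorem facePen_smul_left (g a : ℝ) {q : E d → ℝ} (hq : M.IsReg q) (ψ : E d → ℝ) :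
    facePen S M g (fun x => a * q x) ψ = a * facePen S M g q ψ := by
  simp only [facePen]
  rw [← faceInt_const_mul]
  exact faceInt_congr fun i j x hi hj => by rw [jump_smul a hq hi hj]; ring

theorem formB_add_left {kind : PressureKind} {q q' ψ : E d → ℝ} (hq : q ∈ Qh M r kind)
    (hq' : q' ∈ Qh M r kind) (hψ : ψ ∈ Qh M r kind) :
    formB S M c kind (fun x => q x + q' x) ψ = formB S M c kind q ψ + formB S M c kind q' ψ := by
  have p1 := isPW_of_mem hq
  have p2 := isPW_of_mem hq'
  have p3 := isPW_of_mem hψ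
  cases kind
  · have l1 : L2Q M S.ΓpD fun _ => q := L2Q_of_continuousOn hq.2.2.1
    have l2 : L2Q M S.ΓpD fun _ => q' := L2Q_of_continuousOn hq'.2.2.1
    have l3 : L2Q M S.ΓpD fun _ => ψ := L2Q_of_continuousOn hψ.2.2.1
    have e1 := fluxB_add_right (S := S) p3 l1 l2
    have e2 := penQ_add_left c.γb l1 l2 l3
    simp only [formB_cont_eq, diffn_add_left p1 p2 p3, fluxB_add_left p1 p2 l3, e1, e2]
    ring
  · have t : ∀ i, ∀ x ∈ closure (M.cell i),
        M.tr i (fun y => q y + q' y) x = M.tr i q x + M.tr i q' x :=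
      fun i x hx => p1.isReg.tr_add p2.isReg hx
    have l1 : L2Q M (frontier S.Ω) fun i => M.tr i q := L2Q_tr p1.isReg
    have l2 : L2Q M (frontier S.Ω) fun i => M.tr i q' := L2Q_tr p2.isReg
    have l3 : L2Q M (frontier S.Ω) fun i => M.tr i ψ := L2Q_tr p3.isReg
    rw [formB_disc_eq c (p1.add p2) p3, formB_disc_eq c p1 p3, formB_disc_eq c p2 p3,
      diffn_add_left p1 p2 p3, faceFlux_add_left p1 p2 p3.isReg,
      faceFlux_add_right p3 p1.isReg p2.isReg, facePen_add_left _ p1.isReg p2.isReg p3.isReg,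
      fluxB_add_left p1 p2 l3, fluxB_congr t, penQ_congr t, fluxB_add_right p3 l1 l2,
      penQ_add_left _ l1 l2 l3]
    ring

theorem formB_smul_left (a : ℝ) {kind : PressureKind} {q ψ : E d → ℝ} (hq : q ∈ Qh M r kind)
    (hψ : ψ ∈ Qh M r kind) :
    formB S M c kind (fun x => a * q x) ψ = a * formB S M c kind q ψ := by
  have p1 := isPW_of_mem hq
  have p3 := isPW_of_mem hψ
  cases kind
  · have e1 := fluxB_smul_right (S := S) (M := M) (Γ := S.ΓpD) a ψ fun _ => q
    have e2 := penQ_smul_left (S := S) (M := M) (Γ := S.ΓpD) c.γb a (fun _ => q) fun _ => ψ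
    simp only [formB_cont_eq, diffn_smul_left a p1, fluxB_smul_left a p1, e1, e2]
    ring
  · have t : ∀ i, ∀ x ∈ closure (M.cell i), M.tr i (fun y => a * q y) x = a * M.tr i q x :=
      fun i x hx => p1.isReg.tr_const_mul a hx
    rw [formB_disc_eq c (p1.const_mul a) p3, formB_disc_eq c p1 p3,
      diffn_smul_left a p1, faceFlux_smul_left a p1,
      faceFlux_smul_right a p1.isReg, facePen_smul_left _ a p1.isReg,
      fluxB_smul_left a p1, fluxB_congr t, penQ_congr t, fluxB_smul_right, penQ_smul_left]
    ring

/-- A symmetric map that is linear in its first argument, as a bilinear form. -/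
def symmBilin {V : Type*} [AddCommGroup V] [Module ℝ V] (f : V → V → ℝ)
    (hs : ∀ x y, f x y = f y x) (ha : ∀ x x' y, f (x + x') y = f x y + f x' y)
    (hc : ∀ (c : ℝ) x y, f (c • x) y = c * f x y) : LinearMap.BilinForm ℝ V :=
  LinearMap.mk₂ ℝ f ha hc (fun x y y' => by rw [hs, ha, hs y, hs y'])
    (fun c x y => by rw [hs, hc, hs y]; rfl)

/-- The `L²` inner product on `V_h`. -/
def bilV (S : Setting d) (M : Mesh d S.Ω) (r : ℕ) : LinearMap.BilinForm ℝ (VhS M r) :=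
  symmBilin (fun u v => ipV S.Ω u.1 v.1) (fun _ _ => ipV_comm _ _)
    (fun u u' v => ipV_add_left S.volume_lt_top (isPWV_of_mem u.2) (isPWV_of_mem u'.2)
      (isPWV_of_mem v.2))
    fun a _ _ => ipV_smul_left a _ _

/-- The `L²` inner product on `Q_h`. -/
def bilQ (S : Setting d) (M : Mesh d S.Ω) (r : ℕ) (kind : PressureKind) :
    LinearMap.BilinForm ℝ (QhS M r kind) :=
  symmBilin (fun p q => ipQ S.Ω p.1 q.1) (fun _ _ => ipQ_comm _ _)
    (fun p p' q => ipQ_add_left S.volume_lt_top (isPW_of_mem p.2).isReg (isPW_of_mem p'.2).isReg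
      (isPW_of_mem q.2).isReg)
    fun a _ _ => ipQ_smul_left a _ _

/-- `A_γ` on `V_h`. -/
def bilA (S : Setting d) (M : Mesh d S.Ω) (r : ℕ) (c : Params) : LinearMap.BilinForm ℝ (VhS M r) :=
  symmBilin (fun u v => formA S M c u.1 v.1) (fun _ _ => formA_comm c _ _)
    (fun u u' v => formA_add_left c u.2 u'.2 v.2) fun a u _ => formA_smul_left c a u.2 _

/-- `B_γ` on `Q_h`. -/
def bilB (S : Setting d) (M : Mesh d S.Ω) (r : ℕ) (kind : PressureKind) (c : Params) :
    LinearMap.BilinForm ℝ (QhS M r kind) :=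
  symmBilin (fun p q => formB S M c kind p.1 q.1)
    (fun p q => formB_comm c (isPW_of_mem p.2) (isPW_of_mem q.2))
    (fun p p' q => formB_add_left c p.2 p'.2 q.2) fun a p q => formB_smul_left c a p.2 q.2

theorem ipQ_dvg_add {u v : E d → E d} {q : E d → ℝ} (hu : M.IsPWV n u) (hv : M.IsPWV n v)
    (hq : M.IsReg q) :
    ipQ S.Ω (dvg fun x => u x + v x) q = ipQ S.Ω (dvg u) q + ipQ S.Ω (dvg v) q := by
  rw [← ipQ_add_left S.volume_lt_top hu.isReg_dvg hv.isReg_dvg hq]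
  exact setIntegral_congr_cells (M := M) fun x hx => by rw [dvg_add hu hv hx]

theorem ipQ_dvg_smul (a : ℝ) {u : E d → E d} (hu : M.IsPWV n u) (q : E d → ℝ) :
    ipQ S.Ω (dvg fun x => a • u x) q = a * ipQ S.Ω (dvg u) q := by
  rw [← ipQ_smul_left]
  exact setIntegral_congr_cells (M := M) fun x hx => by rw [dvg_smul a hu hx]

theorem ipQ_add_right {u q q' : E d → ℝ} (hu : M.IsReg u) (hq : M.IsReg q) (hq' : M.IsReg q') :
    ipQ S.Ω u (fun x => q x + q' x) = ipQ S.Ω u q + ipQ S.Ω u q' := by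
  rw [ipQ_comm, ipQ_add_left S.volume_lt_top hq hq' hu, ipQ_comm q, ipQ_comm q']

theorem ipQ_smul_right (a : ℝ) (u q : E d → ℝ) :
    ipQ S.Ω u (fun x => a * q x) = a * ipQ S.Ω u q := by
  rw [ipQ_comm, ipQ_smul_left, ipQ_comm]

/-- The coupling form on `V_h × Q_h`. -/
def bilC (S : Setting d) (M : Mesh d S.Ω) (r : ℕ) (kind : PressureKind) (c : Params) :
    VhS M r →ₗ[ℝ] QhS M r kind →ₗ[ℝ] ℝ :=
  LinearMap.mk₂ ℝ (fun u q => formC S M c u.1 q.1)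
    (fun u u' q => by
      have h1 := ipQ_dvg_add (S := S) (isPWV_of_mem u.2) (isPWV_of_mem u'.2) (isPW_of_mem q.2).isReg
      have h2 := bdryN_add_left (S := S) (L2V_of_continuousOn u.2.2.1)
        (L2V_of_continuousOn u'.2.2.1) (isPW_of_mem q.2).isReg
      change -c.α * ipQ S.Ω (dvg fun x => u.1 x + u'.1 x) q.1
        + c.α * bdryN S M (fun x => u.1 x + u'.1 x) q.1 = _
      rw [h1, h2]
      simp only [formC]
      ring)
    (fun a u q => by
      change -c.α * ipQ S.Ω (dvg fun x => a • u.1 x) q.1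
        + c.α * bdryN S M (fun x => a • u.1 x) q.1 = _
      rw [ipQ_dvg_smul a (isPWV_of_mem u.2), bdryN_smul_left]
      simp only [formC, smul_eq_mul]
      ring)
    (fun u q q' => by
      have h1 := ipQ_add_right (S := S) (isPWV_of_mem u.2).isReg_dvg (isPW_of_mem q.2).isReg
        (isPW_of_mem q'.2).isReg
      have h2 := bdryN_add_right (S := S) (L2V_of_continuousOn u.2.2.1)
        (isPW_of_mem q.2).isReg (isPW_of_mem q'.2).isReg
      change -c.α * ipQ S.Ω (dvg u.1) (fun x => q.1 x + q'.1 x)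
        + c.α * bdryN S M u.1 (fun x => q.1 x + q'.1 x) = _
      rw [h1, h2]
      simp only [formC]
      ring)
    (fun a u q => by
      change -c.α * ipQ S.Ω (dvg u.1) (fun x => a * q.1 x)
        + c.α * bdryN S M u.1 (fun x => a * q.1 x) = _
      rw [ipQ_smul_right, bdryN_smul_right a _ (isPW_of_mem q.2).isReg]
      simp only [formC, smul_eq_mul]
      ring)

theorem bilV_pos (u : VhS M r) (hu : u ≠ 0) : 0 < bilV S M r u u := by
  have h0 : ∀ x, 0 ≤ dotE (u.1 x) (u.1 x) := fun x => Finset.sum_nonneg fun _ _ => mul_self_nonneg _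
  refine lt_of_le_of_ne (integral_nonneg h0) fun h => hu ?_
  have p := isPWV_of_mem u.2
  refine Subtype.ext (Vh_eq_zero u.2 fun x hx => ?_)
  have := (p.isReg_dotE p).eq_zero_of_integral S.volume_lt_top h0 h.symm x hx
  ext j
  exact mul_self_eq_zero.1 ((Finset.sum_eq_zero_iff_of_nonneg fun _ _ => mul_self_nonneg _).1 this j
    (Finset.mem_univ j))

theorem bilQ_pos {kind : PressureKind} (q : QhS M r kind) (hq : q ≠ 0) :
    0 < bilQ S M r kind q q := by
  have h0 : ∀ x, 0 ≤ q.1 x * q.1 x := fun x => mul_self_nonneg _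
  refine lt_of_le_of_ne (integral_nonneg h0) fun h => hq ?_
  have p := (isPW_of_mem q.2).isReg
  refine Subtype.ext (Qh_eq_zero q.2 fun x hx => ?_)
  exact mul_self_eq_zero.1 ((p.mul p).eq_zero_of_integral S.volume_lt_top h0 h.symm x hx)

end Forms

end Biot

end

noncomputable section

namespace Biot

variable {d : ℕ}

/-! ### Positivity of the forms for large penalty parameters -/

theorem two_mul_le_young {δ : ℝ} (hδ : 0 < δ) (a b : ℝ) : 2 * (|a| * |b|) ≤ δ * a ^ 2 + b ^ 2 / δ := by
  have h : 0 ≤ (δ * |a| - |b|) ^ 2 / δ := by positivity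
  have e : (δ * |a| - |b|) ^ 2 / δ = δ * a ^ 2 + b ^ 2 / δ - 2 * (|a| * |b|) := by
    rw [← sq_abs a, ← sq_abs b]
    field_simp
    ring
  linarith

/-- The sum of the absolute values of the entries of a fourth order tensor. -/
def absC (C : Fin d → Fin d → Fin d → Fin d → ℝ) : ℝ := ∑ a, ∑ b, ∑ k, ∑ l, |C a b k l|

/-- The sum of the absolute values of the entries of a matrix. -/
def absK (K : Matrix (Fin d) (Fin d) ℝ) : ℝ := ∑ a, ∑ b, |K a b|

theorem absC_nonneg (C : Fin d → Fin d → Fin d → Fin d → ℝ) : 0 ≤ absC C := by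
  unfold absC; positivity

theorem absK_nonneg (K : Matrix (Fin d) (Fin d) ℝ) : 0 ≤ absK K := by
  unfold absK; positivity

theorem mul_mul_mul_le_young {δ C e ν w s W : ℝ} (hδ : 0 < δ) (hν : |ν| ≤ 1) (hs : e ^ 2 ≤ s)
    (hW : w ^ 2 ≤ W) : 2 * (C * e * ν * w) ≤ |C| * (δ * s + W / δ) := by
  have h1 := two_mul_le_young hδ e w
  have h2 : δ * e ^ 2 + w ^ 2 / δ ≤ δ * s + W / δ := by gcongr
  have h3 : C * e * ν * w ≤ |C| * (|e| * |w|) := by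
    refine (le_abs_self _).trans ?_
    rw [abs_mul, abs_mul, abs_mul]
    have : |C| * |e| * |w| * |ν| ≤ |C| * |e| * |w| * 1 :=
      mul_le_mul_of_nonneg_left hν (by positivity)
    linarith
  have h4 := mul_le_mul_of_nonneg_left (h1.trans h2) (abs_nonneg C)
  linarith

theorem single_le_sum_sq {ι : Type*} [Fintype ι] (f : ι → ℝ) (i : ι) : f i ^ 2 ≤ ∑ j, f j ^ 2 :=
  Finset.single_le_sum (f := fun j => f j ^ 2) (fun _ _ => sq_nonneg _) (Finset.mem_univ i)

/-- Young's inequality is applied to each entry, with every single square replaced by the full sum.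
The price is the crude but mesh-independent factor `absC C`. -/
theorem matDot_young (C : Fin d → Fin d → Fin d → Fin d → ℝ) (e : Matrix (Fin d) (Fin d) ℝ)
    {n : E d} (hn : ‖n‖ ≤ 1) (w : E d) {δ : ℝ} (hδ : 0 < δ) :
    2 * matDot (applyC C e) n w ≤ absC C * (δ * ∑ k, ∑ l, e k l ^ 2 + dotE w w / δ) := by
  simp only [matDot, applyC, absC, Finset.sum_mul, Finset.mul_sum _ _ (2 : ℝ)]
  refine Finset.sum_le_sum fun a _ => Finset.sum_le_sum fun b _ => Finset.sum_le_sum fun k _ =>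
    Finset.sum_le_sum fun l _ => ?_
  have h1 : |n b| ≤ 1 := (PiLp.norm_apply_le n b).trans hn
  have h2 : e k l ^ 2 ≤ ∑ k, ∑ l, e k l ^ 2 :=
    (single_le_sum_sq (fun l => e k l) l).trans (Finset.single_le_sum
      (f := fun k => ∑ l, e k l ^ 2) (fun _ _ => by positivity) (Finset.mem_univ k))
  have h3 : w a ^ 2 ≤ dotE w w := by
    simpa only [dotE, sq] using single_le_sum_sq (fun a => w a) a
  exact mul_mul_mul_le_young hδ h1 h2 h3

theorem flux_young (K : Matrix (Fin d) (Fin d) ℝ) (g : Fin d → ℝ) {n : E d} (hn : ‖n‖ ≤ 1) (J : ℝ)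
    {δ : ℝ} (hδ : 0 < δ) :
    2 * (flux K g n * J) ≤ absK K * (δ * ∑ b, g b ^ 2 + J ^ 2 / δ) := by
  simp only [flux, absK, Finset.sum_mul, Finset.mul_sum _ _ (2 : ℝ)]
  refine Finset.sum_le_sum fun a _ => Finset.sum_le_sum fun b _ => ?_
  exact mul_mul_mul_le_young hδ ((PiLp.norm_apply_le n a).trans hn) (single_le_sum_sq g b) le_rfl

/-! ### Absorbing flux terms by discrete trace inequalities -/

section Trace

variable {S : Setting d} {M : Mesh d S.Ω} {n : ℕ}

/-- The constant `cT` is admissible in the discrete trace inequality. -/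
def TraceConst (M : Mesh d S.Ω) (n : ℕ) (cT : ℝ) : Prop :=
  ∀ φ, M.IsRat n φ → ∀ i j, ∀ x ∈ closure (M.cell i),
    M.size j * (M.bd i).real univ * M.tr i φ x ^ 2 ≤ cT * ∫ y in M.cell i, φ y ^ 2

theorem integrable_tr_sq {φ : E d → ℝ} (hφ : M.IsReg φ) {i : Fin M.num} {μ : Measure (E d)}
    (hμ : μ ≤ M.bd i) : Integrable (fun x => M.tr i φ x ^ 2) μ := by
  have h := (hφ.memLp_tr i).mono_measure hμ
  have : IsFiniteMeasure μ := isFiniteMeasure_of_le _ hμ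
  simpa only [sq] using (memLp_top_mul h h).integrable le_top

/-- The pointwise bound carries the factor `|∂K|`. Integrating it over a part of `∂K` brings the
mass of that part, at most `|∂K|`, to the right-hand side, and the factor cancels. If `|∂K|` is
zero, the integral itself vanishes. -/
theorem size_mul_integral_tr_le {cT : ℝ} (hT : TraceConst M n cT) (hcT : 0 < cT) {φ : E d → ℝ}
    (hφ : M.IsRat n φ) (i j : Fin M.num) {μ : Measure (E d)} (hμ : μ ≤ M.bd i) :
    M.size j * ∫ x, M.tr i φ x ^ 2 ∂μ ≤ cT * ∫ y in M.cell i, φ y ^ 2 := by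
  have : IsFiniteMeasure μ := isFiniteMeasure_of_le _ hμ
  have hI : 0 ≤ ∫ y in M.cell i, φ y ^ 2 := integral_nonneg fun _ => sq_nonneg _
  have hS : 0 ≤ (M.bd i).real univ := measureReal_nonneg
  rcases hS.eq_or_lt with h0 | h0
  · have h1 : M.bd i = 0 := by
      rw [eq_comm, measureReal_eq_zero_iff, Measure.measure_univ_eq_zero] at h0
      exact h0
    have h2 : μ = 0 := le_antisymm (h1 ▸ hμ) (Measure.zero_le μ)
    rw [h2, integral_zero_measure, mul_zero]
    positivity
  · have hint := integrable_tr_sq hφ.isReg hμ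
    have hmono : ∫ x, M.size j * (M.bd i).real univ * M.tr i φ x ^ 2 ∂μ
        ≤ ∫ _ : E d, cT * (∫ y in M.cell i, φ y ^ 2) ∂μ :=
      integral_mono_ae (hint.const_mul _) (integrable_const _)
        (hμ.absolutelyContinuous (M.ae_bd (hT φ hφ i j)))
    rw [integral_const_mul, integral_const, smul_eq_mul] at hmono
    have hμS : μ.real univ ≤ (M.bd i).real univ :=
      ENNReal.toReal_mono (measure_ne_top _ _) (hμ univ)
    refine le_of_mul_le_mul_left ?_ h0
    calc (M.bd i).real univ * (M.size j * ∫ x, M.tr i φ x ^ 2 ∂μ)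
        = M.size j * (M.bd i).real univ * ∫ x, M.tr i φ x ^ 2 ∂μ := by ring
      _ ≤ μ.real univ * (cT * ∫ y in M.cell i, φ y ^ 2) := hmono
      _ ≤ (M.bd i).real univ * (cT * ∫ y in M.cell i, φ y ^ 2) :=
        mul_le_mul_of_nonneg_right hμS (by positivity)

/-- `∑_{kl} ‖ε_{kl}(w)‖²` on the `i`-th element. -/
def strainSq (M : Mesh d S.Ω) (i : Fin M.num) (w : E d → E d) : ℝ :=
  ∑ k, ∑ l, ∫ x in M.cell i, strain w x k l ^ 2

/-- `‖∇q‖²` on the `i`-th element. -/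
def gradSq (M : Mesh d S.Ω) (i : Fin M.num) (q : E d → ℝ) : ℝ :=
  ∑ b, ∫ x in M.cell i, grad q x b ^ 2

theorem gradSq_nonneg (i : Fin M.num) (q : E d → ℝ) : 0 ≤ gradSq M i q :=
  Finset.sum_nonneg fun _ _ => integral_nonneg fun _ => sq_nonneg _

theorem strainSq_nonneg (i : Fin M.num) (w : E d → E d) : 0 ≤ strainSq M i w :=
  Finset.sum_nonneg fun _ _ => Finset.sum_nonneg fun _ _ => integral_nonneg fun _ => sq_nonneg _

theorem size_mul_strain_le {m : ℕ} {cT : ℝ} (hT : TraceConst M (m + d * d) cT) (hcT : 0 < cT)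
    {w : E d → E d} (hw : M.IsPWV m w) (i : Fin M.num) (Γ : Set (E d)) :
    Integrable (fun x => ∑ k, ∑ l, M.tr i (strain w) x k l ^ 2) (M.bdOn i Γ) ∧
    M.size i * ∫ x, (∑ k, ∑ l, M.tr i (strain w) x k l ^ 2) ∂M.bdOn i Γ ≤ cT * strainSq M i w := by
  have hae : ∀ k l, (fun x => M.tr i (fun y => strain w y k l) x ^ 2)
      =ᵐ[M.bdOn i Γ] fun x => M.tr i (strain w) x k l ^ 2 := fun k l =>
    M.ae_bdOn Γ fun x hx => congrArg (· ^ 2) (hw.tr_strain hx k l).symm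
  have hint : ∀ k l, Integrable (fun x => M.tr i (strain w) x k l ^ 2) (M.bdOn i Γ) := fun k l =>
    (integrable_tr_sq (hw.isReg_strain k l) (M.bdOn_le i Γ)).congr (hae k l)
  refine ⟨integrable_finsetSum _ fun k _ => integrable_finsetSum _ fun l _ => hint k l, ?_⟩
  rw [integral_finsetSum _ fun k _ => integrable_finsetSum _ fun l _ => hint k l, Finset.mul_sum,
    strainSq, Finset.mul_sum]
  refine Finset.sum_le_sum fun k _ => ?_
  rw [integral_finsetSum _ fun l _ => hint k l, Finset.mul_sum, Finset.mul_sum]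
  refine Finset.sum_le_sum fun l _ => ?_
  rw [← integral_congr_ae (hae k l)]
  exact size_mul_integral_tr_le hT hcT (hw.isRat_strain k l) i i (M.bdOn_le i Γ)

theorem size_mul_grad_le {m : ℕ} {cT : ℝ} (hT : TraceConst M (m + d * d) cT) (hcT : 0 < cT)
    {q : E d → ℝ} (hq : M.IsPW m q) (i j : Fin M.num) {μ : Measure (E d)} (hμ : μ ≤ M.bd i) :
    Integrable (fun x => ∑ b, M.tr i (grad q) x b ^ 2) μ ∧
    M.size j * ∫ x, (∑ b, M.tr i (grad q) x b ^ 2) ∂μ ≤ cT * gradSq M i q := by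
  have hae : ∀ b, (fun x => M.tr i (fun y => grad q y b) x ^ 2)
      =ᵐ[μ] fun x => M.tr i (grad q) x b ^ 2 := fun b =>
    hμ.absolutelyContinuous (M.ae_bd fun x hx => congrArg (· ^ 2) (hq.tr_grad hx b).symm)
  have hint : ∀ b, Integrable (fun x => M.tr i (grad q) x b ^ 2) μ := fun b =>
    (integrable_tr_sq (hq.isReg_grad b) hμ).congr (hae b)
  refine ⟨integrable_finsetSum _ fun b _ => hint b, ?_⟩
  rw [integral_finsetSum _ fun b _ => hint b, Finset.mul_sum, gradSq, Finset.mul_sum]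
  refine Finset.sum_le_sum fun b _ => ?_
  rw [← integral_congr_ae (hae b)]
  exact size_mul_integral_tr_le hT hcT (hq.isRat_grad b) i j hμ

variable {m : ℕ} {cT η g : ℝ}

/-- Young's inequality with weight `η |K|` fits both sides: `|K|` times the squared stress trace is
controlled by the trace inequality, and the reciprocal weight matches the penalty `g / |K|` once `g
≥ absC C / η`. -/
theorem penV_sub_stressB_ge (hT : TraceConst M (m + d * d) cT) (hcT : 0 < cT) (hη : 0 < η)
    (hg : absC S.C / η ≤ g) (hsize : ∀ i, 0 < M.size i) (Γ : Set (E d)) {w : E d → E d}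
    (hw : M.IsPWV m w) (hwΓ : L2V M Γ w) :
    -(absC S.C * η * cT * ∑ i, strainSq M i w) ≤ penV M g Γ w w - 2 * stressB S M Γ w w := by
  rw [penV, stressB, Mesh.bInt_eq, Mesh.bInt_eq, Finset.mul_sum, Finset.mul_sum,
    ← Finset.sum_neg_distrib, ← Finset.sum_sub_distrib]
  refine Finset.sum_le_sum fun i _ => ?_
  have hs := hsize i
  obtain ⟨hi, hle⟩ := size_mul_strain_le hT hcT hw i Γ
  have hp := (integrable_dotE hwΓ hwΓ i).const_mul (g / M.size i)
  have hst := (integrable_stress (S := S) hw hwΓ i).const_mul 2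
  rw [← integral_const_mul 2, ← integral_sub hp hst]
  have hmono : ∫ x, -(absC S.C * η * M.size i) * ∑ k, ∑ l, M.tr i (strain w) x k l ^ 2 ∂M.bdOn i Γ
      ≤ ∫ x, (g / M.size i * dotE (w x) (w x)
        - 2 * matDot (applyC S.C (M.tr i (strain w) x)) (M.normal i x) (w x)) ∂M.bdOn i Γ := by
    refine integral_mono (hi.const_mul _) (hp.sub hst) fun x => ?_
    have hy := matDot_young S.C (M.tr i (strain w) x) (M.norm_normal_le i x) (w x)
      (mul_pos hη hs)
    have hd : 0 ≤ dotE (w x) (w x) := Finset.sum_nonneg fun _ _ => mul_self_nonneg _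
    have h1 : absC S.C * (dotE (w x) (w x) / (η * M.size i)) ≤ g / M.size i * dotE (w x) (w x) := by
      have e : absC S.C * (dotE (w x) (w x) / (η * M.size i))
          = absC S.C / η / M.size i * dotE (w x) (w x) := by
        field_simp
      rw [e]
      gcongr
    simp only
    linarith
  rw [integral_const_mul] at hmono
  refine le_trans ?_ hmono
  have := mul_le_mul_of_nonneg_left hle (mul_nonneg (absC_nonneg S.C) hη.le)
  linarith

theorem penQ_sub_fluxB_ge (hT : TraceConst M (m + d * d) cT) (hcT : 0 < cT) (hη : 0 < η)
    (hg : absK S.Kp / η ≤ g) (hsize : ∀ i, 0 < M.size i) (Γ : Set (E d)) {q : E d → ℝ}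
    {J : Fin M.num → E d → ℝ} (hq : M.IsPW m q) (hJ : L2Q M Γ J) :
    -(absK S.Kp * η * cT * ∑ i, gradSq M i q) ≤ penQ M g Γ J J - 2 * fluxB S M Γ q J := by
  rw [penQ, fluxB, Mesh.bInt_eq, Mesh.bInt_eq, Finset.mul_sum, Finset.mul_sum,
    ← Finset.sum_neg_distrib, ← Finset.sum_sub_distrib]
  refine Finset.sum_le_sum fun i _ => ?_
  have hs := hsize i
  obtain ⟨hi, hle⟩ := size_mul_grad_le hT hcT hq i i (M.bdOn_le i Γ)
  have hp := (integrable_penQ hJ hJ i).const_mul (g / M.size i)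
  have hst := (integrable_fluxB (S := S) hq hJ i).const_mul 2
  rw [← integral_const_mul 2, ← integral_sub hp hst]
  have hmono : ∫ x, -(absK S.Kp * η * M.size i) * ∑ b, M.tr i (grad q) x b ^ 2 ∂M.bdOn i Γ
      ≤ ∫ x, (g / M.size i * (J i x * J i x)
        - 2 * (J i x * flux S.Kp (M.tr i (grad q) x) (M.normal i x))) ∂M.bdOn i Γ := by
    refine integral_mono (hi.const_mul _) (hp.sub hst) fun x => ?_
    have hy := flux_young S.Kp (M.tr i (grad q) x) (M.norm_normal_le i x) (J i x)
      (mul_pos hη hs)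
    have h1 : absK S.Kp * (J i x ^ 2 / (η * M.size i)) ≤ g / M.size i * (J i x * J i x) := by
      have e : absK S.Kp * (J i x ^ 2 / (η * M.size i))
          = absK S.Kp / η / M.size i * (J i x * J i x) := by
        field_simp
      rw [e]
      have : 0 ≤ J i x * J i x := mul_self_nonneg _
      gcongr
    simp only
    linarith
  rw [integral_const_mul] at hmono
  refine le_trans ?_ hmono
  have := mul_le_mul_of_nonneg_left hle (mul_nonneg (absK_nonneg S.Kp) hη.le)
  linarith

/-- The weight is now `η` times the mean size of the two elements. Traces from each side must
therefore be bounded with the size of either element, which is why the trace inequality allows an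
arbitrary second index. -/
theorem face_ge (hT : TraceConst M (m + d * d) cT) (hcT : 0 < cT) (hη : 0 < η)
    (hg : absK S.Kp / η ≤ g) (hsize : ∀ i, 0 < M.size i) {q : E d → ℝ} (hq : M.IsPW m q)
    (i j : Fin M.num) :
    -(absK S.Kp * η * cT / 2 * (gradSq M i q + gradSq M j q)) ≤
      ∫ x, (g / ((M.size i + M.size j) / 2) * (jump S M i j q x * jump S M i j q x)
        - 2 * (avgFlux S M i j q x * jump S M i j q x)) ∂M.bdOn i (frontier (M.cell j)) := by
  set μ := M.bdOn i (frontier (M.cell j)) with hμ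
  set s := (M.size i + M.size j) / 2 with hs
  have hs0 : 0 < s := by have := hsize i; have := hsize j; positivity
  obtain ⟨hi, hii⟩ := size_mul_grad_le hT hcT hq i i (M.bdOn_le i (frontier (M.cell j)))
  obtain ⟨-, hij⟩ := size_mul_grad_le hT hcT hq i j (M.bdOn_le i (frontier (M.cell j)))
  obtain ⟨hj, hjj⟩ := size_mul_grad_le hT hcT hq j j (M.bdOn_frontier_le i j)
  obtain ⟨-, hji⟩ := size_mul_grad_le hT hcT hq j i (M.bdOn_frontier_le i j)
  have hp := (integrable_facePen (S := S) hq.isReg hq.isReg i j).const_mul (g / s)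
  have hst := (integrable_faceFlux (S := S) hq hq.isReg i j).const_mul 2
  have hmono : ∫ x, -(absK S.Kp * η * s / 2) * (∑ b, M.tr i (grad q) x b ^ 2
        + ∑ b, M.tr j (grad q) x b ^ 2) ∂μ
      ≤ ∫ x, (g / s * (jump S M i j q x * jump S M i j q x)
        - 2 * (avgFlux S M i j q x * jump S M i j q x)) ∂μ := by
    refine integral_mono ((hi.add hj).const_mul _) (hp.sub hst) fun x => ?_
    set J := jump S M i j q x with hJ
    have hy := flux_young S.Kp ((1 / 2 : ℝ) • (M.tr i (grad q) x + M.tr j (grad q) x))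
      (M.norm_normal_le i x) J (mul_pos hη hs0)
    have h1 : absK S.Kp * (J ^ 2 / (η * s)) ≤ g / s * (J * J) := by
      have e : absK S.Kp * (J ^ 2 / (η * s)) = absK S.Kp / η / s * (J * J) := by
        field_simp
      rw [e]
      have : 0 ≤ J * J := mul_self_nonneg _
      gcongr
    -- Convexity of the square separates the average into the two one-sided traces.
    have h2 : ∑ b, ((1 / 2 : ℝ) • (M.tr i (grad q) x + M.tr j (grad q) x)) b ^ 2
        ≤ 1 / 2 * (∑ b, M.tr i (grad q) x b ^ 2 + ∑ b, M.tr j (grad q) x b ^ 2) := by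
      rw [← Finset.sum_add_distrib, Finset.mul_sum]
      refine Finset.sum_le_sum fun b _ => ?_
      simp only [Pi.smul_apply, Pi.add_apply, smul_eq_mul]
      nlinarith [sq_nonneg (M.tr i (grad q) x b - M.tr j (grad q) x b)]
    have h3 := mul_le_mul_of_nonneg_left h2
      (mul_nonneg (mul_nonneg (absK_nonneg S.Kp) hη.le) hs0.le)
    simp only [avgFlux]
    linarith
  rw [integral_const_mul, integral_add hi hj] at hmono
  refine le_trans ?_ hmono
  -- Half the sum of the four trace estimates, for both sides and both sizes.
  have h4 : s * (∫ x, (∑ b, M.tr i (grad q) x b ^ 2) ∂μ + ∫ x, (∑ b, M.tr j (grad q) x b ^ 2) ∂μ)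
      ≤ cT * (gradSq M i q + gradSq M j q) := by
    rw [hs]
    linarith
  have := mul_le_mul_of_nonneg_left h4
    (div_nonneg (mul_nonneg (absK_nonneg S.Kp) hη.le) zero_le_two)
  linarith

/-- The face sum runs over all pairs of elements, but only touching pairs contribute, so each
element's gradient is counted at most `N` times from either position in a pair. Without this count
the constant would depend on the number of elements. -/
theorem facePen_sub_faceFlux_ge (hT : TraceConst M (m + d * d) cT) (hcT : 0 < cT) (hη : 0 < η)
    (hg : absK S.Kp / η ≤ g) (hsize : ∀ i, 0 < M.size i) {N : ℝ}
    (hN : ∀ (i : Fin M.num) (s : Finset (Fin M.num)),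
      (∀ j ∈ s, (frontier (M.cell i) ∩ frontier (M.cell j)).Nonempty) → (s.card : ℝ) ≤ N)
    {q : E d → ℝ} (hq : M.IsPW m q) :
    -(absK S.Kp * η * cT * N * ∑ i, gradSq M i q) ≤
      facePen S M g q q - 2 * faceFlux S M q q := by
  classical
  set κ := absK S.Kp * η * cT with hκ
  have hκ0 : 0 ≤ κ := mul_nonneg (mul_nonneg (absK_nonneg S.Kp) hη.le) hcT.le
  set nb : Fin M.num → Fin M.num → ℝ := fun i j =>
    if (frontier (M.cell i) ∩ frontier (M.cell j)).Nonempty then 1 else 0 with hnb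
  have hnb0 : ∀ i j, 0 ≤ nb i j := fun i j => by
    simp only [hnb]
    split_ifs <;> norm_num
  have hnbs : ∀ i j, nb i j = nb j i := fun i j => by simp only [hnb, inter_comm]
  have hG := fun i => gradSq_nonneg (M := M) i q
  have hpair : ∀ i j, -(κ / 2 * (nb i j * (gradSq M i q + gradSq M j q))) ≤
      ∫ x, (g / ((M.size i + M.size j) / 2) * (jump S M i j q x * jump S M i j q x)
        - 2 * (avgFlux S M i j q x * jump S M i j q x)) ∂M.bdOn i (frontier (M.cell j)) := by
    intro i j
    by_cases h : (frontier (M.cell i) ∩ frontier (M.cell j)).Nonempty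
    · have := face_ge hT hcT hη hg hsize hq i j
      simpa only [hnb, if_pos h, one_mul] using this
    · have h0 : M.bdOn i (frontier (M.cell j)) = 0 := by
        rw [Mesh.bdOn, not_nonempty_iff_eq_empty.1 h, Measure.restrict_empty]
      rw [h0, integral_zero_measure]
      simp only [hnb, if_neg h, zero_mul, mul_zero, neg_zero, le_refl]
  have hcard : ∀ i, ∑ j, nb i j ≤ N := fun i => by
    have := hN i (Finset.univ.filter fun j =>
      (frontier (M.cell i) ∩ frontier (M.cell j)).Nonempty) fun j hj => (Finset.mem_filter.1 hj).2
    simpa only [hnb, Finset.sum_boole] using this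
  -- Enlarging the sum to all ordered pairs makes it symmetric, so the two gradient terms contribute
  -- equally; hence the factor `2`, matched by `κ / 2` in the pair estimate.
  have hsum : ∑ i, ∑ j ∈ Finset.Ioi i, nb i j * (gradSq M i q + gradSq M j q)
      ≤ 2 * (N * ∑ i, gradSq M i q) := by
    have h1 : ∑ i, ∑ j ∈ Finset.Ioi i, nb i j * (gradSq M i q + gradSq M j q)
        ≤ ∑ i, ∑ j, nb i j * (gradSq M i q + gradSq M j q) :=
      Finset.sum_le_sum fun i _ => Finset.sum_le_sum_of_subset_of_nonneg (Finset.subset_univ _)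
        fun j _ _ => mul_nonneg (hnb0 i j) (add_nonneg (hG i) (hG j))
    have h2 : ∑ i, ∑ j, nb i j * gradSq M j q = ∑ i, ∑ j, nb i j * gradSq M i q := by
      rw [Finset.sum_comm]
      exact Finset.sum_congr rfl fun i _ => Finset.sum_congr rfl fun j _ => by rw [hnbs]
    have h3 : ∑ i, ∑ j, nb i j * gradSq M i q ≤ N * ∑ i, gradSq M i q := by
      rw [Finset.mul_sum]
      refine Finset.sum_le_sum fun i _ => ?_
      rw [← Finset.sum_mul]
      exact mul_le_mul_of_nonneg_right (hcard i) (hG i)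
    refine h1.trans ?_
    simp only [mul_add, Finset.sum_add_distrib]
    rw [h2]
    linarith
  have heq : facePen S M g q q - 2 * faceFlux S M q q = ∑ i, ∑ j ∈ Finset.Ioi i,
      ∫ x, (g / ((M.size i + M.size j) / 2) * (jump S M i j q x * jump S M i j q x)
        - 2 * (avgFlux S M i j q x * jump S M i j q x)) ∂M.bdOn i (frontier (M.cell j)) := by
    simp only [facePen, faceFlux, faceInt_eq, Finset.mul_sum, ← Finset.sum_sub_distrib]
    refine Finset.sum_congr rfl fun i _ => Finset.sum_congr rfl fun j _ => ?_
    rw [integral_sub ((integrable_facePen (S := S) hq.isReg hq.isReg i j).const_mul _)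
      ((integrable_faceFlux (S := S) hq hq.isReg i j).const_mul 2), integral_const_mul 2]
  rw [heq]
  refine le_trans ?_ (Finset.sum_le_sum fun i _ => Finset.sum_le_sum fun j _ => hpair i j)
  simp only [Finset.sum_neg_distrib, ← Finset.mul_sum]
  have := mul_le_mul_of_nonneg_left hsum (div_nonneg hκ0 zero_le_two)
  linarith

theorem elast_ge {w : E d → E d} (hw : M.IsPWV m w) {k₀ : ℝ}
    (hk : ∀ ξ : Matrix (Fin d) (Fin d) ℝ, ξ.IsSymm →
      k₀ * ∑ i, ∑ j, ξ i j ^ 2 ≤ ∑ i, ∑ j, ∑ k, ∑ l, ξ i j * S.C i j k l * ξ k l) :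
    k₀ * ∑ i, strainSq M i w ≤ elast S w w := by
  have hsq : ∀ k l, M.IsReg fun x => strain w x k l ^ 2 := fun k l => by
    simpa only [sq] using (hw.isReg_strain k l).mul (hw.isReg_strain k l)
  have hreg : M.IsReg fun x => ∑ k, ∑ l, strain w x k l ^ 2 :=
    Mesh.isReg_sum _ fun k _ => Mesh.isReg_sum _ fun l _ => hsq k l
  have h1 : ∑ i, strainSq M i w = ∫ x in S.Ω, ∑ k, ∑ l, strain w x k l ^ 2 := by
    rw [hreg.integral_eq_sum S.volume_lt_top]
    refine Finset.sum_congr rfl fun i _ => ?_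
    have hi := fun k l => (hsq k l).integrable_cell S.volume_lt_top i
    rw [integral_finsetSum _ fun k _ => integrable_finsetSum _ fun l _ => hi k l]
    exact Finset.sum_congr rfl fun k _ => (integral_finsetSum _ fun l _ => hi k l).symm
  rw [h1, ← integral_const_mul]
  refine integral_mono ((hreg.integrable S.volume_lt_top).const_mul _)
    ((isReg_elast hw hw).integrable S.volume_lt_top) fun x => ?_
  have hsymm : (strain w x).IsSymm := by
    refine Matrix.IsSymm.ext fun a b => ?_
    simp only [Mesh.strain_apply]
    ring
  refine (hk _ hsymm).trans (le_of_eq ?_)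
  simp only [applyC, Finset.sum_mul]
  exact Finset.sum_congr rfl fun a _ => Finset.sum_congr rfl fun b _ =>
    Finset.sum_congr rfl fun k _ => Finset.sum_congr rfl fun l _ => by ring

theorem diffn_ge {q : E d → ℝ} (hq : M.IsPW m q) {k₁ : ℝ}
    (hk : ∀ ξ : Fin d → ℝ, k₁ * ∑ i, ξ i ^ 2 ≤ ∑ i, ∑ j, ξ i * S.Kp i j * ξ j) :
    k₁ * ∑ i, gradSq M i q ≤ diffn S q q := by
  have hsq : ∀ b, M.IsReg fun x => grad q x b ^ 2 := fun b => by
    simpa only [sq] using (hq.isReg_grad b).mul (hq.isReg_grad b)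
  have hreg : M.IsReg fun x => ∑ b, grad q x b ^ 2 := Mesh.isReg_sum _ fun b _ => hsq b
  have h1 : ∑ i, gradSq M i q = ∫ x in S.Ω, ∑ b, grad q x b ^ 2 := by
    rw [hreg.integral_eq_sum S.volume_lt_top]
    exact Finset.sum_congr rfl fun i _ =>
      (integral_finsetSum _ fun b _ => (hsq b).integrable_cell S.volume_lt_top i).symm
  rw [h1, ← integral_const_mul]
  refine integral_mono ((hreg.integrable S.volume_lt_top).const_mul _)
    ((isReg_diffn hq hq).integrable S.volume_lt_top) fun x => ?_
  refine (hk _).trans (le_of_eq ?_)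
  exact Finset.sum_congr rfl fun a _ => Finset.sum_congr rfl fun b _ => by ring

end Trace

/-- Both forms are positive semidefinite for sufficiently large penalty parameters. -/
theorem exists_penalty (S : Setting d) (r : ℕ) (σ : ℝ) : ∃ γ₀ : ℝ, ∀ M : Mesh d S.Ω,
    M.QuasiUniform σ → ∀ c : Params, γ₀ ≤ c.γa → γ₀ ≤ c.γb → γ₀ ≤ c.γ →
      (∀ w ∈ Vh M r, 0 ≤ formA S M c w w) ∧
      ∀ kind, ∀ q ∈ Qh M r kind, 0 ≤ formB S M c kind q q := by
  obtain ⟨cT, hcT, hT⟩ := Mesh.exists_trace_le (Ω := S.Ω) S.volume_lt_top σ (deg d r + d * d)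
  obtain ⟨k₀, hk₀, hC⟩ := S.C_pos
  obtain ⟨k₁, hk₁, hK⟩ := S.Kp_pos
  -- The bound for the number of touching elements; the absolute value keeps it nonnegative for
  -- every real `σ`.
  set N : ℝ := |(2 * σ * Metric.diam (refCube d)) ^ d * volume.real (Metric.ball (0 : E d) 1) * σ
      / Mesh.refVol d| with hN
  have hN0 : 0 ≤ N := abs_nonneg _
  have hκC := absC_nonneg S.C
  have hκK := absK_nonneg S.Kp
  -- The Young weights are chosen so that the absorbed volume terms do not exceed `k₀` and `k₁`. In
  -- `N + 1` the summand `N` stands for interior faces and `1` for boundary faces. The `+ 1` in each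
  -- denominator avoids division by zero.
  set η₁ : ℝ := k₀ / (absC S.C * cT + 1) with hη₁
  set η₂ : ℝ := k₁ / (absK S.Kp * cT * (N + 1) + 1) with hη₂
  have hη₁0 : 0 < η₁ := by positivity
  have hη₂0 : 0 < η₂ := by positivity
  have hle₁ : absC S.C * η₁ * cT ≤ k₀ := by
    have : absC S.C * η₁ * cT = k₀ * ((absC S.C * cT) / (absC S.C * cT + 1)) := by
      rw [hη₁]; ring
    rw [this]
    exact mul_le_of_le_one_right hk₀.le ((div_le_one (by positivity)).2 (by linarith))
  have hle₂ : absK S.Kp * η₂ * cT * (N + 1) ≤ k₁ := by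
    have : absK S.Kp * η₂ * cT * (N + 1)
        = k₁ * ((absK S.Kp * cT * (N + 1)) / (absK S.Kp * cT * (N + 1) + 1)) := by
      rw [hη₂]; ring
    rw [this]
    exact mul_le_of_le_one_right hk₁.le ((div_le_one (by positivity)).2 (by linarith))
  -- The penalties must dominate the reciprocal Young weights; nothing here depends on the mesh
  -- beyond `σ`.
  refine ⟨max (absC S.C / η₁) (absK S.Kp / η₂), fun M hM c ha hb hg => ?_⟩
  obtain ⟨h, H⟩ := hM.exists_qu
  have hTM : TraceConst M (deg d r + d * d) cT := hT M hM
  refine ⟨fun w hw => ?_, fun kind q hq => ?_⟩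
  · have p := isPWV_of_mem hw
    have h1 := penV_sub_stressB_ge hTM hcT hη₁0 ((le_max_left _ _).trans ha) H.size_pos S.ΓuD p
      (L2V_of_continuousOn hw.2.1)
    have h2 := elast_ge (M := M) p hC
    have h3 : 0 ≤ ∑ i, strainSq M i w := Finset.sum_nonneg fun i _ => strainSq_nonneg i w
    have h4 := mul_le_mul_of_nonneg_right hle₁ h3
    rw [formA_eq]
    linarith
  · have p := isPW_of_mem hq
    have h2 := diffn_ge (M := M) p hK
    have h3 : 0 ≤ ∑ i, gradSq M i q := Finset.sum_nonneg fun i _ => gradSq_nonneg i q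
    have h4 := mul_le_mul_of_nonneg_right hle₂ h3
    have h6 : 0 ≤ absK S.Kp * η₂ * cT * N * ∑ i, gradSq M i q := by positivity
    cases kind
    · have h1 := penQ_sub_fluxB_ge hTM hcT hη₂0 ((le_max_right _ _).trans hb) H.size_pos S.ΓpD p
        (L2Q_of_continuousOn hq.2.2.1)
      rw [formB_cont_eq]
      linarith
    · have h1 := penQ_sub_fluxB_ge hTM hcT hη₂0 ((le_max_right _ _).trans hg) H.size_pos
        (frontier S.Ω) p (L2Q_tr p.isReg)
      have h5 := facePen_sub_faceFlux_ge hTM hcT hη₂0 ((le_max_right _ _).trans hg) H.size_pos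
        (fun i s hs => (H.card_neighbours_le i s hs).trans (le_abs_self _)) p
      rw [formB_disc_eq c p p]
      linarith

end Biot

end

noncomputable section

namespace Biot

variable {d : ℕ}

/-! ### Polynomials in time with values in a finite element space -/

section Time

variable {F : Type} [NormedAddCommGroup F] [NormedSpace ℝ F] {k : ℕ} {a b : ℝ}
  {B : Submodule ℝ (E d → F)}

/-- The element of `ℙ_k(I; B)`, `I = (a, b]`, with coefficients `W`. -/
def polyT (a b : ℝ) (W : Fin (k + 1) → B) : ℝ → E d → F :=
  (Ioc a b).indicator fun t => (pe t W : B).1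

theorem polyT_of_mem (W : Fin (k + 1) → B) {t : ℝ} (ht : t ∈ Ioc a b) :
    polyT a b W t = (pe t W : B).1 := indicator_of_mem ht _

theorem coe_pe (W : Fin (k + 1) → B) (t : ℝ) :
    (pe t W : B).1 = ∑ j : Fin (k + 1), (t ^ (j : ℕ)) • (W j).1 := by
  simp [pe_apply]

theorem coe_pe_apply (W : Fin (k + 1) → B) (t : ℝ) (x : E d) :
    (pe t W : B).1 x = ∑ j : Fin (k + 1), (t ^ (j : ℕ)) • (W j).1 x := by
  simp [pe_apply]

theorem coe_pd_apply (W : Fin (k + 1) → B) (t : ℝ) (x : E d) :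
    (pd t W : B).1 x = ∑ j : Fin (k + 1), ((j : ℕ) * t ^ ((j : ℕ) - 1)) • (W j).1 x := by
  simp [pd_apply]

theorem polyT_mem (W : Fin (k + 1) → B) : polyT a b W ∈ PolyT k a b (B : Set (E d → F)) :=
  ⟨⟨fun j => (W j).1, fun j => (W j).2, fun t ht => by rw [polyT_of_mem W ht, coe_pe]⟩,
    fun _ ht => indicator_of_notMem ht _⟩

theorem exists_polyT_eq {w : ℝ → E d → F} (hw : w ∈ PolyT k a b (B : Set (E d → F))) :
    ∃ W : Fin (k + 1) → B, polyT a b W = w := by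
  obtain ⟨⟨W, hW, h⟩, h0⟩ := hw
  refine ⟨fun j => ⟨W j, hW j⟩, funext fun t => ?_⟩
  by_cases ht : t ∈ Ioc a b
  · rw [polyT_of_mem _ ht, coe_pe, h t ht]
  · rw [h0 t ht]
    exact indicator_of_notMem ht _

/-- At the right end point the derivative within the interval is one-sided. It is still unique and
equals that of the polynomial. -/
theorem dt_polyT (W : Fin (k + 1) → B) {t : ℝ} (ht : t ∈ Ioc a b) :
    dt a b (polyT a b W) t = (pd t W : B).1 := by
  ext1 x
  have h : HasDerivAt (fun s => (pe s W : B).1 x) ((pd t W : B).1 x) t := by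
    simp only [coe_pe_apply, coe_pd_apply]
    exact HasDerivAt.fun_sum fun j _ => (hasDerivAt_pow (j : ℕ) t).smul_const _
  have hu : UniqueDiffWithinAt ℝ (Ioc a b) t :=
    uniqueDiffOn_Ioc a b t ht
  refine (h.hasDerivWithinAt.congr_of_mem (fun s hs => ?_) ht).derivWithin hu
  rw [polyT_of_mem W hs]

/-- The function itself is zero at `a` by convention; its right-sided limit is the value of the
extended polynomial. -/
theorem plus_polyT (hab : a < b) (W : Fin (k + 1) → B) :
    plus (polyT a b W) a = (pe a W : B).1 := by
  ext1 x
  have hc : Continuous fun s => (pe s W : B).1 x := by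
    simp only [coe_pe_apply]
    fun_prop
  refine rightLim_eq_of_tendsto (((hc.tendsto a).mono_left nhdsWithin_le_nhds).congr' ?_)
  filter_upwards [Ioc_mem_nhdsGT hab] with s hs
  rw [polyT_of_mem W hs]

end Time

/-! ### The right-hand sides as linear functionals -/

section Functionals

variable {S : Setting d} {M : Mesh d S.Ω} {r : ℕ} {kind : PressureKind} (c : Params)

/-- A quadrature formula applied to a family of functionals, evaluated at polynomials. -/
def quadDual {V : Type*} [AddCommGroup V] [Module ℝ V] {k : ℕ} (R : GaussRadau k) (a b : ℝ)
    (ℓ : ℝ → V →ₗ[ℝ] ℝ) : (Fin (k + 1) → V) →ₗ[ℝ] ℝ where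
  toFun X := R.quad a b fun t => ℓ t (pe t X)
  map_add' X Y := by simp only [map_add, quad_add]
  map_smul' s X := by simp only [map_smul, smul_eq_mul, quad_const_mul, RingHom.id_apply]

/-- `F_γ` at time `t`, as a functional on `V_h`. -/
def dualF (M : Mesh d S.Ω) (r : ℕ) (D : Data S kind) (t : ℝ) : VhS M r →ₗ[ℝ] ℝ where
  toFun χ := rhsF S M c D t χ.1
  map_add' χ χ' := by
    have hu := L2V_Lp (M := M) (D.uD t)
    have e1 := map_add (D.f t) (fun x : S.Ω => χ.1 x) fun x => χ'.1 x
    have e2 := map_add (D.tN t) (fun x : S.ΓuN => χ.1 x) fun x => χ'.1 x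
    have e3 := stressB_add_left (S := S) (isPWV_of_mem χ.2) (isPWV_of_mem χ'.2) hu
    have e4 := penV_add_left c.γa (L2V_of_continuousOn χ.2.2.1) (L2V_of_continuousOn χ'.2.2.1) hu
    simp only [rhsF, aN_eq, penV_comm _ (D.uD t)]
    exact (congrArg₂ (· + ·) (congrArg₂ (· - ·) e1 e2)
      (congrArg₂ (fun p q => -p + q) e3 e4)).trans (by ring)
  map_smul' s χ := by
    have e1 := map_smul (D.f t) s fun x : S.Ω => χ.1 x
    have e2 := map_smul (D.tN t) s fun x : S.ΓuN => χ.1 x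
    have e3 := stressB_smul_left (S := S) (Γ := S.ΓuD) s (isPWV_of_mem χ.2) (D.uD t)
    have e4 := penV_smul_left (S := S) (M := M) (Γ := S.ΓuD) c.γa s χ.1 (D.uD t)
    simp only [rhsF, aN_eq, penV_comm _ (D.uD t)]
    exact (congrArg₂ (· + ·) (congrArg₂ (· - ·) e1 e2)
      (congrArg₂ (fun p q => -p + q) e3 e4)).trans
        (by simp only [smul_eq_mul, RingHom.id_apply]; ring)

/-- `⟨w · n, ·⟩` on `Γ_u^D`, as a functional on `Q_h`. -/
def dualN (M : Mesh d S.Ω) (r : ℕ) (kind : PressureKind) (w : Lp (E d) 2 ((surf d).restrict S.ΓuD)) :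
    QhS M r kind →ₗ[ℝ] ℝ where
  toFun ψ := bdryN S M w ψ.1
  map_add' ψ ψ' := bdryN_add_right (L2V_Lp w) (isPW_of_mem ψ.2).isReg (isPW_of_mem ψ'.2).isReg
  map_smul' s ψ := bdryN_smul_right s w (isPW_of_mem ψ.2).isReg

/-- `⟨q, K ∇ψ · n⟩` on `Γ`, as a functional of `ψ ∈ Q_h`. -/
def dualFlux (M : Mesh d S.Ω) (r : ℕ) (kind : PressureKind) {Γ : Set (E d)}
    (q : Lp ℝ 2 ((surf d).restrict Γ)) : QhS M r kind →ₗ[ℝ] ℝ where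
  toFun ψ := fluxB S M Γ ψ.1 fun _ => q
  map_add' ψ ψ' := fluxB_add_left (isPW_of_mem ψ.2) (isPW_of_mem ψ'.2) (L2Q_Lp q)
  map_smul' s ψ := fluxB_smul_left s (isPW_of_mem ψ.2) _

/-- `γ / h_F ⟨q, ψ⟩` on `Γ`, as a functional of `ψ ∈ Q_h^cont`. -/
def dualPen (M : Mesh d S.Ω) (r : ℕ) (g : ℝ) {Γ : Set (E d)}
    (q : Lp ℝ 2 ((surf d).restrict Γ)) : QhS M r .cont →ₗ[ℝ] ℝ where
  toFun ψ := penQ M g Γ (fun _ => ψ.1) fun _ => q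
  map_add' ψ ψ' := penQ_add_left g (L2Q_of_continuousOn ψ.2.2.2.1) (L2Q_of_continuousOn ψ'.2.2.2.1)
    (L2Q_Lp q)
  map_smul' s _ := penQ_smul_left g s _ _

/-- `γ / h_F ⟨q, ψ⟩` on `Γ`, with the traces of `ψ`, as a functional of `ψ ∈ Q_h`. -/
def dualPenTr (M : Mesh d S.Ω) (r : ℕ) (kind : PressureKind) (g : ℝ) {Γ : Set (E d)}
    (q : Lp ℝ 2 ((surf d).restrict Γ)) : QhS M r kind →ₗ[ℝ] ℝ where
  toFun ψ := penQ M g Γ (fun i => M.tr i ψ.1) fun _ => q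
  map_add' ψ ψ' := by
    have p := (isPW_of_mem ψ.2).isReg
    have p' := (isPW_of_mem ψ'.2).isReg
    rw [← penQ_add_left g (L2Q_tr p) (L2Q_tr p') (L2Q_Lp q)]
    exact penQ_congr fun i x hx => p.tr_add p' hx
  map_smul' s ψ := by
    have p := (isPW_of_mem ψ.2).isReg
    refine Eq.trans ?_ (penQ_smul_left g s _ _)
    exact penQ_congr fun i x hx => p.tr_const_mul s hx

/-- `⟨q, ψ⟩` on `Γ`, as a functional of `ψ ∈ Q_h`. -/
def dualTr (M : Mesh d S.Ω) (r : ℕ) (kind : PressureKind) {Γ : Set (E d)}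
    (q : Lp ℝ 2 ((surf d).restrict Γ)) : QhS M r kind →ₗ[ℝ] ℝ where
  toFun ψ := M.bInt Γ fun i x => q x * M.tr i ψ.1 x
  map_add' ψ ψ' := by
    have p := (isPW_of_mem ψ.2).isReg
    have p' := (isPW_of_mem ψ'.2).isReg
    rw [← Mesh.bInt_add (integrable_penQ (L2Q_Lp q) (L2Q_tr p))
      (integrable_penQ (L2Q_Lp q) (L2Q_tr p'))]
    exact Mesh.bInt_congr fun i x hx =>
      (congrArg (q x * ·) (p.tr_add p' hx)).trans (mul_add _ _ _)
  map_smul' s ψ := by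
    have p := (isPW_of_mem ψ.2).isReg
    refine Eq.trans ?_ (Mesh.bInt_const_mul Γ s _)
    exact Mesh.bInt_congr fun i x hx =>
      (congrArg (q x * ·) (p.tr_const_mul s hx)).trans (mul_left_comm _ _ _)

/-- Continuous and discontinuous pressures have different right-hand sides, assembled separately
from linear pieces; the abstract system needs only their linearity. -/
theorem exists_dualG (M : Mesh d S.Ω) (r : ℕ) (T : ℝ) (D : Data S kind) (t : ℝ) :
    ∃ ℓ : QhS M r kind →ₗ[ℝ] ℝ, ∀ ψ, ℓ ψ = rhsG S M c T kind D t ψ.1 := by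
  let res : ∀ A : Set (E d), QhS M r kind →ₗ[ℝ] (A → ℝ) := fun A =>
    LinearMap.funLeft ℝ ℝ Subtype.val ∘ₗ (QhS M r kind).subtype
  cases kind
  · refine ⟨D.g t ∘ₗ res S.Ω - c.α • dualN M r .cont (D.vD T t) - (D.pN t).toDual ∘ₗ res S.ΓpN
      + (-dualFlux M r .cont (D.pD t) + dualPen M r c.γb (D.pD t)), fun _ => ?_⟩
    simp only [rhsG, bN_eq, penQ_comm _ fun _ => D.pD t]
    rfl
  · refine ⟨D.g t ∘ₗ res S.Ω - c.α • dualN M r .disc (D.vD T t) - dualFlux M r .disc (D.pD t)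
      + dualPenTr M r .disc c.γ (D.pD t) - dualTr M r .disc (D.pN t).toLp, fun ψ => ?_⟩
    have e := penQ_comm (M := M) (Γ := S.ΓpD) c.γ (fun i => M.tr i ψ.1) fun _ => D.pD t
    exact congrArg (fun z => _ + z - _) e

theorem ipQ_add_dvg_left {p ψ : E d → ℝ} {u : E d → E d} (hp : p ∈ Qh M r kind) (hu : u ∈ Vh M r)
    (hψ : ψ ∈ Qh M r kind) :
    ipQ S.Ω (fun x => c.c₀ * p x + c.α * dvg u x) ψ
      = c.c₀ * ipQ S.Ω p ψ + c.α * ipQ S.Ω (dvg u) ψ := by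
  rw [ipQ_add_left S.volume_lt_top ((isPW_of_mem hp).isReg.const_mul _)
    ((isPWV_of_mem hu).isReg_dvg.const_mul _) (isPW_of_mem hψ).isReg, ipQ_smul_left, ipQ_smul_left]

/-- `⟨c₀ p + α ∇·u, ·⟩` as a functional on `Q_h`. -/
def dualInit {p : E d → ℝ} {u : E d → E d} (hp : p ∈ Qh M r kind) (hu : u ∈ Vh M r) :
    QhS M r kind →ₗ[ℝ] ℝ where
  toFun ψ := ipQ S.Ω (fun x => c.c₀ * p x + c.α * dvg u x) ψ.1
  map_add' ψ ψ' := ipQ_add_right (((isPW_of_mem hp).isReg.const_mul _).add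
    ((isPWV_of_mem hu).isReg_dvg.const_mul _)) (isPW_of_mem ψ.2).isReg (isPW_of_mem ψ'.2).isReg
  map_smul' s _ := ipQ_smul_right s _ _

end Functionals

/-! ### The discrete problem as a linear system -/

section Solution

variable {S : Setting d} {M : Mesh d S.Ω} {r k : ℕ} {kind : PressureKind} {c : Params} {T : ℝ}
  {a b : ℝ} {D : Data S kind} {u₀ v₀ : E d → E d} {p₀ : E d → ℝ}

/-- The quadrature evaluates only at nodes inside the half-open interval, where the functions agree
with their polynomials and `dt` with `pd`; initial terms enter through right-sided limits. The
scheme is thus exactly the abstract system for the coefficients. -/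
theorem isSolution_polyT_iff (R : GaussRadau k) (hab : a < b) (hu₀ : u₀ ∈ Vh M r)
    (hv₀ : v₀ ∈ Vh M r) (hp₀ : p₀ ∈ Qh M r kind) (G : ℝ → QhS M r kind →ₗ[ℝ] ℝ)
    (hG : ∀ t ψ, G t ψ = rhsG S M c T kind D t ψ.1) (U W : Fin (k + 1) → VhS M r)
    (P : Fin (k + 1) → QhS M r kind) :
    IsSolution S M c r kind D T R a b u₀ v₀ p₀ (polyT a b U) (polyT a b W) (polyT a b P) ↔
      (∀ Φ, eqU R a b (bilV S M r) U W Φ = (bilV S M r ⟨u₀, hu₀⟩ ∘ₗ pe a) Φ) ∧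
      (∀ X, eqV R a b c.ρ (bilV S M r) (bilA S M r c) (bilC S M r kind c) U W P X
        = (quadDual R a b (dualF c M r D) + c.ρ • bilV S M r ⟨v₀, hv₀⟩ ∘ₗ pe a :
          (Fin (k + 1) → VhS M r) →ₗ[ℝ] ℝ) X) ∧
      (∀ Ψ, eqP R a b c.c₀ (bilQ S M r kind) (bilB S M r kind c) (bilC S M r kind c) U P Ψ
        = (quadDual R a b G
          + (dualInit c hp₀ hu₀ - c.α • dualN M r kind (D.uD a)) ∘ₗ pe a :
          (Fin (k + 1) → QhS M r kind) →ₗ[ℝ] ℝ) Ψ) := by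
  have hV : ∀ {p : (ℝ → E d → E d) → Prop}, (∀ φ ∈ PolyT k a b (Vh M r), p φ) ↔
      ∀ Φ : Fin (k + 1) → VhS M r, p (polyT a b Φ) := fun {p} =>
    ⟨fun h Φ => h _ (polyT_mem Φ), fun h φ hφ => by
      obtain ⟨Φ, rfl⟩ := exists_polyT_eq (B := VhS M r) hφ
      exact h Φ⟩
  have hQ : ∀ {p : (ℝ → E d → ℝ) → Prop}, (∀ ψ ∈ PolyT k a b (Qh M r kind), p ψ) ↔
      ∀ Ψ : Fin (k + 1) → QhS M r kind, p (polyT a b Ψ) := fun {p} =>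
    ⟨fun h Φ => h _ (polyT_mem Φ), fun h φ hφ => by
      obtain ⟨Φ, rfl⟩ := exists_polyT_eq (B := QhS M r kind) hφ
      exact h Φ⟩
  have hU : polyT a b U ∈ PolyT k a b (Vh M r) := polyT_mem U
  have hW : polyT a b W ∈ PolyT k a b (Vh M r) := polyT_mem W
  have hP : polyT a b P ∈ PolyT k a b (Qh M r kind) := polyT_mem P
  simp only [IsSolution, hV, hQ, hU, hW, hP, true_and, plus_polyT hab]
  refine and_congr (forall_congr' fun Φ => ?_) (and_congr (forall_congr' fun X => ?_)
    (forall_congr' fun Ψ => ?_))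
  · rw [quad_congr R hab (g := fun t => bilV S M r (pd t U) (pe t Φ)
      - bilV S M r (pe t W) (pe t Φ))
      fun t ht => by rw [dt_polyT U ht, polyT_of_mem W ht, polyT_of_mem Φ ht]; rfl]
    rfl
  · rw [quad_congr R hab (g := fun t => c.ρ * bilV S M r (pd t W) (pe t X)
      + bilA S M r c (pe t U) (pe t X) + bilC S M r kind c (pe t X) (pe t P))
      fun t ht => by
        rw [dt_polyT W ht, polyT_of_mem U ht, polyT_of_mem X ht, polyT_of_mem P ht]; rfl,
      quad_congr R hab (f := fun t => rhsF S M c D t (polyT a b X t))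
        (g := fun t => dualF c M r D t (pe t X))
      fun t ht => by rw [polyT_of_mem X ht]; rfl]
    rfl
  · rw [quad_congr R hab (g := fun t => c.c₀ * bilQ S M r kind (pd t P) (pe t Ψ)
      - bilC S M r kind c (pd t U) (pe t Ψ) + bilB S M r kind c (pe t P) (pe t Ψ))
      fun t ht => by
        rw [dt_polyT P ht, dt_polyT U ht, polyT_of_mem P ht, polyT_of_mem Ψ ht]; rfl,
      quad_congr R hab (f := fun t => rhsG S M c T kind D t (polyT a b Ψ t))
        (g := fun t => G t (pe t Ψ))
      fun t ht => by rw [polyT_of_mem Ψ ht, hG],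
      ipQ_add_dvg_left c (pe a P).2 (pe a U).2 (pe a Ψ).2]
    -- The initial terms `α ⟨∇·u⁺, ψ⁺⟩ - α ⟨u⁺·n, ψ⁺⟩` are minus the coupling form at `(u⁺, ψ⁺)`.
    -- This matching of signs is what makes the energy cancellation possible.
    have e : eqP R a b c.c₀ (bilQ S M r kind) (bilB S M r kind c) (bilC S M r kind c) U P Ψ
        = R.quad a b (fun t => c.c₀ * bilQ S M r kind (pd t P) (pe t Ψ)
          - bilC S M r kind c (pd t U) (pe t Ψ) + bilB S M r kind c (pe t P) (pe t Ψ))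
        + (c.c₀ * ipQ S.Ω (pe a P).1 (pe a Ψ).1
          - (-c.α * ipQ S.Ω (dvg (pe a U).1) (pe a Ψ).1
            + c.α * bdryN S M (pe a U).1 (pe a Ψ).1)) := rfl
    have e' : (quadDual R a b G
          + (dualInit c hp₀ hu₀ - c.α • dualN M r kind (D.uD a)) ∘ₗ pe a :
          (Fin (k + 1) → QhS M r kind) →ₗ[ℝ] ℝ) Ψ
        = R.quad a b (fun t => G t (pe t Ψ))
        + (ipQ S.Ω (fun x => c.c₀ * p₀ x + c.α * dvg u₀ x) (pe a Ψ).1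
          - c.α * bdryN S M (D.uD a) (pe a Ψ).1) := rfl
    rw [e, e']
    constructor <;> intro h <;> linarith

/-- Existence and uniqueness pass from coefficients to functions because every element of `PolyT`
has the form `polyT`, so each competing solution comes from coefficients that solve the same system.
-/
theorem existsUnique_isSolution (R : GaussRadau k) (hab : a < b) (hρ : 0 < c.ρ) (hc : 0 < c.c₀)
    (hA : ∀ w ∈ Vh M r, 0 ≤ formA S M c w w) (hB : ∀ q ∈ Qh M r kind, 0 ≤ formB S M c kind q q)
    (D : Data S kind) (T : ℝ) (hu₀ : u₀ ∈ Vh M r) (hv₀ : v₀ ∈ Vh M r) (hp₀ : p₀ ∈ Qh M r kind) :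
    ∃! w : (ℝ → E d → E d) × (ℝ → E d → E d) × (ℝ → E d → ℝ),
      IsSolution S M c r kind D T R a b u₀ v₀ p₀ w.1 w.2.1 w.2.2 := by
  choose G hG using exists_dualG c M r T D
  have key := isSolution_polyT_iff R hab hu₀ hv₀ hp₀ G hG
  obtain ⟨x, hx, huniq⟩ := system_existsUnique R hab hρ hc (bilC S M r kind c)
    (m := bilV S M r) (A := bilA S M r c) (n := bilQ S M r kind) (D := bilB S M r kind c)
    (fun _ _ => ipV_comm _ _) bilV_pos (fun _ _ => formA_comm c _ _) (fun w => hA w.1 w.2)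
    (fun _ _ => ipQ_comm _ _) bilQ_pos
    (fun p q => formB_comm c (isPW_of_mem p.2) (isPW_of_mem q.2)) (fun q => hB q.1 q.2)
    (bilV S M r ⟨u₀, hu₀⟩ ∘ₗ pe a)
    (quadDual R a b (dualF c M r D) + c.ρ • bilV S M r ⟨v₀, hv₀⟩ ∘ₗ pe a)
    (quadDual R a b G + (dualInit c hp₀ hu₀ - c.α • dualN M r kind (D.uD a)) ∘ₗ pe a)
  refine ⟨(polyT a b x.1, polyT a b x.2.1, polyT a b x.2.2), (key _ _ _).2 hx, ?_⟩
  rintro ⟨u, v, p⟩ hw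
  obtain ⟨U, rfl⟩ := exists_polyT_eq (B := VhS M r) hw.1
  obtain ⟨W, rfl⟩ := exists_polyT_eq (B := VhS M r) hw.2.1
  obtain ⟨P, rfl⟩ := exists_polyT_eq (B := QhS M r kind) hw.2.2.1
  have e := huniq (U, W, P) ((key U W P).1 hw)
  subst e
  rfl

end Solution

end Biot

end

/-! ### Unique solvability from the penalty threshold -/

theorem mainTheorem2 (d : ℕ) (hd : d = 2 ∨ d = 3) (S : Biot.Setting d) (r : ℕ) (hr : 2 ≤ r)
    (σ : ℝ) :
    ∃ γ₀ : ℝ, ∀ M : Biot.Mesh d S.Ω, M.QuasiUniform σ →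
      ∀ c : Biot.Params, 0 < c.ρ → 0 < c.α → 0 < c.c₀ →
        γ₀ ≤ c.γa → γ₀ ≤ c.γb → γ₀ ≤ c.γ →
      ∀ (kind : Biot.PressureKind) (N : ℕ) (T : ℝ) (t : Fin (N + 1) → ℝ),
        StrictMono t → t 0 = 0 → t (Fin.last N) = T →
      ∀ D : Biot.Data S kind, DifferentiableOn ℝ D.uD (Set.Icc 0 T) →
      ∀ (k : ℕ) (R : Biot.GaussRadau k) (n : Fin N),
      ∀ u₀ ∈ Biot.Vh M r, ∀ v₀ ∈ Biot.Vh M r, ∀ p₀ ∈ Biot.Qh M r kind,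
        ∃! w : (ℝ → Biot.E d → Biot.E d) × (ℝ → Biot.E d → Biot.E d) × (ℝ → Biot.E d → ℝ),
          Biot.IsSolution S M c r kind D T R (t n.castSucc) (t n.succ) u₀ v₀ p₀
            w.1 w.2.1 w.2.2 := by
  obtain ⟨γ₀, hγ₀⟩ := Biot.exists_penalty S r σ
  refine ⟨γ₀, fun M hM c hρ _ hc ha hb hg kind N T t ht _ _ D _ k R n u₀ hu₀ v₀ hv₀ p₀ hp₀ => ?_⟩
  obtain ⟨hA, hB⟩ := hγ₀ M hM c ha hb hg
  exact Biot.existsUnique_isSolution R (ht n.castSucc_lt_succ) hρ hc hA (hB kind) D T hu₀ hv₀ hp₀
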